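/- Let $p$ and $q$ be relatively prime integers with $0<p<q$ and $p+q$ odd. A \emph{$(p,q)$-leaper} moves from a square $a\in\mathbb Z^2$ to any of the squares $a+(\pm p,\pm q)$, $a+(\pm q,\pm p)$; its \emph{leaper graph} over a set $B$ of squares (a board) has the squares of $B$ as vertices and joins two squares of $B$ by an edge when they are joined by a move, and $B$ is \emph{toured} by the leaper if this graph has a Hamiltonian cycle. An \emph{even continued fraction} is an expression \[[c_1\pm,c_2\pm,\ldots,c_k]=c_1\pm\cfrac{1}{c_2\pm\cfrac{1}{\ddots\pm\frac1{c_k}}}\] with $k\ge 1$, all $c_i$ even integers, $c_1\ge 0$, $c_2,\ldots,c_k>0$, and each sign chosen independently. The number $\frac qp$ has exactly one representation $\frac qp=[c_1\pm,c_2\pm,\ldots,c_k]$ as an even continued fraction. For $i=1,2,\ldots,k-1$ let $\frac{q_i}{p_i}=[c_{i+1}\pm,c_{i+2}\pm,\ldots,c_k]$ in lowest terms, and let $p_k=0$ and $q_k=1$. Then the leaper graph $G$ of the $(p,q)$-leaper over the $(p+q)\times(p+q)$ chessboard consists of $(q-p)^2$ isolated vertices and a number of disjoint cycles of $k$ distinct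 types $1,2,\ldots,k$ (that is, every connected component of $G$ is an isolated vertex or a cycle, each cycle has exactly one type, and two cycles are of the same type if and only if they are translation copies of each other). For each $i=1,\ldots,k$, $G$ contains exactly $(q_i-p_i)^2$ cycles of type $i$, all of which are translation copies of each other, and the set of squares of each of which is also toured by a $(p_i,q_i)$-leaper. -/

import Mathlib

namespace Leaper

/-- A square of the infinite chessboard, given by the integer coordinates of its centre. -/
abbrev Square := ℤ × ℤ

/-- `a` and `b` are joined by a move of a `(p, q)`-leaper:
`b - a` is one of `(±p, ±q)`, `(±q, ±p)`. -/
def IsMove (p q : ℕ) (a b : Square) : Prop :=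
  (|b.1 - a.1| = (p : ℤ) ∧ |b.2 - a.2| = (q : ℤ)) ∨
  (|b.1 - a.1| = (q : ℤ) ∧ |b.2 - a.2| = (p : ℤ))

/-- The leaper graph of a `(p, q)`-leaper over a board `B`. The condition `a ≠ b` is automatic
unless `p = q = 0`. -/
def graph (p q : ℕ) (B : Set Square) : SimpleGraph B where
  Adj a b := a ≠ b ∧ IsMove p q a b
  symm := ⟨fun a b h => ⟨h.1.symm, by
    have h2 := h.2
    simp only [IsMove] at h2 ⊢
    rwa [abs_sub_comm a.1.1 b.1.1, abs_sub_comm a.1.2 b.1.2]⟩⟩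
  loopless := ⟨fun _ h => h.1 rfl⟩

/-- The `n × n` chessboard. -/
def squareBoard (n : ℕ) : Set Square :=
  Set.Ico (0 : ℤ) n ×ˢ Set.Ico (0 : ℤ) n

/-- A `(p, q)`-leaper is skew. -/
def IsSkew (p q : ℕ) : Prop := p ≠ 0 ∧ q ≠ 0 ∧ p ≠ q

/-- A `(p, q)`-leaper is basic. -/
def IsBasic (p q : ℕ) : Prop := Odd (p + q) ∧ Nat.Coprime p q

/-- A connected component which, as a graph, is a cycle. -/
def IsCycleComponent {V : Type*} {G : SimpleGraph V} (K : G.ConnectedComponent) : Prop :=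
  ∃ n, 3 ≤ n ∧ Nonempty (K.toSimpleGraph ≃g SimpleGraph.cycleGraph n)

/-- The set of squares of a connected component of a graph over a board. -/
def squares {B : Set Square} {G : SimpleGraph B} (K : G.ConnectedComponent) : Set Square :=
  Subtype.val '' K.supp

/-- `T` is a copy of `S` under a translation. -/
def IsTranslate (S T : Set Square) : Prop :=
  ∃ v : Square, T = (fun a => a + v) '' S

/-- There is a closed tour (a Hamiltonian cycle) of a `(p, q)`-leaper over the board `S`. -/
def IsTouredBy (p q : ℕ) (S : Set Square) : Prop :=
  ∃ (a : S) (w : (graph p q S).Walk a a), w.IsHamiltonianCycle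

/-- An even continued fraction `[c₁±, c₂±, …, cₖ]`: `init` lists the terms `c₁, …, cₖ₋₁`, each
with the sign that follows it, and `last` is `cₖ`. All terms are even, and all terms but the first
are positive. -/
structure EvenCF where
  init : List (ℕ × ℤˣ)
  last : ℕ
  even : ∀ c ∈ init.map Prod.fst ++ [last], Even c
  pos : ∀ c ∈ (init.map Prod.fst ++ [last]).tail, 0 < c

/-- The value of `c₁ ± 1 / (c₂ ± 1 / (⋯ ± 1 / cₖ))`. -/
def cfValue (init : List (ℕ × ℤˣ)) (last : ℕ) : ℚ :=
  init.foldr (fun t r => (t.1 : ℚ) + ((t.2 : ℤ) : ℚ) / r) (last : ℚ)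

/-- The number `k` of terms. -/
def EvenCF.length (x : EvenCF) : ℕ := x.init.length + 1

/-- The value of an even continued fraction. -/
def EvenCF.value (x : EvenCF) : ℚ := cfValue x.init x.last

/-- The value of the tail `[cᵢ₊₁±, …, cₖ]`, for `0 ≤ i < k`. -/
def EvenCF.tailValue (x : EvenCF) (i : ℕ) : ℚ := cfValue (x.init.drop i) x.last

/-- The proportion `pᵢ`: the denominator of the tail `[cᵢ₊₁±, …, cₖ]` in lowest terms
for `i < k`, and `pₖ = 0`. -/
def EvenCF.p (x : EvenCF) (i : ℕ) : ℕ :=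
  if i < x.length then (x.tailValue i).den else 0

/-- The proportion `qᵢ`: the numerator of the tail `[cᵢ₊₁±, …, cₖ]` in lowest terms (a positive
integer for `1 ≤ i < k`), and `qₖ = 1`. -/
def EvenCF.q (x : EvenCF) (i : ℕ) : ℕ :=
  if i < x.length then (x.tailValue i).num.toNat else 1

end Leaper

/-! The proof is an induction along the continued fraction, one term at a time. Write `q = 2mp + s`
with `m ≥ 1` and `|s| < p`, and put `r = |s|`, so that `q/p = 2m ± r/p`. The components of the `(r,
p)`-leaper on its board of side `p + r` correspond to those components of the `(p, q)`-leaper on its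
board of side `p + q` which are not isolated central squares. Each term thus shifts all types by one
and adds the `(q - p)²` isolated squares as the new type `0`; the induction starts from the `(0,
1)`-leaper on a single square.

The correspondence. The moves `(±q, ±p)` alternate between the `p` leftmost and the `p` rightmost
columns and form vertical zigzags; the moves `(±p, ±q)` form horizontal ones. Slide the four `p × p`
corners of the big board together by `q - s`, so that they overlap and cover the small board. Two
moves of a vertical zigzag rise by `2p`, and `2mp = q - s`. Hence a zigzag that crosses the board in
`2m` moves joins corner squares which come to coincide, and one that needs `2m ± 1` moves joins
corner squares which come to differ by `(±s, ±p)`, a move of the small leaper. `Rep` relates small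
squares to the big squares on their zigzags; `Rep.conn_small` and `Rep.conn_big_of_conn` show that
it respects components, which gives `isComp_lift`, `exists_lift_eq` and `lift_injective`. By
`isTranslate_lift` and `isTranslate_of_lift`, translation copies correspond to translation copies.

Tours. Along a side of the big board, the lift of a component `C` is a stack of translates of two
windows of `C`, taken alternately. A tour of `C` by some `(P, Q)`-leaper is cut at the corners and
sides into arcs (`ArcTour`), with the extra condition that the moves of the `(r, p)`-leaper, as
translations, carry the arcs of a side to those of the opposite side in the order of the tour. This
condition makes the stacked windows join up (`rail`) into a tour of the lift by the same `(P,
Q)`-leaper, and it holds again for the lift. For an isolated square every window is a single square,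
consecutive ones differ by `(±s, p)`, and the lift is toured by the `(r, p)`-leaper.

`Lifting` collects these facts, `Classified.succ` is the induction step and `classified_cfValue`
runs it. Components are cycles because every non-central square has exactly two moves
(`exists_two_neighbors`). The continued fraction is unique because its terms are even while each
remainder is below `1` in absolute value. -/

namespace Leaper

/-! ### Moves, paths and components over a board. -/

/-- Moves of a leaper whose proportions are arbitrary integers. -/
def Mv (p q : ℤ) (a b : Square) : Prop :=
  ((b.1 = a.1 + p ∨ b.1 = a.1 - p) ∧ (b.2 = a.2 + q ∨ b.2 = a.2 - q)) ∨
  ((b.1 = a.1 + q ∨ b.1 = a.1 - q) ∧ (b.2 = a.2 + p ∨ b.2 = a.2 - p))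

theorem isMove_iff_mv {p q : ℕ} {a b : Square} : IsMove p q a b ↔ Mv p q a b := by
  have key : ∀ (x y : ℤ) (n : ℕ), |y - x| = (n : ℤ) ↔ (y = x + n ∨ y = x - n) := by
    intro x y n
    rw [abs_eq (by positivity)]
    omega
  simp only [IsMove, Mv, key]

theorem Mv.symm {p q : ℤ} {a b : Square} (h : Mv p q a b) : Mv p q b a := by
  unfold Mv at *; omega

theorem mv_neg {p q : ℤ} {a b : Square} : Mv (-p) q a b ↔ Mv p q a b := by
  unfold Mv; omega

theorem Mv.add {p q : ℤ} {a b : Square} (h : Mv p q a b) (v : Square) :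
    Mv p q (a + v) (b + v) := by
  unfold Mv at *; simp only [Prod.fst_add, Prod.snd_add]; omega

theorem Mv.swap {p q : ℤ} {a b : Square} (h : Mv p q a b) : Mv p q a.swap b.swap := by
  unfold Mv at *; simp only [Prod.fst_swap, Prod.snd_swap]; omega

/-- Two squares of a board joined by a move. -/
def Link (p q : ℤ) (B : Set Square) (a b : Square) : Prop := a ∈ B ∧ b ∈ B ∧ Mv p q a b

/-- Two squares joined by a sequence of moves within a board. -/
def Conn (p q : ℤ) (B : Set Square) : Square → Square → Prop :=
  Relation.ReflTransGen (Link p q B)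

theorem Link.symm {p q : ℤ} {B : Set Square} {a b : Square} (h : Link p q B a b) :
    Link p q B b a := ⟨h.2.1, h.1, h.2.2.symm⟩

theorem Link.conn {p q : ℤ} {B : Set Square} {a b : Square} (h : Link p q B a b) :
    Conn p q B a b := Relation.ReflTransGen.single h

theorem Conn.refl {p q : ℤ} {B : Set Square} (a : Square) : Conn p q B a a :=
  Relation.ReflTransGen.refl

theorem Conn.symm {p q : ℤ} {B : Set Square} {a b : Square} (h : Conn p q B a b) :
    Conn p q B b a := by
  induction h with
  | refl => exact .refl _
  | tail _ h ih => exact Relation.ReflTransGen.head h.symm ih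

theorem Conn.trans {p q : ℤ} {B : Set Square} {a b c : Square} (h : Conn p q B a b)
    (h' : Conn p q B b c) : Conn p q B a c := Relation.ReflTransGen.trans h h'

theorem Conn.mem {p q : ℤ} {B : Set Square} {a b : Square} (h : Conn p q B a b) (ha : a ∈ B) :
    b ∈ B := by
  induction h with
  | refl => exact ha
  | tail _ h _ => exact h.2.1

/-- The set of squares of a connected component of the leaper graph over a board. -/
def IsComp (p q : ℤ) (B : Set Square) (S : Set Square) : Prop :=
  ∃ a ∈ B, S = {b | Conn p q B a b}

namespace IsComp
variable {p q : ℤ} {B S S' : Set Square} {a b : Square}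

theorem subset (h : IsComp p q B S) : S ⊆ B := by
  obtain ⟨a, ha, rfl⟩ := h
  exact fun b hb => Conn.mem hb ha

theorem eq_of_mem (h : IsComp p q B S) (ha : a ∈ S) : S = {b | Conn p q B a b} := by
  obtain ⟨c, hc, rfl⟩ := h
  ext b
  exact ⟨fun hb => (Conn.symm ha).trans hb, fun hb => Conn.trans ha hb⟩

theorem mem_of_conn (h : IsComp p q B S) (ha : a ∈ S) (hab : Conn p q B a b) : b ∈ S := by
  rw [h.eq_of_mem ha]; exact hab

theorem conn (h : IsComp p q B S) (ha : a ∈ S) (hb : b ∈ S) : Conn p q B a b := by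
  rw [h.eq_of_mem ha] at hb; exact hb

theorem mem_of_mv (h : IsComp p q B S) (ha : a ∈ S) (hb : b ∈ B) (hab : Mv p q a b) : b ∈ S :=
  h.mem_of_conn ha (Link.conn ⟨h.subset ha, hb, hab⟩)

theorem nonempty (h : IsComp p q B S) : S.Nonempty := by
  obtain ⟨a, _, rfl⟩ := h
  exact ⟨a, .refl a⟩

theorem eq_of_mem_of_mem (h : IsComp p q B S) (h' : IsComp p q B S') (ha : a ∈ S) (ha' : a ∈ S') :
    S = S' := by
  rw [h.eq_of_mem ha, h'.eq_of_mem ha']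

end IsComp

theorem isComp_conn {p q : ℤ} {B : Set Square} {a : Square} (ha : a ∈ B) :
    IsComp p q B {b | Conn p q B a b} := ⟨a, ha, rfl⟩

/-! ### Zigzags, and the correspondence between the squares of the small and the big board. -/

/-- The `(p + q) × (p + q)` board. -/
def bigBoard (p q : ℤ) : Set Square :=
  {a | 0 ≤ a.1 ∧ a.1 < p + q ∧ 0 ≤ a.2 ∧ a.2 < p + q}

/-- The `(p + |s|) × (p + |s|)` board, placed so that it covers both `[0, p)²` and
`[s, p + s)²`. -/
def smallBoard (p s : ℤ) : Set Square :=
  {z | min s 0 ≤ z.1 ∧ z.1 < p + max s 0 ∧ min s 0 ≤ z.2 ∧ z.2 < p + max s 0}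

/-- The squares reached from column `x`, row `y` by zigzagging between the two vertical sides
of the board. -/
def Zigzag (p q x y : ℤ) (a : Square) : Prop :=
  0 ≤ x ∧ x < p ∧
    ∃ i : ℤ, a = (x, y + 2 * (i * p)) ∨ a = (x + q, y + 2 * (i * p) + p)

/-- The square `a` of the big board lies on one of the vertical trips attached to the square `z`
of the small board. -/
def VRep (p q s : ℤ) (z a : Square) : Prop :=
  Zigzag p q z.1 z.2 a ∨ Zigzag p q (z.1 - s) (z.2 + p) a

/-- The square `a` of the big board represents the square `z` of the small board. -/
def Rep (p q s : ℤ) (z a : Square) : Prop :=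
  z ∈ smallBoard p s ∧ a ∈ bigBoard p q ∧ (VRep p q s z a ∨ VRep p q s z.swap a.swap)

/-- The numerical assumptions under which components are lifted from the small board of an
`(|s|, p)`-leaper to the big board of a `(p, q)`-leaper. -/
structure Params (p q s m : ℤ) : Prop where
  p_pos : 0 < p
  s_lo : -p < s
  s_hi : s < p
  m_pos : 1 ≤ m
  q_eq : q = 2 * (m * p) + s

theorem Params.le_mul {p q s m : ℤ} (h : Params p q s m) : p ≤ m * p := by
  nlinarith [h.p_pos, h.m_pos]

theorem Params.p_lt_q {p q s m : ℤ} (h : Params p q s m) : p < q := by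
  have := h.le_mul; have := h.q_eq; have := h.s_lo; omega

theorem swap_mem_smallBoard {p s : ℤ} {z : Square} :
    z.swap ∈ smallBoard p s ↔ z ∈ smallBoard p s := by
  simp only [smallBoard, Set.mem_ofPred_eq, Prod.fst_swap, Prod.snd_swap]; omega

theorem swap_mem_bigBoard {p q : ℤ} {z : Square} :
    z.swap ∈ bigBoard p q ↔ z ∈ bigBoard p q := by
  simp only [bigBoard, Set.mem_ofPred_eq, Prod.fst_swap, Prod.snd_swap]; omega

theorem Rep.swap {p q s : ℤ} {z a : Square} (h : Rep p q s z a) :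
    Rep p q s z.swap a.swap :=
  ⟨swap_mem_smallBoard.2 h.1, swap_mem_bigBoard.2 h.2.1, by simpa using h.2.2.symm⟩

theorem Conn.swap {p q : ℤ} {B : Set Square} (hB : ∀ a : Square, a ∈ B → a.swap ∈ B)
    {a b : Square} (h : Conn p q B a b) : Conn p q B a.swap b.swap := by
  induction h with
  | refl => exact .refl _
  | tail _ h ih => exact ih.tail ⟨hB _ h.1, hB _ h.2.1, h.2.2.swap⟩

theorem Conn.swap_big {p q : ℤ} {a b : Square} (h : Conn p q (bigBoard p q) a b) :
    Conn p q (bigBoard p q) a.swap b.swap := h.swap fun _ => swap_mem_bigBoard.2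

theorem Conn.swap_small {p s : ℤ} {a b : Square} (h : Conn s p (smallBoard p s) a b) :
    Conn s p (smallBoard p s) a.swap b.swap := h.swap fun _ => swap_mem_smallBoard.2

section Correspondence
variable {p q s m : ℤ}

/-- The board has width `p + q` and `p < q`, so a horizontal step of length `q` can only switch
between the two columns of the zigzag. -/
theorem Zigzag.of_mv {x y : ℤ} {a b : Square} (H : Params p q s m)
    (h : Zigzag p q x y a) (hb : b ∈ bigBoard p q)
    (h1 : b.1 = a.1 + q ∨ b.1 = a.1 - q) (h2 : b.2 = a.2 + p ∨ b.2 = a.2 - p) :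
    Zigzag p q x y b := by
  obtain ⟨b1, b2⟩ := b
  have := H.p_lt_q
  have := H.p_pos
  simp only [bigBoard, Set.mem_ofPred_eq] at *
  obtain ⟨hx, hx', i, rfl | rfl⟩ := h
  · simp only at h1 h2
    have h3 : b1 = x + q := by omega
    rcases h2 with h2 | h2
    · exact ⟨hx, hx', i, Or.inr (by rw [h3, h2])⟩
    · refine ⟨hx, hx', i - 1, Or.inr ?_⟩
      rw [h3, h2]; ext <;> simp; ring
  · simp only at h1 h2
    have h3 : b1 = x := by omega
    rcases h2 with h2 | h2
    · refine ⟨hx, hx', i + 1, Or.inl ?_⟩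
      rw [h3, h2]; ext <;> simp; ring
    · refine ⟨hx, hx', i, Or.inl ?_⟩
      rw [h3, h2]; ext <;> simp

theorem VRep.of_mv {z a b : Square} (H : Params p q s m)
    (h : VRep p q s z a) (hb : b ∈ bigBoard p q)
    (h1 : b.1 = a.1 + q ∨ b.1 = a.1 - q) (h2 : b.2 = a.2 + p ∨ b.2 = a.2 - p) :
    VRep p q s z b :=
  h.imp (fun h => h.of_mv H hb h1 h2) (fun h => h.of_mv H hb h1 h2)

theorem Zigzag.conn_add {x y : ℤ} (H : Params p q s m) (hx : 0 ≤ x) (hx' : x < p) (n : ℕ)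
    (h0 : 0 ≤ y) (h1 : y + 2 * (n * p) < p + q) :
    Conn p q (bigBoard p q) (x, y) (x, y + 2 * (n * p)) := by
  have := H.p_lt_q
  have := H.p_pos
  induction n with
  | zero => simpa using Conn.refl _
  | succ n ih =>
    push_cast at h1 ⊢
    have h2 : 0 ≤ n * p := by positivity
    have h3 : (n + 1 : ℤ) * p = n * p + p := by ring
    rw [h3] at h1 ⊢
    clear h3
    refine (ih (by omega)).trans (Conn.trans (b := (x + q, y + 2 * (n * p) + p)) ?_ ?_)
    · refine Link.conn ⟨?_, ?_, Or.inr ⟨Or.inl rfl, Or.inl rfl⟩⟩ <;>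
        simp only [bigBoard, Set.mem_ofPred_eq] <;> omega
    · refine Link.conn ⟨?_, ?_, ?_⟩ <;> simp only [bigBoard, Mv, Set.mem_ofPred_eq] <;> omega

theorem Zigzag.conn_left {x y y' : ℤ} (H : Params p q s m) (hx : 0 ≤ x) (hx' : x < p) {i : ℤ}
    (h : y' = y + 2 * (i * p)) (h0 : 0 ≤ y) (h1 : y < p + q) (h0' : 0 ≤ y') (h1' : y' < p + q) :
    Conn p q (bigBoard p q) (x, y) (x, y') := by
  rcases le_total 0 i with hi | hi
  · lift i to ℕ using hi
    subst h
    exact conn_add H hx hx' i h0 h1'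
  · obtain ⟨j, rfl⟩ : ∃ j : ℤ, i = -j := ⟨-i, by ring⟩
    have hj : 0 ≤ j := by omega
    lift j to ℕ using hj
    have : y = y' + 2 * (j * p) := by rw [h]; ring
    subst this
    exact (conn_add H hx hx' j h0' h1).symm

theorem Zigzag.conn {x y : ℤ} {a b : Square} (H : Params p q s m)
    (ha : Zigzag p q x y a) (hb : Zigzag p q x y b) (hab : a ∈ bigBoard p q)
    (hbb : b ∈ bigBoard p q) : Conn p q (bigBoard p q) a b := by
  have hpq := H.p_lt_q
  have hp := H.p_pos
  have key : ∀ c : Square, Zigzag p q x y c → c ∈ bigBoard p q →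
      ∃ i : ℤ, (x, y + 2 * (i * p)) ∈ bigBoard p q ∧
        Conn p q (bigBoard p q) c (x, y + 2 * (i * p)) := by
    intro c hc hcb
    obtain ⟨hx, hx', i, rfl | rfl⟩ := hc
    · exact ⟨i, hcb, .refl _⟩
    · simp only [bigBoard, Set.mem_ofPred_eq] at hcb
      -- A right-hand square is joined to the left-hand square one step below it or, if that is off
      -- the board, to the one above.
      by_cases h : 0 ≤ y + 2 * (i * p)
      · refine ⟨i, ?_, Link.conn ⟨?_, ?_, ?_⟩⟩ <;>
          simp only [bigBoard, Mv, Set.mem_ofPred_eq] <;> omega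
      · have e : (i + 1) * p = i * p + p := by ring
        refine ⟨i + 1, ?_, Link.conn ⟨?_, ?_, ?_⟩⟩ <;> (try rw [e]) <;>
          simp only [bigBoard, Mv, Set.mem_ofPred_eq] <;> omega
  obtain ⟨i, hi, hai⟩ := key a ha hab
  obtain ⟨j, hj, hbj⟩ := key b hb hbb
  refine hai.trans (Conn.trans ?_ hbj.symm)
  simp only [bigBoard, Set.mem_ofPred_eq] at hi hj
  exact Zigzag.conn_left H ha.1 ha.2.1 (i := j - i) (by ring) (by omega) (by omega) (by omega)
    (by omega)

theorem Zigzag.unique {x y x' y' : ℤ} {a : Square} (H : Params p q s m)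
    (h : Zigzag p q x y a) (h' : Zigzag p q x' y' a) :
    x = x' ∧ ∃ i : ℤ, y' = y + 2 * (i * p) := by
  have hpq := H.p_lt_q
  obtain ⟨hx, hx1, i, hi⟩ := h
  obtain ⟨hx', hx1', j, hj⟩ := h'
  have e : (i - j) * p = i * p - j * p := by ring
  rcases hi with rfl | rfl <;> rcases hj with hj | hj <;> simp only [Prod.mk.injEq] at hj
  · exact ⟨hj.1, i - j, by rw [e]; omega⟩
  · omega
  · omega
  · exact ⟨by omega, i - j, by rw [e]; omega⟩

/-- A zigzag determines its column, and its row modulo `2p`. The small board has fewer than `2p`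
rows, so two small squares attached to a zigzag from the same side coincide, and two attached from
opposite sides differ by `(±s, ±p)`. -/
theorem VRep.conn_small {z z' a : Square} (H : Params p q s m)
    (hz : z ∈ smallBoard p s) (hz' : z' ∈ smallBoard p s)
    (h : VRep p q s z a) (h' : VRep p q s z' a) : Conn s p (smallBoard p s) z z' := by
  have hp := H.p_pos
  have h1 := H.s_lo
  have h2 := H.s_hi
  obtain ⟨X, Y⟩ := z
  obtain ⟨X', Y'⟩ := z'
  -- The products `i * p` are opaque to `omega`; these bounds exclude every `i` outside `-1`, `0`,
  -- `1`.
  have pos : ∀ i : ℤ, 1 ≤ i → p ≤ i * p := fun i hi => by nlinarith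
  have neg : ∀ i : ℤ, i ≤ -1 → i * p ≤ -p := fun i hi => by nlinarith
  have neg2 : ∀ i : ℤ, i ≤ -2 → i * p ≤ -(2 * p) := fun i hi => by nlinarith
  have pos2 : ∀ i : ℤ, 2 ≤ i → 2 * p ≤ i * p := fun i hi => by nlinarith
  have hzz := hz
  have hzz' := hz'
  simp only [smallBoard, Set.mem_ofPred_eq] at hzz hzz'
  have tri : ∀ i : ℤ, i ≤ -2 ∨ i = -1 ∨ i = 0 ∨ i = 1 ∨ 2 ≤ i := by intro i; omega
  rcases h with h | h <;> rcases h' with h' | h' <;>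
    obtain ⟨hx, i, hi⟩ := Zigzag.unique H h h' <;> simp only at hx hi <;>
    have a1 := pos i <;> have a2 := pos2 i <;> have a3 := neg i <;> have a4 := neg2 i
  · have : Y' = Y := by
      rcases tri i with h | h | h | h | h
      · omega
      · omega
      · rw [h] at hi; omega
      · omega
      · omega
    subst this; subst hx; exact .refl _
  · refine Link.conn ⟨hz, hz', ?_⟩
    have : Y' = Y + p ∨ Y' = Y - p := by
      rcases tri i with h | h | h | h | h
      · omega
      · omega
      · rw [h] at hi; omega
      · rw [h] at hi; omega
      · omega
    unfold Mv; simp only; omega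
  · refine Link.conn ⟨hz, hz', ?_⟩
    have : Y' = Y + p ∨ Y' = Y - p := by
      rcases tri i with h | h | h | h | h
      · omega
      · rw [h] at hi; omega
      · rw [h] at hi; omega
      · omega
      · omega
    unfold Mv; simp only; omega
  · have : Y' = Y := by
      rcases tri i with h | h | h | h | h
      · omega
      · omega
      · rw [h] at hi; omega
      · omega
      · omega
    have : X' = X := by omega
    subst this; subst Y'; exact .refl _

end Correspondence
end Leaper

namespace Leaper
section Correspondence
variable {p q s m : ℤ}

theorem VRep.outer {z a : Square} (H : Params p q s m) (h : VRep p q s z a) :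
    0 ≤ a.1 ∧ a.1 < p ∨ q ≤ a.1 ∧ a.1 < p + q := by
  have := H.p_lt_q
  rcases h with ⟨h1, h2, i, rfl | rfl⟩ | ⟨h1, h2, i, rfl | rfl⟩ <;> simp only <;> omega

theorem exists_vRep {a : Square} (H : Params p q s m) (ha : a ∈ bigBoard p q)
    (h : a.1 < p ∨ q ≤ a.1) : ∃ z ∈ smallBoard p s, VRep p q s z a := by
  obtain ⟨x, y⟩ := a
  simp only [bigBoard, Set.mem_ofPred_eq] at ha h
  have hp := H.p_pos
  have h1 := Int.emod_nonneg y hp.ne'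
  have h2 := Int.emod_lt_of_pos y hp
  have h3 := Int.mul_ediv_add_emod y p
  have e : ∀ i : ℤ, p * (i + i) = 2 * (i * p) := fun i => by ring
  have e' : ∀ i : ℤ, p * (2 * i + 1) = 2 * (i * p) + p := fun i => by ring
  have e'' : ∀ i : ℤ, (i - 1) * p = i * p - p := fun i => by ring
  -- The parity of the level `y / p` tells whether a bottom square of the zigzag lies in the same
  -- outer columns as `a` or in the opposite ones.
  rcases Int.even_or_odd (y / p) with ⟨i, hi⟩ | ⟨i, hi⟩ <;> rw [hi] at h3 <;>
    first | rw [e] at h3 | rw [e'] at h3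
  · rcases h with h | h
    · refine ⟨(x, y % p), ?_, Or.inl ⟨ha.1, h, i, Or.inl ?_⟩⟩
      · simp only [smallBoard, Set.mem_ofPred_eq]; omega
      · ext <;> simp only; omega
    · refine ⟨(x - q + s, y % p), ?_, Or.inr ⟨?_, ?_, i - 1, Or.inr ?_⟩⟩
      · simp only [smallBoard, Set.mem_ofPred_eq]; omega
      · simp only; omega
      · simp only; omega
      · rw [e'']; ext <;> simp only <;> omega
  · rcases h with h | h
    · refine ⟨(x + s, y % p), ?_, Or.inr ⟨?_, ?_, i, Or.inl ?_⟩⟩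
      · simp only [smallBoard, Set.mem_ofPred_eq]; omega
      · simp only; omega
      · simp only; omega
      · ext <;> simp only <;> omega
    · refine ⟨(x - q, y % p), ?_, Or.inl ⟨?_, ?_, i, Or.inr ?_⟩⟩
      · simp only [smallBoard, Set.mem_ofPred_eq]; omega
      · simp only; omega
      · simp only; omega
      · ext <;> simp only <;> omega

/-- The conditions under which a square of the small board has a corner representative on the
left, on the right, at the bottom, or at the top. -/
theorem zigzag_corner (H : Params p q s m) (X Y : ℤ) :
    (0 ≤ X → X < p → Zigzag p q X Y (X, Y) ∧ Zigzag p q X Y (X, Y - s + q)) ∧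
    (s ≤ X → X < p + s → Zigzag p q (X - s) (Y + p) (X - s + q, Y) ∧
      Zigzag p q (X - s) (Y + p) (X - s + q, Y - s + q)) := by
  have hq := H.q_eq
  have e : (m - 1) * p = m * p - p := by ring
  refine ⟨fun h1 h2 => ⟨⟨h1, h2, 0, Or.inl ?_⟩, ⟨h1, h2, m, Or.inl ?_⟩⟩,
    fun h1 h2 => ⟨⟨by omega, by omega, -1, Or.inr ?_⟩, ⟨by omega, by omega, m - 1, Or.inr ?_⟩⟩⟩
  · simp
  · ext <;> simp only; omega
  · ext <;> simp only; omega
  · rw [e]; ext <;> simp only; omega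

/-- Sliding the corners together by `q - s` matches a corner square with one small square, to which
both its vertical and its horizontal zigzag are attached. The two kinds of trip are compared only in
corners. -/
theorem exists_corner_rep {a : Square} (H : Params p q s m) (ha : a ∈ bigBoard p q)
    (h : a.1 < p ∨ q ≤ a.1) (h' : a.2 < p ∨ q ≤ a.2) :
    ∃ z ∈ smallBoard p s, VRep p q s z a ∧ VRep p q s z.swap a.swap := by
  obtain ⟨x, y⟩ := a
  simp only [bigBoard, Set.mem_ofPred_eq] at ha h h'
  have e1 : x = x - q + s - s + q := by ring
  have e2 : y = y - q + s - s + q := by ring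
  rcases h with h | h <;> rcases h' with h' | h'
  · refine ⟨(x, y), ?_, Or.inl ?_, Or.inl ?_⟩
    · simp only [smallBoard, Set.mem_ofPred_eq]; omega
    · exact ((zigzag_corner H x y).1 (by omega) (by omega)).1
    · exact ((zigzag_corner H y x).1 (by omega) (by omega)).1
  · refine ⟨(x, y - q + s), ?_, Or.inl ?_, Or.inr ?_⟩
    · simp only [smallBoard, Set.mem_ofPred_eq]; omega
    · have := ((zigzag_corner H x (y - q + s)).1 (by omega) (by omega)).2
      rwa [← e2] at this
    · have := ((zigzag_corner H (y - q + s) x).2 (by omega) (by omega)).1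
      rwa [← e2] at this
  · refine ⟨(x - q + s, y), ?_, Or.inr ?_, Or.inl ?_⟩
    · simp only [smallBoard, Set.mem_ofPred_eq]; omega
    · have := ((zigzag_corner H (x - q + s) y).2 (by omega) (by omega)).1
      rwa [← e1] at this
    · have := ((zigzag_corner H y (x - q + s)).1 (by omega) (by omega)).2
      rwa [← e1] at this
  · refine ⟨(x - q + s, y - q + s), ?_, Or.inr ?_, Or.inr ?_⟩
    · simp only [smallBoard, Set.mem_ofPred_eq]; omega
    · have := ((zigzag_corner H (x - q + s) (y - q + s)).2 (by omega) (by omega)).2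
      rwa [← e1, ← e2] at this
    · have := ((zigzag_corner H (y - q + s) (x - q + s)).2 (by omega) (by omega)).2
      rwa [← e1, ← e2] at this

/-- If one representation is vertical and the other horizontal, the big square lies in a corner, and
the small square given by `exists_corner_rep` mediates. -/
theorem Rep.conn_small {z z' a : Square} (H : Params p q s m) (h : Rep p q s z a)
    (h' : Rep p q s z' a) : Conn s p (smallBoard p s) z z' := by
  have key : ∀ {z z' a : Square}, Rep p q s z a → Rep p q s z' a → VRep p q s z a →
      VRep p q s z'.swap a.swap → Conn s p (smallBoard p s) z z' := by
    intro z z' a h h' hv hh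
    have o1 := hv.outer H
    have o2 := hh.outer H
    simp only [Prod.fst_swap] at o2
    obtain ⟨w, hw, hwv, hwh⟩ := exists_corner_rep H h.2.1 (by omega) (by omega)
    refine (VRep.conn_small H h.1 hw hv hwv).trans ?_
    simpa using (VRep.conn_small H (swap_mem_smallBoard.2 hw) (swap_mem_smallBoard.2 h'.1)
      hwh hh).swap_small
  rcases h.2.2 with hv | hv <;> rcases h'.2.2 with hv' | hv'
  · exact VRep.conn_small H h.1 h'.1 hv hv'
  · exact key h h' hv hv'
  · exact (key h' h hv' hv).symm
  · simpa using (VRep.conn_small H (swap_mem_smallBoard.2 h.1) (swap_mem_smallBoard.2 h'.1)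
      hv hv').swap_small

theorem exists_rep {z : Square} (H : Params p q s m) (hz : z ∈ smallBoard p s) :
    ∃ a ∈ bigBoard p q, VRep p q s z a ∧ VRep p q s z.swap a.swap := by
  obtain ⟨X, Y⟩ := z
  have hp := H.p_pos
  have hq := H.p_lt_q
  have hlo := H.s_lo
  have hhi := H.s_hi
  simp only [smallBoard, Set.mem_ofPred_eq] at hz
  by_cases hX : 0 ≤ X ∧ X < p <;> by_cases hY : 0 ≤ Y ∧ Y < p
  · refine ⟨(X, Y), ?_, Or.inl ((zigzag_corner H X Y).1 hX.1 hX.2).1,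
      Or.inl ((zigzag_corner H Y X).1 hY.1 hY.2).1⟩
    simp only [bigBoard, Set.mem_ofPred_eq]; omega
  · refine ⟨(X, Y - s + q), ?_, Or.inl ((zigzag_corner H X Y).1 hX.1 hX.2).2,
      Or.inr ((zigzag_corner H Y X).2 (by omega) (by omega)).1⟩
    simp only [bigBoard, Set.mem_ofPred_eq]; omega
  · refine ⟨(X - s + q, Y), ?_, Or.inr ((zigzag_corner H X Y).2 (by omega) (by omega)).1,
      Or.inl ((zigzag_corner H Y X).1 hY.1 hY.2).2⟩
    simp only [bigBoard, Set.mem_ofPred_eq]; omega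
  · refine ⟨(X - s + q, Y - s + q), ?_, Or.inr ((zigzag_corner H X Y).2 (by omega) (by omega)).2,
      Or.inr ((zigzag_corner H Y X).2 (by omega) (by omega)).2⟩
    simp only [bigBoard, Set.mem_ofPred_eq]; omega

/-- A vertical and a horizontal zigzag attached to the same small square cross in a corner of the
big board; the four cases are the four corners. -/
theorem conn_of_vRep_of_vRep_swap {z a b : Square} (H : Params p q s m)
    (ha : a ∈ bigBoard p q) (hb : b ∈ bigBoard p q)
    (h : VRep p q s z a) (h' : VRep p q s z.swap b.swap) : Conn p q (bigBoard p q) a b := by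
  obtain ⟨X, Y⟩ := z
  have hp := H.p_pos
  have hq := H.p_lt_q
  have hlo := H.s_lo
  have hhi := H.s_hi
  have key : ∀ (x y x' y' : ℤ) (c : Square), Zigzag p q x y a → Zigzag p q x' y' b.swap →
      Zigzag p q x y c → Zigzag p q x' y' c.swap → c ∈ bigBoard p q →
      Conn p q (bigBoard p q) a b := by
    intro x y x' y' c h1 h2 h3 h4 hc
    refine (Zigzag.conn H h1 h3 ha hc).trans ?_
    simpa using (Zigzag.conn H h4 h2 (swap_mem_bigBoard.2 hc) (swap_mem_bigBoard.2 hb)).swap_big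
  rcases h with h | h <;> rcases h' with h' | h' <;> have h1 := h.1 <;> have h2 := h.2.1 <;>
    have h3 := h'.1 <;> have h4 := h'.2.1 <;> simp only [Prod.fst_swap] at h1 h2 h3 h4
  · refine key _ _ _ _ (X, Y) h h' ((zigzag_corner H X Y).1 h1 h2).1
      ((zigzag_corner H Y X).1 h3 h4).1 ?_
    simp only [bigBoard, Set.mem_ofPred_eq]; omega
  · refine key _ _ _ _ (X, Y - s + q) h h' ((zigzag_corner H X Y).1 h1 h2).2
      ((zigzag_corner H Y X).2 (by omega) (by omega)).1 ?_
    simp only [bigBoard, Set.mem_ofPred_eq]; omega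
  · refine key _ _ _ _ (X - s + q, Y) h h' ((zigzag_corner H X Y).2 (by omega) (by omega)).1
      ((zigzag_corner H Y X).1 h3 h4).2 ?_
    simp only [bigBoard, Set.mem_ofPred_eq]; omega
  · refine key _ _ _ _ (X - s + q, Y - s + q) h h'
      ((zigzag_corner H X Y).2 (by omega) (by omega)).2
      ((zigzag_corner H Y X).2 (by omega) (by omega)).2 ?_
    simp only [bigBoard, Set.mem_ofPred_eq]; omega

theorem Rep.conn_big {z a b : Square} (H : Params p q s m) (h : Rep p q s z a)
    (h' : Rep p q s z b) : Conn p q (bigBoard p q) a b := by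
  obtain ⟨c, hc, hv, hh⟩ := exists_rep H h.1
  have key : ∀ {a}, Rep p q s z a → Conn p q (bigBoard p q) a c := by
    intro a h
    rcases h.2.2 with h1 | h1
    · exact conn_of_vRep_of_vRep_swap H h.2.1 hc h1 hh
    · exact (conn_of_vRep_of_vRep_swap H hc h.2.1 hv h1).symm
  exact (key h).trans (key h').symm

/-- A move `(±q, ±p)` stays on a vertical zigzag. A square that is represented only horizontally and
has such a move lies in a corner, where it can be represented anew at the cost of a path in the
small board. -/
theorem Rep.of_link {z a b : Square} (H : Params p q s m) (h : Rep p q s z a)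
    (hab : Link p q (bigBoard p q) a b) :
    ∃ z', Rep p q s z' b ∧ Conn s p (smallBoard p s) z z' := by
  have key : ∀ {z a b : Square}, Rep p q s z a → b ∈ bigBoard p q →
      (b.1 = a.1 + q ∨ b.1 = a.1 - q) → (b.2 = a.2 + p ∨ b.2 = a.2 - p) →
      ∃ z', Rep p q s z' b ∧ Conn s p (smallBoard p s) z z' := by
    intro z a b h hb h1 h2
    by_cases hv : VRep p q s z a
    · exact ⟨z, ⟨h.1, hb, Or.inl (hv.of_mv H hb h1 h2)⟩, .refl _⟩
    · have hh := (h.2.2.resolve_left hv).outer H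
      simp only [Prod.fst_swap] at hh
      have hb' := hb
      have ha' := h.2.1
      simp only [bigBoard, Set.mem_ofPred_eq] at hb' ha'
      obtain ⟨w, hw, hwv, hwh⟩ := exists_corner_rep H h.2.1 (by omega) (by omega)
      exact ⟨w, ⟨hw, hb, Or.inl (hwv.of_mv H hb h1 h2)⟩,
        h.conn_small H ⟨hw, h.2.1, Or.inl hwv⟩⟩
  obtain ⟨ha, hb, ⟨h1, h2⟩ | ⟨h1, h2⟩⟩ := hab
  · obtain ⟨w, hw, hc⟩ := key h.swap (swap_mem_bigBoard.2 hb) h2 h1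
    exact ⟨w.swap, by simpa using hw.swap, by simpa using hc.swap_small⟩
  · exact key h hb h1 h2

/-- A small move by `(s, ±p)` is one zigzag seen from both sides: the zigzag attached to `z` on the
left is the one attached to `z'` on the right. -/
theorem exists_common_rep {z z' : Square} (H : Params p q s m)
    (h : Link s p (smallBoard p s) z z') : ∃ a, Rep p q s z a ∧ Rep p q s z' a := by
  have hp := H.p_pos
  have hq := H.p_lt_q
  have hlo := H.s_lo
  have hhi := H.s_hi
  have key : ∀ {z z' : Square}, z ∈ smallBoard p s → z' ∈ smallBoard p s → z'.1 = z.1 + s →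
      (z'.2 = z.2 + p ∨ z'.2 = z.2 - p) → ∃ a, Rep p q s z a ∧ Rep p q s z' a := by
    rintro ⟨X, Y⟩ ⟨X', Y'⟩ hz hz' h1 h2
    have hz2 := hz
    have hz2' := hz'
    simp only [smallBoard, Set.mem_ofPred_eq] at hz2 hz2' h1 h2
    have hX : 0 ≤ X := by omega
    have hX' : X < p := by omega
    obtain ⟨a, ha, hab⟩ : ∃ a, Zigzag p q X Y a ∧ a ∈ bigBoard p q := by
      by_cases hY : 0 ≤ Y
      · refine ⟨_, ((zigzag_corner H X Y).1 hX hX').1, ?_⟩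
        simp only [bigBoard, Set.mem_ofPred_eq]; omega
      -- Here `-p < Y < 0`, so the zigzag enters the board at its right-hand square in row `Y + p`.
      · refine ⟨_, ⟨hX, hX', 0, Or.inr rfl⟩, ?_⟩
        simp only [bigBoard, Set.mem_ofPred_eq]; omega
    refine ⟨a, ⟨hz, hab, Or.inl (Or.inl ha)⟩, ⟨hz', hab, Or.inl (Or.inr ?_)⟩⟩
    obtain ⟨-, -, i, hi⟩ := ha
    refine ⟨by simp only; omega, by simp only; omega, ?_⟩
    have e : (i - 1) * p = i * p - p := by ring
    have e' : X' - s = X := by omega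
    simp only [e']
    rcases h2 with h2 | h2
    · refine ⟨i - 1, hi.imp ?_ ?_⟩ <;> rintro rfl <;> rw [e] <;> ext <;> simp only <;> omega
    · refine ⟨i, hi.imp ?_ ?_⟩ <;> rintro rfl <;> ext <;> simp only <;> omega
  have key2 : ∀ {z z' : Square}, z ∈ smallBoard p s → z' ∈ smallBoard p s →
      (z'.1 = z.1 + s ∨ z'.1 = z.1 - s) →
      (z'.2 = z.2 + p ∨ z'.2 = z.2 - p) → ∃ a, Rep p q s z a ∧ Rep p q s z' a := by
    intro z z' hz hz' h1 h2
    rcases h1 with h1 | h1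
    · exact key hz hz' h1 h2
    · obtain ⟨a, h, h'⟩ := key hz' hz (by omega) (by omega)
      exact ⟨a, h', h⟩
  obtain ⟨hz, hz', ⟨h1, h2⟩ | ⟨h1, h2⟩⟩ := h
  · exact key2 hz hz' h1 h2
  · obtain ⟨a, h, h'⟩ := key2 (swap_mem_smallBoard.2 hz) (swap_mem_smallBoard.2 hz') h2 h1
    exact ⟨a.swap, by simpa using h.swap, by simpa using h'.swap⟩

theorem Rep.conn_big_of_conn {z z' a a' : Square} (H : Params p q s m) (h : Rep p q s z a)
    (h' : Rep p q s z' a') (hz : Conn s p (smallBoard p s) z z') :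
    Conn p q (bigBoard p q) a a' := by
  induction hz generalizing a' with
  | refl => exact h.conn_big H h'
  | tail _ hl ih =>
    obtain ⟨b, hb, hb'⟩ := exists_common_rep H hl
    exact (ih hb).trans (hb'.conn_big H h')

theorem Rep.exists_of_conn {z a b : Square} (H : Params p q s m) (h : Rep p q s z a)
    (hab : Conn p q (bigBoard p q) a b) :
    ∃ z', Rep p q s z' b ∧ Conn s p (smallBoard p s) z z' := by
  induction hab with
  | refl => exact ⟨z, h, .refl _⟩
  | tail _ hl ih =>
    obtain ⟨w, hw, hc⟩ := ih
    obtain ⟨w', hw', hc'⟩ := hw.of_link H hl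
    exact ⟨w', hw', hc.trans hc'⟩

theorem exists_rep_of_not_center {a : Square} (H : Params p q s m) (ha : a ∈ bigBoard p q)
    (h : ¬ (p ≤ a.1 ∧ a.1 < q ∧ p ≤ a.2 ∧ a.2 < q)) : ∃ z, Rep p q s z a := by
  by_cases h1 : a.1 < p ∨ q ≤ a.1
  · obtain ⟨z, hz, hv⟩ := exists_vRep H ha h1
    exact ⟨z, hz, ha, Or.inl hv⟩
  · obtain ⟨z, hz, hv⟩ := exists_vRep H (swap_mem_bigBoard.2 ha)
      (by simp only [Prod.fst_swap]; omega)
    exact ⟨z.swap, swap_mem_smallBoard.2 hz, ha, Or.inr (by simpa using hv)⟩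

/-! ### Lifting components, and the squares without moves. -/

/-- The component of the big board which corresponds to a component of the small board. -/
def lift (p q s : ℤ) (C : Set Square) : Set Square := {a | ∃ z ∈ C, Rep p q s z a}

theorem mem_lift_iff {C : Set Square} {z a : Square} (H : Params p q s m)
    (hC : IsComp s p (smallBoard p s) C) (h : Rep p q s z a) : a ∈ lift p q s C ↔ z ∈ C :=
  ⟨fun ⟨_, hw, hwa⟩ => hC.mem_of_conn hw (hwa.conn_small H h), fun hz => ⟨z, hz, h⟩⟩

theorem isComp_lift {C : Set Square} (H : Params p q s m)
    (hC : IsComp s p (smallBoard p s) C) : IsComp p q (bigBoard p q) (lift p q s C) := by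
  obtain ⟨z, hz⟩ := hC.nonempty
  obtain ⟨a, ha, hv, -⟩ := exists_rep H (hC.subset hz)
  have hr : Rep p q s z a := ⟨hC.subset hz, ha, Or.inl hv⟩
  refine ⟨a, ha, Set.ext fun b => ⟨?_, fun hb => ?_⟩⟩
  · rintro ⟨w, hw, hwb⟩
    exact hr.conn_big_of_conn H hwb (hC.conn hz hw)
  · obtain ⟨w, hw, hc⟩ := hr.exists_of_conn H hb
    exact ⟨w, hC.mem_of_conn hz hc, hw⟩

theorem exists_lift_eq {S : Set Square} {a : Square} (H : Params p q s m)
    (hS : IsComp p q (bigBoard p q) S) (ha : a ∈ S)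
    (h : ¬ (p ≤ a.1 ∧ a.1 < q ∧ p ≤ a.2 ∧ a.2 < q)) :
    ∃ C, IsComp s p (smallBoard p s) C ∧ lift p q s C = S := by
  obtain ⟨z, hz⟩ := exists_rep_of_not_center H (hS.subset ha) h
  have hC := isComp_conn (p := s) (q := p) hz.1
  exact ⟨_, hC, (isComp_lift H hC).eq_of_mem_of_mem hS ⟨z, .refl z, hz⟩ ha⟩

theorem isComp_singleton_of_center {p q : ℤ} {a : Square} (hp : 0 ≤ p) (ha : p ≤ a.1 ∧ a.1 < q)
    (ha' : p ≤ a.2 ∧ a.2 < q) : IsComp p q (bigBoard p q) {a} := by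
  refine ⟨a, by simp only [bigBoard, Set.mem_ofPred_eq]; omega, Set.ext fun b =>
    ⟨?_, fun h => ?_⟩⟩
  · rintro rfl; exact .refl _
  · rcases h.cases_head with h | ⟨c, ⟨-, hc, hm⟩, -⟩
    · exact h.symm
    · simp only [bigBoard, Mv, Set.mem_ofPred_eq] at hc hm
      omega

theorem exists_mv_of_not_center {p q : ℤ} {a : Square} (hp : 0 ≤ p) (hpq : p < q)
    (ha : a ∈ bigBoard p q) (h : ¬ (p ≤ a.1 ∧ a.1 < q ∧ p ≤ a.2 ∧ a.2 < q)) :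
    ∃ b ∈ bigBoard p q, b ≠ a ∧ Mv p q a b := by
  obtain ⟨x, y⟩ := a
  simp only [bigBoard, Set.mem_ofPred_eq] at ha h
  have key : ∀ x' y', (x', y') ∈ bigBoard p q → (x', y') ≠ (x, y) → Mv p q (x, y) (x', y') →
    ∃ b ∈ bigBoard p q, b ≠ (x, y) ∧ Mv p q (x, y) b := fun x' y' h1 h2 h3 => ⟨_, h1, h2, h3⟩
  simp only [bigBoard, Mv, Set.mem_ofPred_eq, ne_eq, Prod.mk.injEq] at key ⊢
  have : (x < p ∧ y < q) ∨ (x < p ∧ p ≤ y) ∨ (q ≤ x ∧ y < q) ∨ (q ≤ x ∧ p ≤ y) ∨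
    (y < p ∧ x < q) ∨ (y < p ∧ p ≤ x) ∨ (q ≤ y ∧ x < q) ∨ (q ≤ y ∧ p ≤ x) := by omega
  rcases this with h | h | h | h | h | h | h | h
  · exact key (x + q) (y + p) (by omega) (by omega) (by omega)
  · exact key (x + q) (y - p) (by omega) (by omega) (by omega)
  · exact key (x - q) (y + p) (by omega) (by omega) (by omega)
  · exact key (x - q) (y - p) (by omega) (by omega) (by omega)
  · exact key (x + p) (y + q) (by omega) (by omega) (by omega)
  · exact key (x - p) (y + q) (by omega) (by omega) (by omega)
  · exact key (x + p) (y - q) (by omega) (by omega) (by omega)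
  · exact key (x - p) (y - q) (by omega) (by omega) (by omega)

end Correspondence
end Leaper

/-! ### Translation copies correspond under the lift. -/

namespace Leaper
section Translation
variable {p q s m : ℤ}

/-- The squares of the small board without moves. -/
def smallCenter (p s : ℤ) : Set Square :=
  {z | max s 0 ≤ z.1 ∧ z.1 < p + min s 0 ∧ max s 0 ≤ z.2 ∧ z.2 < p + min s 0}

/-- The gain `max s (-s)` is `|s|`, exactly the distance from `p + min s 0` to the right edge `p +
max s 0`; `sameSides_of_translate` depends on this. -/
theorem exists_mv_right {z : Square} (hlo : -p < s) (hhi : s < p)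
    (hz : z ∈ smallBoard p s) (hc : z ∉ smallCenter p s) (h : z.1 < p + min s 0) :
    ∃ w ∈ smallBoard p s, Mv s p z w ∧ z.1 + max s (-s) ≤ w.1 ∧ w ≠ z := by
  obtain ⟨x, y⟩ := z
  simp only [smallBoard, smallCenter, Set.mem_ofPred_eq] at hz hc h
  have key : ∀ x' y', (x', y') ∈ smallBoard p s → Mv s p (x, y) (x', y') →
    x + max s (-s) ≤ x' → (x', y') ≠ (x, y) →
    ∃ w ∈ smallBoard p s, Mv s p (x, y) w ∧ x + max s (-s) ≤ w.1 ∧ w ≠ (x, y) :=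
      fun x' y' h1 h2 h3 h4 => ⟨_, h1, h2, h3, h4⟩
  simp only [smallBoard, Mv, Set.mem_ofPred_eq, ne_eq, Prod.mk.injEq] at key ⊢
  by_cases h1 : x < max s 0
  · by_cases h2 : y < p + min s 0
    · exact key (x + p) (y + max s (-s)) (by omega) (by omega) (by omega) (by omega)
    · exact key (x + p) (y - max s (-s)) (by omega) (by omega) (by omega) (by omega)
  · by_cases h2 : y < p + min s 0
    · exact key (x + max s (-s)) (y + p) (by omega) (by omega) (by omega) (by omega)
    · exact key (x + max s (-s)) (y - p) (by omega) (by omega) (by omega) (by omega)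

theorem exists_mv_left {z : Square} (hlo : -p < s) (hhi : s < p)
    (hz : z ∈ smallBoard p s) (hc : z ∉ smallCenter p s) (h : max s 0 ≤ z.1) :
    ∃ w ∈ smallBoard p s, Mv s p z w ∧ w.1 ≤ z.1 - max s (-s) ∧ w ≠ z := by
  obtain ⟨x, y⟩ := z
  simp only [smallBoard, smallCenter, Set.mem_ofPred_eq] at hz hc h
  have key : ∀ x' y', (x', y') ∈ smallBoard p s → Mv s p (x, y) (x', y') →
    x' ≤ x - max s (-s) → (x', y') ≠ (x, y) →
    ∃ w ∈ smallBoard p s, Mv s p (x, y) w ∧ w.1 ≤ x - max s (-s) ∧ w ≠ (x, y) :=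
      fun x' y' h1 h2 h3 h4 => ⟨_, h1, h2, h3, h4⟩
  simp only [smallBoard, Mv, Set.mem_ofPred_eq, ne_eq, Prod.mk.injEq] at key ⊢
  by_cases h1 : p + min s 0 ≤ x
  · by_cases h2 : y < p + min s 0
    · exact key (x - p) (y + max s (-s)) (by omega) (by omega) (by omega) (by omega)
    · exact key (x - p) (y - max s (-s)) (by omega) (by omega) (by omega) (by omega)
  · by_cases h2 : y < p + min s 0
    · exact key (x - max s (-s)) (y + p) (by omega) (by omega) (by omega) (by omega)
    · exact key (x - max s (-s)) (y - p) (by omega) (by omega) (by omega) (by omega)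

theorem eq_singleton_of_mem_smallCenter {C : Set Square} {z : Square}
    (hC : IsComp s p (smallBoard p s) C) (hz : z ∈ C) (hc : z ∈ smallCenter p s) : C = {z} := by
  rw [hC.eq_of_mem hz]
  refine Set.eq_singleton_iff_unique_mem.2 ⟨.refl z, fun b h => ?_⟩
  rcases h.cases_head with h | ⟨c, ⟨-, hc', hm⟩, -⟩
  · exact h.symm
  · simp only [smallBoard, smallCenter, Mv, Set.mem_ofPred_eq] at hc hc' hm
    omega

theorem Zigzag.add {x y : ℤ} {a : Square} (h : Zigzag p q x y a) (v : Square)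
    (h0 : 0 ≤ x + v.1) (h1 : x + v.1 < p) : Zigzag p q (x + v.1) (y + v.2) (a + v) := by
  obtain ⟨-, -, i, rfl | rfl⟩ := h
  · exact ⟨h0, h1, i, Or.inl (by ext <;> simp; ring)⟩
  · exact ⟨h0, h1, i, Or.inr (by ext <;> simp <;> ring)⟩

/-- On the levels `1 ≤ j ≤ 2m - 1` every row is on the big board. On the levels `-1`, `0`, `2m`, `2m
+ 1` the answer depends only on whether the row of the small square is in `[0, p)` and in `[s, p +
s)`. -/
theorem row_mem_add {Y Y' j : ℤ} (H : Params p q s m) (hY : min s 0 ≤ Y ∧ Y < p + max s 0)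
    (hY' : min s 0 ≤ Y' ∧ Y' < p + max s 0)
    (h1 : (0 ≤ Y ∧ Y < p) ↔ (0 ≤ Y' ∧ Y' < p)) (h2 : (s ≤ Y ∧ Y < p + s) ↔ (s ≤ Y' ∧ Y' < p + s))
    (h : 0 ≤ Y + j * p ∧ Y + j * p < p + q) : 0 ≤ Y' + j * p ∧ Y' + j * p < p + q := by
  have hp := H.p_pos
  have hlo := H.s_lo
  have hhi := H.s_hi
  have hq := H.q_eq
  have hm := H.le_mul
  have : j ≤ -2 ∨ j = -1 ∨ j = 0 ∨ (1 ≤ j ∧ j ≤ 2 * m - 1) ∨ j = 2 * m ∨ j = 2 * m + 1 ∨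
    2 * m + 2 ≤ j := by omega
  rcases this with h | rfl | rfl | ⟨h, h'⟩ | rfl | rfl | h
  · have : j * p ≤ -(2 * p) := by nlinarith
    omega
  · omega
  · omega
  · have : p ≤ j * p := by nlinarith
    have : j * p ≤ 2 * (m * p) - p := by nlinarith
    omega
  · have e : 2 * m * p = 2 * (m * p) := by ring
    rw [e] at h ⊢
    omega
  · have e : (2 * m + 1) * p = 2 * (m * p) + p := by ring
    rw [e] at h ⊢
    omega
  · have : 2 * (m * p) + 2 * p ≤ j * p := by nlinarith
    omega

/-- Translation by `v` preserves the sides from which a square of the small board is reached. -/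
def SameSides (p s x x' : ℤ) : Prop :=
  ((0 ≤ x ∧ x < p) ↔ (0 ≤ x' ∧ x' < p)) ∧ ((s ≤ x ∧ x < p + s) ↔ (s ≤ x' ∧ x' < p + s))

theorem VRep.add {z a v : Square} (H : Params p q s m) (hz : z ∈ smallBoard p s)
    (hzv : z + v ∈ smallBoard p s) (h1 : SameSides p s z.1 (z.1 + v.1))
    (h2 : SameSides p s z.2 (z.2 + v.2)) (ha : a ∈ bigBoard p q) (h : VRep p q s z a) :
    VRep p q s (z + v) (a + v) ∧ a + v ∈ bigBoard p q := by
  have hp := H.p_pos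
  have hpq := H.p_lt_q
  simp only [bigBoard, smallBoard, Set.mem_ofPred_eq, Prod.fst_add, Prod.snd_add, SameSides]
    at hz hzv ha h1 h2 ⊢
  have hrow : ∀ j : ℤ, a.2 = z.2 + j * p → 0 ≤ a.2 + v.2 ∧ a.2 + v.2 < p + q := by
    intro j hj
    have := row_mem_add (j := j) H hz.2.2 hzv.2.2 h2.1 h2.2 (by rw [← hj]; omega)
    rw [hj]; omega
  have e1 : ∀ i : ℤ, (2 * i) * p = 2 * (i * p) := fun i => by ring
  have e2 : ∀ i : ℤ, (2 * i + 1) * p = 2 * (i * p) + p := fun i => by ring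
  have e3 : ∀ i : ℤ, (2 * i + 2) * p = 2 * (i * p) + 2 * p := fun i => by ring
  rcases h with h | h
  · have h3 := h.1
    have h4 := h.2.1
    have h5 := h1.1.1 ⟨h3, h4⟩
    have hadd := h.add v (by omega) (by omega)
    refine ⟨Or.inl hadd, ?_⟩
    obtain ⟨-, -, i, hi | hi⟩ := h
    · have := hrow (2 * i) (by rw [e1, hi])
      have hx : a.1 = z.1 := by rw [hi]
      omega
    · have := hrow (2 * i + 1) (by rw [e2, hi]; ring)
      have hx : a.1 = z.1 + q := by rw [hi]
      omega
  · have h3 := h.1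
    have h4 := h.2.1
    have h5 := h1.2.1 ⟨by omega, by omega⟩
    have hadd := h.add v (by omega) (by omega)
    have e4 : z.1 - s + v.1 = z.1 + v.1 - s := by ring
    have e5 : z.2 + p + v.2 = z.2 + v.2 + p := by ring
    rw [e4, e5] at hadd
    refine ⟨Or.inr hadd, ?_⟩
    obtain ⟨-, -, i, hi | hi⟩ := h
    · have := hrow (2 * i + 1) (by rw [e2, hi]; ring)
      have hx : a.1 = z.1 - s := by rw [hi]
      omega
    · have := hrow (2 * i + 2) (by rw [e3, hi]; ring)
      have hx : a.1 = z.1 - s + q := by rw [hi]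
      omega

theorem isTranslate_iff {S T : Set Square} :
    IsTranslate S T ↔ ∃ v : Square, (∀ a ∈ S, a + v ∈ T) ∧ ∀ b ∈ T, b + -v ∈ S := by
  constructor
  · rintro ⟨v, rfl⟩
    refine ⟨v, fun a ha => ⟨a, ha, rfl⟩, ?_⟩
    rintro _ ⟨a, ha, rfl⟩
    simpa using ha
  · rintro ⟨v, h1, h2⟩
    refine ⟨v, Set.ext fun b => ⟨fun hb => ⟨_, h2 b hb, by simp⟩, ?_⟩⟩
    rintro ⟨a, ha, rfl⟩
    exact h1 a ha

theorem IsTranslate.symm {S T : Set Square} (h : IsTranslate S T) : IsTranslate T S := by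
  rw [isTranslate_iff] at *
  obtain ⟨v, h1, h2⟩ := h
  exact ⟨-v, h2, by simpa using h1⟩

theorem IsTranslate.trans {S T U : Set Square} (h : IsTranslate S T) (h' : IsTranslate T U) :
    IsTranslate S U := by
  obtain ⟨v, rfl⟩ := h
  obtain ⟨w, rfl⟩ := h'
  exact ⟨v + w, by rw [Set.image_image]; simp only [add_assoc]⟩

/-- If `z` has moves and lies left of `p + min s 0`, it can move at least `|s|` to the right inside
`C`; the translate needs the same room, so it lies left of `p + min s 0` too. The other side is
symmetric, and the converses use the inverse translation. A square without moves can only go to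
another such square. -/
theorem sameSides_of_translate {C C' : Set Square} {v z : Square} (hlo : -p < s)
    (hhi : s < p) (hC : IsComp s p (smallBoard p s) C) (hC' : IsComp s p (smallBoard p s) C')
    (h : ∀ z ∈ C, z + v ∈ C') (h' : ∀ z ∈ C', z + -v ∈ C) (hz : z ∈ C) :
    SameSides p s z.1 (z.1 + v.1) := by
  have key : ∀ {C C' : Set Square} {v : Square}, IsComp s p (smallBoard p s) C →
      IsComp s p (smallBoard p s) C' → (∀ z ∈ C, z + v ∈ C') → (∀ z ∈ C', z + -v ∈ C) →
      ∀ z ∈ C, (z.1 < p + min s 0 → z.1 + v.1 < p + min s 0) ∧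
        (max s 0 ≤ z.1 → max s 0 ≤ z.1 + v.1) := by
    clear! C C' v z
    intro C C' v hC hC' h h' z hz
    by_cases hc : z ∈ smallCenter p s
    · have hs := eq_singleton_of_mem_smallCenter hC hz hc
      have hc' : z + v ∈ smallCenter p s := by
        by_contra hc'
        have hb := hC'.subset (h z hz)
        obtain ⟨w, hw, hm, hne⟩ : ∃ w ∈ smallBoard p s, Mv s p (z + v) w ∧ w ≠ z + v := by
          by_cases h1 : (z + v).1 < p + min s 0
          · obtain ⟨w, h1, h2, -, h3⟩ := exists_mv_right hlo hhi hb hc' h1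
            exact ⟨w, h1, h2, h3⟩
          · obtain ⟨w, h1, h2, -, h3⟩ := exists_mv_left hlo hhi hb hc' (by omega)
            exact ⟨w, h1, h2, h3⟩
        have := h' w (hC'.mem_of_mv (h z hz) hw hm)
        rw [hs, Set.mem_singleton_iff] at this
        exact hne (by rw [← this]; simp)
      simp only [smallCenter, Set.mem_ofPred_eq, Prod.fst_add, Prod.snd_add] at hc hc'
      omega
    · have hb := hC.subset hz
      have side : ∀ w ∈ smallBoard p s, Mv s p z w →
          min s 0 ≤ w.1 + v.1 ∧ w.1 + v.1 < p + max s 0 := by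
        intro w hw hm
        have := hC'.subset (h w (hC.mem_of_mv hz hw hm))
        simp only [smallBoard, Set.mem_ofPred_eq, Prod.fst_add, Prod.snd_add] at this
        omega
      constructor
      · intro h1
        obtain ⟨w, hw, hm, hle, -⟩ := exists_mv_right hlo hhi hb hc h1
        have := side w hw hm
        omega
      · intro h1
        obtain ⟨w, hw, hm, hle, -⟩ := exists_mv_left hlo hhi hb hc h1
        have := side w hw hm
        omega
  have k1 := key hC hC' h h' z hz
  have k2 := key hC' hC h' (by simpa using h) (z + v) (h z hz)
  have b1 := hC.subset hz
  have b2 := hC'.subset (h z hz)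
  simp only [smallBoard, Set.mem_ofPred_eq, Prod.fst_add, Prod.snd_add, Prod.fst_neg] at b1 b2 k2
  unfold SameSides
  omega

theorem isComp_swap {C : Set Square} (hC : IsComp s p (smallBoard p s) C) :
    IsComp s p (smallBoard p s) (Prod.swap ⁻¹' C) := by
  obtain ⟨z, hz⟩ := hC.nonempty
  refine ⟨z.swap, swap_mem_smallBoard.2 (hC.subset hz), Set.ext fun w => ⟨fun hw => ?_,
    fun hw => ?_⟩⟩
  · simpa using (hC.conn hz hw).swap_small
  · exact hC.mem_of_conn hz (by simpa using hw.swap_small)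

theorem lift_swap {C : Set Square} : lift p q s (Prod.swap ⁻¹' C) = Prod.swap ⁻¹' lift p q s C := by
  ext a
  constructor
  · rintro ⟨z, hz, h⟩; exact ⟨z.swap, hz, h.swap⟩
  · rintro ⟨z, hz, h⟩; exact ⟨z.swap, by simpa using hz, by simpa using h.swap⟩

theorem isTranslate_lift {C C' : Set Square} (H : Params p q s m)
    (hC : IsComp s p (smallBoard p s) C) (hC' : IsComp s p (smallBoard p s) C')
    (h : IsTranslate C C') : IsTranslate (lift p q s C) (lift p q s C') := by
  rw [isTranslate_iff] at h ⊢
  obtain ⟨v, h1, h2⟩ := h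
  have key : ∀ {C C' : Set Square} {v : Square}, IsComp s p (smallBoard p s) C →
      IsComp s p (smallBoard p s) C' → (∀ z ∈ C, z + v ∈ C') → (∀ z ∈ C', z + -v ∈ C) →
      ∀ a ∈ lift p q s C, a + v ∈ lift p q s C' := by
    clear! C C' v
    rintro C C' v hC hC' h1 h2 a ⟨z, hz, hr⟩
    refine ⟨z + v, h1 z hz, hC'.subset (h1 z hz), ?_⟩
    have b1 := hC.subset hz
    have b2 := hC'.subset (h1 z hz)
    have s1 := sameSides_of_translate H.s_lo H.s_hi hC hC' h1 h2 hz
    have s2 := sameSides_of_translate (v := v.swap) (z := z.swap) H.s_lo H.s_hi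
      (isComp_swap hC) (isComp_swap hC') (fun w hw => by simpa using h1 w.swap hw)
      (fun w hw => by simpa using h2 w.swap hw) (by simpa using hz)
    simp only [Prod.fst_swap] at s2
    rcases hr.2.2 with hv | hv
    · obtain ⟨h3, h4⟩ := hv.add H b1 b2 s1 s2 hr.2.1
      exact ⟨h4, Or.inl h3⟩
    · obtain ⟨h3, h4⟩ := hv.add (v := v.swap) H (swap_mem_smallBoard.2 b1)
        (by simpa using swap_mem_smallBoard.2 b2) s2 s1 (swap_mem_bigBoard.2 hr.2.1)
      exact ⟨by simpa using swap_mem_bigBoard.2 h4, Or.inr (by simpa using h3)⟩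
  exact ⟨v, key hC hC' h1 h2, key hC' hC h2 (by simpa using h1)⟩

/-- Each small square is represented by a corner square of the lift, whose two moves lead inwards.
The translates of both neighbours must be on the board, which keeps the translated square in the
same corner, where `v` acts on small squares in the same way. -/
theorem isTranslate_of_lift {C C' : Set Square} (H : Params p q s m)
    (hC : IsComp s p (smallBoard p s) C) (hC' : IsComp s p (smallBoard p s) C')
    (h : IsTranslate (lift p q s C) (lift p q s C')) : IsTranslate C C' := by
  rw [isTranslate_iff] at h ⊢
  obtain ⟨v, h1, h2⟩ := h
  have hp := H.p_pos
  have hpq := H.p_lt_q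
  have hlo := H.s_lo
  have hhi := H.s_hi
  have key : ∀ {C C' : Set Square} {v : Square}, IsComp s p (smallBoard p s) C →
      IsComp s p (smallBoard p s) C' → (∀ a ∈ lift p q s C, a + v ∈ lift p q s C') →
      ∀ z ∈ C, z + v ∈ C' := by
    clear! C C' v
    rintro C C' ⟨v1, v2⟩ hC hC' h1 ⟨X, Y⟩ hz
    have hzb := hC.subset hz
    have hS := isComp_lift H hC
    have hS' := isComp_lift H hC'
    have next : ∀ a ∈ lift p q s C, ∀ b ∈ bigBoard p q, Mv p q a b →
        b + (v1, v2) ∈ bigBoard p q :=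
      fun a ha b hb hm => hS'.subset (h1 b (hS.mem_of_mv ha hb hm))
    have fin : ∀ a, Rep p q s (X, Y) a → (a ∈ lift p q s C → Rep p q s ((X, Y) + (v1, v2))
        (a + (v1, v2))) → (X, Y) + (v1, v2) ∈ C' := by
      intro a hr hr'
      have ha : a ∈ lift p q s C := ⟨_, hz, hr⟩
      exact (mem_lift_iff H hC' (hr' ha)).1 (h1 a ha)
    simp only [bigBoard, smallBoard, Set.mem_ofPred_eq, Mv, Prod.mk_add_mk] at next hzb fin
    by_cases hX : 0 ≤ X ∧ X < p <;> by_cases hY : 0 ≤ Y ∧ Y < p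
    · refine fin (X, Y) ⟨?_, ?_, Or.inl (Or.inl ((zigzag_corner H X Y).1 hX.1 hX.2).1)⟩
        fun ha => ?_
      · simp only [smallBoard, Set.mem_ofPred_eq]; omega
      · simp only [bigBoard, Set.mem_ofPred_eq]; omega
      · have n1 := next _ ha (X + p, Y + q) (by simp only; omega) (by simp)
        have n2 := next _ ha (X + q, Y + p) (by simp only; omega) (by simp)
        have n3 := hS'.subset (h1 _ ha)
        simp only [bigBoard, Set.mem_ofPred_eq, Prod.mk_add_mk] at n1 n2 n3
        refine ⟨?_, n3, Or.inl (Or.inl ((zigzag_corner H _ _).1 (by omega) (by omega)).1)⟩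
        simp only [smallBoard, Set.mem_ofPred_eq]; omega
    · refine fin (X, Y - s + q) ⟨?_, ?_, Or.inl (Or.inl ((zigzag_corner H X Y).1 hX.1 hX.2).2)⟩
        fun ha => ?_
      · simp only [smallBoard, Set.mem_ofPred_eq]; omega
      · simp only [bigBoard, Set.mem_ofPred_eq]; omega
      · have n1 := next _ ha (X + p, Y - s) (by simp only; omega) (by simp)
        have n2 := next _ ha (X + q, Y - s + q - p) (by simp only; omega) (by simp)
        have n3 := hS'.subset (h1 _ ha)
        simp only [bigBoard, Set.mem_ofPred_eq, Prod.mk_add_mk] at n1 n2 n3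
        have e : Y - s + q + v2 = Y + v2 - s + q := by ring
        refine ⟨?_, n3, Or.inl (Or.inl ?_)⟩
        · simp only [smallBoard, Set.mem_ofPred_eq]; omega
        · simp only [Prod.mk_add_mk, e]
          exact ((zigzag_corner H _ _).1 (by omega) (by omega)).2
    · refine fin (X - s + q, Y) ⟨?_, ?_,
        Or.inl (Or.inr ((zigzag_corner H X Y).2 (by omega) (by omega)).1)⟩ fun ha => ?_
      · simp only [smallBoard, Set.mem_ofPred_eq]; omega
      · simp only [bigBoard, Set.mem_ofPred_eq]; omega
      · have n1 := next _ ha (X - s, Y + p) (by simp only; omega) (by simp)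
        have n2 := next _ ha (X - s + q - p, Y + q) (by simp only; omega) (by simp)
        have n3 := hS'.subset (h1 _ ha)
        simp only [bigBoard, Set.mem_ofPred_eq, Prod.mk_add_mk] at n1 n2 n3
        have e : X - s + q + v1 = X + v1 - s + q := by ring
        refine ⟨?_, n3, Or.inl (Or.inr ?_)⟩
        · simp only [smallBoard, Set.mem_ofPred_eq]; omega
        · simp only [Prod.mk_add_mk, e]
          exact ((zigzag_corner H _ _).2 (by omega) (by omega)).1
    · refine fin (X - s + q, Y - s + q) ⟨?_, ?_,
        Or.inl (Or.inr ((zigzag_corner H X Y).2 (by omega) (by omega)).2)⟩ fun ha => ?_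
      · simp only [smallBoard, Set.mem_ofPred_eq]; omega
      · simp only [bigBoard, Set.mem_ofPred_eq]; omega
      · have n1 := next _ ha (X - s, Y - s + q - p) (by simp only; omega) (by simp)
        have n2 := next _ ha (X - s + q - p, Y - s) (by simp only; omega) (by simp)
        have n3 := hS'.subset (h1 _ ha)
        simp only [bigBoard, Set.mem_ofPred_eq, Prod.mk_add_mk] at n1 n2 n3
        have e : X - s + q + v1 = X + v1 - s + q := by ring
        have e' : Y - s + q + v2 = Y + v2 - s + q := by ring
        refine ⟨?_, n3, Or.inl (Or.inr ?_)⟩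
        · simp only [smallBoard, Set.mem_ofPred_eq]; omega
        · simp only [Prod.mk_add_mk, e, e']
          exact ((zigzag_corner H _ _).2 (by omega) (by omega)).2
  exact ⟨v, key hC hC' h1, key hC' hC h2⟩

end Translation
end Leaper

/-! ### Lists of squares, and rails built from alternating windows. -/

namespace Leaper
section Lists

/-- The translation of a list of squares by a vector. -/
def sh (v : Square) (l : List Square) : List Square := l.map (· + v)

/-- The reflection of a list of squares in the main diagonal. -/
def sw (l : List Square) : List Square := l.map Prod.swap

@[simp] theorem sh_append (v : Square) (l l' : List Square) : sh v (l ++ l') = sh v l ++ sh v l' :=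
  List.map_append
@[simp] theorem sh_sh (v w : Square) (l : List Square) : sh v (sh w l) = sh (w + v) l := by
  simp [sh, Function.comp_def, add_assoc]
@[simp] theorem sh_reverse (v : Square) (l : List Square) : sh v l.reverse = (sh v l).reverse :=
  List.map_reverse
@[simp] theorem sh_eq_nil {v : Square} {l : List Square} : sh v l = [] ↔ l = [] := List.map_eq_nil_iff

theorem sh_eq_of_eq {v w : Square} (l : List Square) (h : v = w) : sh v l = sh w l := by rw [h]

@[simp] theorem mem_sh {v a : Square} {l : List Square} : a ∈ sh v l ↔ a - v ∈ l := by
  simp only [sh, List.mem_map]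
  constructor
  · rintro ⟨b, hb, rfl⟩; simpa using hb
  · intro h; exact ⟨_, h, by simp⟩

theorem nodup_sh {v : Square} {l : List Square} : (sh v l).Nodup ↔ l.Nodup :=
  List.nodup_map_iff (add_left_injective v)

@[simp] theorem sw_append (l l' : List Square) : sw (l ++ l') = sw l ++ sw l' := List.map_append
@[simp] theorem sw_reverse (l : List Square) : sw l.reverse = (sw l).reverse := List.map_reverse
@[simp] theorem sw_sw (l : List Square) : sw (sw l) = l := by simp [sw]
@[simp] theorem sw_eq_nil {l : List Square} : sw l = [] ↔ l = [] := List.map_eq_nil_iff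
@[simp] theorem sw_sh (v : Square) (l : List Square) : sw (sh v l) = sh v.swap (sw l) := by
  simp [sh, sw, Function.comp_def]

@[simp] theorem mem_sw {a : Square} {l : List Square} : a ∈ sw l ↔ a.swap ∈ l := by
  simp only [sw, List.mem_map]
  constructor
  · rintro ⟨b, hb, rfl⟩; simpa using hb
  · intro h; exact ⟨_, h, by simp⟩

theorem nodup_sw {l : List Square} : (sw l).Nodup ↔ l.Nodup :=
  List.nodup_map_iff Prod.swap_injective

variable {P Q : ℤ}

theorem isChain_sh {v : Square} {l : List Square} (h : l.IsChain (Mv P Q)) :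
    (sh v l).IsChain (Mv P Q) :=
  List.isChain_map_of_isChain _ (fun _ _ h => h.add v) h

theorem isChain_sw {l : List Square} (h : l.IsChain (Mv P Q)) : (sw l).IsChain (Mv P Q) :=
  List.isChain_map_of_isChain _ (fun _ _ h => h.swap) h

theorem isChain_rev {l : List Square} (h : l.IsChain (Mv P Q)) : l.reverse.IsChain (Mv P Q) :=
  List.isChain_reverse.2 (h.imp fun _ _ h => h.symm)

/-- The squares above a bottom corner on a vertical side of the board: translates of the corners
`B` and `A` alternate, and the last stretch is a translate of `L`. -/
def rail (A B L : List Square) (e p : ℤ) : ℕ → List Square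
  | 0 => L
  | n + 1 => sh (-e, p) B ++ sh (0, 2 * p) (A ++ rail A B L e p n)

/-- Passing from `n` to `n + 1` adds the same two levels on both sides, so the equation for the
lowest board propagates. It supplies the translation fields of `ArcTour` for the lift. -/
theorem rail_append_eq {A B L K T : List Square} {e p : ℤ}
    (h : L ++ sh (0, 2 * p) T = sh (-e, p) (B ++ K)) (n : ℕ) :
    rail A B L e p n ++ sh (0, 2 * ((n + 1) * p)) T = sh (-e, p) (B ++ rail B A K (-e) p n) := by
  induction n with
  | zero => simpa [rail] using h
  | succ n ih =>
    have e1 : sh (0, 2 * (((n + 1 : ℕ) + 1) * p)) T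
        = sh (0, 2 * p) (sh (0, 2 * ((n + 1) * p)) T) := by
      rw [sh_sh]; refine sh_eq_of_eq _ ?_; ext
      · simp
      · simp; ring
    rw [e1, rail, rail, List.append_assoc, ← sh_append, List.append_assoc, ih]
    simp only [sh_append, sh_sh, Prod.mk_add_mk]
    congr 2
    · exact sh_eq_of_eq _ (by ext <;> simp; ring)
    · congr 1 <;> exact sh_eq_of_eq _ (by ext <;> simp <;> ring)

/-- By `h` and `h'`, the lists that follow `A` and `B` in `hc` and `hc'` begin with translates of
`B` and `A`. So the chains for the lowest board already contain both junctions that occur in longer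
rails. -/
theorem isChain_rail {A B L K T U : List Square} {e p : ℤ} (hA : A ≠ []) (hB : B ≠ [])
    (h : L ++ sh (0, 2 * p) T = sh (-e, p) (B ++ K))
    (h' : K ++ sh (0, 2 * p) U = sh (e, p) (A ++ L))
    (hc : (A ++ L ++ sh (0, 2 * p) T).IsChain (Mv P Q))
    (hc' : (B ++ K ++ sh (0, 2 * p) U).IsChain (Mv P Q)) (n : ℕ) :
    (A ++ rail A B L e p n ++ sh (0, 2 * ((n + 1) * p)) T).IsChain (Mv P Q) := by
  induction n with
  | zero => simpa [rail] using hc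
  | succ n ih =>
    have e1 : sh (0, 2 * (((n + 1 : ℕ) + 1) * p)) T
        = sh (0, 2 * p) (sh (0, 2 * ((n + 1) * p)) T) := by
      rw [sh_sh]; refine sh_eq_of_eq _ ?_; ext
      · simp
      · simp; ring
    have c1 : (A ++ sh (-e, p) B).IsChain (Mv P Q) := by
      rw [List.append_assoc, h, sh_append, ← List.append_assoc] at hc
      exact hc.left_of_append
    have c2 : (sh (-e, p) B ++ sh (0, 2 * p) A).IsChain (Mv P Q) := by
      rw [List.append_assoc, h', sh_append, ← List.append_assoc] at hc'
      have := isChain_sh (v := (-e, p)) hc'.left_of_append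
      rw [sh_append, sh_sh] at this
      convert this using 2
      exact sh_eq_of_eq _ (by ext <;> simp; ring)
    have c3 := isChain_sh (v := (0, 2 * p)) ih
    rw [e1, rail, List.append_assoc, List.append_assoc, ← sh_append]
    rw [List.append_assoc, sh_append] at c3
    rw [List.append_assoc, sh_append, ← List.append_assoc, ← List.append_assoc]
    refine List.IsChain.append_overlap (c1.append_overlap c2 (by simpa using hB)) ?_
      (by simpa using hA)
    simpa using c3

/-- `D` has vertical period `2p`, so it is known from two consecutive levels, given by `A` and `B`,
and from the last stretch. -/
theorem mem_rail {A B L : List Square} {e p s : ℤ} {D : Square → Prop} (hp : 0 < p) (hs : -p < s)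
    (hD : ∀ x y, D (x, y) ↔ D (x, y - 2 * p))
    (hA : ∀ x y, (x, y) ∈ A ↔ D (x, y) ∧ 0 ≤ y ∧ y < p)
    (hB : ∀ x y, (x, y) ∈ B ↔ D (x - e, y + p) ∧ 0 ≤ y ∧ y < p)
    (hL : ∀ x y, (x, y) ∈ L ↔ D (x, y) ∧ p ≤ y ∧ y < 2 * p + s) (n : ℕ) (x y : ℤ) :
    (x, y) ∈ rail A B L e p n ↔ D (x, y) ∧ p ≤ y ∧ y < 2 * ((n + 1) * p) + s := by
  induction n generalizing y with
  | zero => rw [rail, hL]; simp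
  | succ n ih =>
    have e1 : ((n + 1 : ℕ) + 1 : ℤ) * p = (n + 1) * p + p := by push_cast; ring
    have h2 : 0 ≤ n * p := by positivity
    have e2 : (n + 1 : ℤ) * p = n * p + p := by ring
    rw [rail, List.mem_append, mem_sh, mem_sh, List.mem_append, Prod.mk_sub_mk, Prod.mk_sub_mk,
      sub_zero, hA, hB, ih, e1, ← hD, e2]
    have e3 : (x - -e - e, y - p + p) = (x, y) := by ext <;> simp
    rw [e3]
    constructor
    · rintro (h | h | h) <;> exact ⟨h.1, by omega, by omega⟩
    · rintro ⟨h, h3, h4⟩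
      by_cases h5 : y < 2 * p
      · exact Or.inl ⟨h, by omega, by omega⟩
      · by_cases h6 : y < 3 * p
        · exact Or.inr (Or.inl ⟨h, by omega, by omega⟩)
        · exact Or.inr (Or.inr ⟨h, by omega, by omega⟩)

theorem nodup_rail {A B L : List Square} {e p : ℤ} (hp : 0 < p)
    (hA : ∀ a ∈ A, 0 ≤ a.2 ∧ a.2 < p) (hB : ∀ a ∈ B, 0 ≤ a.2 ∧ a.2 < p)
    (hL : ∀ a ∈ L, p ≤ a.2) (nA : A.Nodup) (nB : B.Nodup) (nL : L.Nodup) (n : ℕ) :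
    (rail A B L e p n).Nodup ∧ ∀ a ∈ rail A B L e p n, p ≤ a.2 := by
  induction n with
  | zero => exact ⟨nL, hL⟩
  | succ n ih =>
    rw [rail]
    constructor
    · refine List.Nodup.append (nodup_sh.2 nB) (nodup_sh.2 (nA.append ih.1 ?_)) ?_
      · intro a ha ha'
        have := hA a ha
        have := ih.2 a ha'
        omega
      · intro a ha ha'
        rw [mem_sh] at ha ha'
        have h1 := hB _ ha
        rw [List.mem_append] at ha'
        simp only [Prod.snd_sub] at h1
        rcases ha' with h | h
        · have := hA _ h
          simp only [Prod.snd_sub] at this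
          omega
        · have := ih.2 _ h
          simp only [Prod.snd_sub] at this
          omega
    · intro a ha
      rw [List.mem_append, mem_sh, mem_sh, List.mem_append] at ha
      rcases ha with h | h | h
      · have := hB _ h
        simp only [Prod.snd_sub] at this
        omega
      · have := hA _ h
        simp only [Prod.snd_sub] at this
        omega
      · have := ih.2 _ h
        simp only [Prod.snd_sub] at this
        omega

end Lists
end Leaper

/-! ### Tours cut into arcs, and the windows of a lifted component. -/

namespace Leaper
section Tours

/-- A tour of an `(P, Q)`-leaper over a component `C` of the leaper graph of an `(r, p)`-leaper,
cut into the arcs which lie at the four corners and along the four sides of the board. Corner arcs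
and the arcs of the left and right sides are directed upwards, the others to the right. -/
structure ArcTour (P Q r p : ℤ) (C : Set Square) where
  (bl l tl t tr rt br b : List Square)
  sub : C ⊆ bigBoard r p
  mem_bl : ∀ x y, (x, y) ∈ bl ↔ (x, y) ∈ C ∧ x < r ∧ y < r
  mem_l : ∀ x y, (x, y) ∈ l ↔ (x, y) ∈ C ∧ x < r ∧ r ≤ y ∧ y < p
  mem_tl : ∀ x y, (x, y) ∈ tl ↔ (x, y) ∈ C ∧ x < r ∧ p ≤ y
  mem_t : ∀ x y, (x, y) ∈ t ↔ (x, y) ∈ C ∧ r ≤ x ∧ x < p ∧ p ≤ y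
  mem_tr : ∀ x y, (x, y) ∈ tr ↔ (x, y) ∈ C ∧ p ≤ x ∧ p ≤ y
  mem_rt : ∀ x y, (x, y) ∈ rt ↔ (x, y) ∈ C ∧ p ≤ x ∧ r ≤ y ∧ y < p
  mem_br : ∀ x y, (x, y) ∈ br ↔ (x, y) ∈ C ∧ p ≤ x ∧ y < r
  mem_b : ∀ x y, (x, y) ∈ b ↔ (x, y) ∈ C ∧ r ≤ x ∧ x < p ∧ y < r
  not_mid : ∀ x y, (x, y) ∈ C → ¬ (r ≤ x ∧ x < p ∧ r ≤ y ∧ y < p)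
  nodup_bl : bl.Nodup
  nodup_l : l.Nodup
  nodup_tl : tl.Nodup
  nodup_t : t.Nodup
  nodup_tr : tr.Nodup
  nodup_rt : rt.Nodup
  nodup_br : br.Nodup
  nodup_b : b.Nodup
  ne_bl : bl ≠ []
  ne_tl : tl ≠ []
  ne_tr : tr ≠ []
  ne_br : br ≠ []
  chain_l : (bl ++ l ++ tl).IsChain (Mv P Q)
  chain_rt : (br ++ rt ++ tr).IsChain (Mv P Q)
  chain_b : (bl.reverse ++ b ++ br).IsChain (Mv P Q)
  chain_t : (tl ++ t ++ tr.reverse).IsChain (Mv P Q)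
  -- The moves of the `(r, p)`-leaper, as translations, carry a side with one of its corners to the
  -- opposite side with the other corner. These four fields demand that the order of the tour be
  -- carried along; they are the invariant that allows the next lift.
  eq_l : br ++ rt = sh (p, -r) (l ++ tl)
  eq_rt : rt ++ tr = sh (p, r) (bl ++ l)
  eq_b : tl ++ t = sh (-r, p) (b ++ br)
  eq_t : t ++ tr.reverse = sh (r, p) (bl.reverse ++ b)

/-- The reflection of a tour in the main diagonal. -/
def ArcTour.swap {P Q r p : ℤ} {C : Set Square} (T : ArcTour P Q r p C) :
    ArcTour P Q r p (Prod.swap ⁻¹' C) where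
  bl := sw T.bl.reverse
  l := sw T.b
  tl := sw T.br
  t := sw T.rt
  tr := sw T.tr.reverse
  rt := sw T.t
  br := sw T.tl
  b := sw T.l
  sub := fun a ha => swap_mem_bigBoard.1 (T.sub ha)
  mem_bl x y := by simp [T.mem_bl]; tauto
  mem_l x y := by simp [T.mem_b]; tauto
  mem_tl x y := by simp [T.mem_br]; tauto
  mem_t x y := by simp [T.mem_rt]; tauto
  mem_tr x y := by simp [T.mem_tr]; tauto
  mem_rt x y := by simp [T.mem_t]; tauto
  mem_br x y := by simp [T.mem_tl]; tauto
  mem_b x y := by simp [T.mem_l]; tauto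
  not_mid x y h := by have := T.not_mid y x h; tauto
  nodup_bl := nodup_sw.2 (List.nodup_reverse.2 T.nodup_bl)
  nodup_l := nodup_sw.2 T.nodup_b
  nodup_tl := nodup_sw.2 T.nodup_br
  nodup_t := nodup_sw.2 T.nodup_rt
  nodup_tr := nodup_sw.2 (List.nodup_reverse.2 T.nodup_tr)
  nodup_rt := nodup_sw.2 T.nodup_t
  nodup_br := nodup_sw.2 T.nodup_tl
  nodup_b := nodup_sw.2 T.nodup_l
  ne_bl := by simpa using T.ne_bl
  ne_tl := by simpa using T.ne_br
  ne_tr := by simpa using T.ne_tr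
  ne_br := by simpa using T.ne_tl
  chain_l := by simpa using isChain_sw T.chain_b
  chain_rt := by simpa using isChain_sw T.chain_t
  chain_b := by simpa using isChain_sw T.chain_l
  chain_t := by simpa using isChain_sw T.chain_rt
  eq_l := by rw [← sw_append, T.eq_b]; simp
  eq_rt := by rw [← sw_append, T.eq_t]; simp
  eq_b := by rw [← sw_append, T.eq_l]; simp
  eq_t := by simp only [sw_reverse, List.reverse_reverse]; rw [← sw_append, T.eq_rt]; simp

/-- The data from which the tour of a lifted component is assembled along the vertical sides of
the board: the lists `lb`, `rb`, `lt`, `rt` give the four corners, up to translation. -/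
structure RailData (P Q p s : ℤ) (C : Set Square) (lb rb lt rt : List Square) where
  (L K : List Square)
  mem_lb : ∀ x y, (x, y) ∈ lb ↔ (x, y) ∈ C ∧ 0 ≤ x ∧ x < p ∧ 0 ≤ y ∧ y < p
  mem_rb : ∀ x y, (x, y) ∈ rb ↔ (x, y) ∈ C ∧ s ≤ x ∧ x < p + s ∧ 0 ≤ y ∧ y < p
  mem_lt : ∀ x y, (x, y) ∈ lt ↔ (x, y) ∈ C ∧ 0 ≤ x ∧ x < p ∧ s ≤ y ∧ y < p + s
  mem_rt : ∀ x y, (x, y) ∈ rt ↔ (x, y) ∈ C ∧ s ≤ x ∧ x < p + s ∧ s ≤ y ∧ y < p + s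
  mem_L : ∀ x y, (x, y) ∈ L ↔ 0 ≤ x ∧ x < p ∧ p ≤ y ∧ y < 2 * p + s ∧
    ((y < 2 * p ∧ (x + s, y - p) ∈ C) ∨ (2 * p ≤ y ∧ (x, y - 2 * p) ∈ C))
  mem_K : ∀ x y, (x, y) ∈ K ↔ s ≤ x ∧ x < p + s ∧ p ≤ y ∧ y < 2 * p + s ∧
    ((y < 2 * p ∧ (x - s, y - p) ∈ C) ∨ (2 * p ≤ y ∧ (x, y - 2 * p) ∈ C))
  nodup_lb : lb.Nodup
  nodup_rb : rb.Nodup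
  nodup_lt : lt.Nodup
  nodup_rt : rt.Nodup
  nodup_L : L.Nodup
  nodup_K : K.Nodup
  ne_lb : lb ≠ []
  ne_rb : rb ≠ []
  ne_lt : lt ≠ []
  ne_rt : rt ≠ []
  eq_L : L ++ sh (0, 2 * p) lt = sh (-s, p) (rb ++ K)
  eq_K : K ++ sh (0, 2 * p) rt = sh (s, p) (lb ++ L)
  chain_L : (lb ++ L ++ sh (0, 2 * p) lt).IsChain (Mv P Q)
  chain_K : (rb ++ K ++ sh (0, 2 * p) rt).IsChain (Mv P Q)

theorem Zigzag.add_iff {p q x y a1 a2 : ℤ} :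
    Zigzag p q x y (a1, a2) ↔ Zigzag p q x y (a1, a2 - 2 * p) := by
  have e1 : ∀ i : ℤ, (i + 1) * p = i * p + p := fun i => by ring
  have e2 : ∀ i : ℤ, (i - 1) * p = i * p - p := fun i => by ring
  constructor
  · rintro ⟨h, h', i, hi⟩
    refine ⟨h, h', i - 1, ?_⟩
    rw [e2]
    simp only [Prod.mk.injEq] at *
    omega
  · rintro ⟨h, h', i, hi⟩
    refine ⟨h, h', i + 1, ?_⟩
    rw [e1]
    simp only [Prod.mk.injEq] at *
    omega

theorem VRep.add_iff {p q s a1 a2 : ℤ} {z : Square} :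
    VRep p q s z (a1, a2) ↔ VRep p q s z (a1, a2 - 2 * p) := by
  unfold VRep
  rw [Zigzag.add_iff, Zigzag.add_iff (y := z.2 + p)]

variable {p q s m : ℤ} {C : Set Square}

theorem exists_vRep_iff {z a : Square} (H : Params p q s m)
    (hC : IsComp s p (smallBoard p s) C) (hz : z ∈ smallBoard p s) (h : VRep p q s z a) :
    (∃ w ∈ C, VRep p q s w a) ↔ z ∈ C :=
  ⟨fun ⟨_, hw, hwa⟩ => hC.mem_of_conn hw (hwa.conn_small H (hC.subset hw) hz h),
    fun hz => ⟨z, hz, h⟩⟩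

/-- Every square of the outer columns has a vertical representation, so horizontal ones can be
ignored there. -/
theorem mem_lift_iff_exists_vRep {a : Square} (H : Params p q s m)
    (hC : IsComp s p (smallBoard p s) C) (h : a.1 < p ∨ q ≤ a.1) :
    a ∈ lift p q s C ↔ a ∈ bigBoard p q ∧ ∃ w ∈ C, VRep p q s w a := by
  constructor
  · intro ha
    have hb := (isComp_lift H hC).subset ha
    obtain ⟨z, hz, hv⟩ := exists_vRep H hb h
    exact ⟨hb, z, (mem_lift_iff H hC ⟨hz, hb, Or.inl hv⟩).1 ha, hv⟩
  · rintro ⟨hb, w, hw, hv⟩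
    exact ⟨w, hw, hC.subset hw, hb, Or.inl hv⟩

/-- In the left column strip, squares of the lifted component are read off from `C` by going down
at most two levels. -/
theorem left_strip (H : Params p q s m) (hC : IsComp s p (smallBoard p s) C) {x y : ℤ}
    (hx : 0 ≤ x) (hx' : x < p) :
    (0 ≤ y → y < p → ((∃ w ∈ C, VRep p q s w (x, y)) ↔ (x, y) ∈ C)) ∧
    (0 ≤ y → y < p → ((∃ w ∈ C, VRep p q s w (x, y + p)) ↔ (x + s, y) ∈ C)) ∧
    (s ≤ y → y < p + s → ((∃ w ∈ C, VRep p q s w (x, y - s + q)) ↔ (x, y) ∈ C)) ∧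
    (2 * p ≤ y → y < 2 * p + s → ((∃ w ∈ C, VRep p q s w (x, y)) ↔ (x, y - 2 * p) ∈ C)) := by
  have hp := H.p_pos
  have hlo := H.s_lo
  have hhi := H.s_hi
  refine ⟨fun h h' => exists_vRep_iff H hC ?_ (Or.inl ((zigzag_corner H x y).1 hx hx').1),
    fun h h' => exists_vRep_iff H hC ?_ (Or.inr ⟨?_, ?_, 0, Or.inl ?_⟩),
    fun h h' => exists_vRep_iff H hC ?_ (Or.inl ((zigzag_corner H x y).1 hx hx').2),
    fun h h' => exists_vRep_iff H hC ?_ (Or.inl ⟨hx, hx', 1, Or.inl ?_⟩)⟩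
  · simp only [smallBoard, Set.mem_ofPred_eq]; omega
  · simp only [smallBoard, Set.mem_ofPred_eq]; omega
  · simp only; omega
  · simp only; omega
  · ext <;> simp
  · simp only [smallBoard, Set.mem_ofPred_eq]; omega
  · simp only [smallBoard, Set.mem_ofPred_eq]; omega
  · ext <;> simp

theorem right_strip (H : Params p q s m) (hC : IsComp s p (smallBoard p s) C) {x y : ℤ}
    (hx : s ≤ x) (hx' : x < p + s) :
    (0 ≤ y → y < p → ((∃ w ∈ C, VRep p q s w (x - s + q, y)) ↔ (x, y) ∈ C)) ∧
    (0 ≤ y → y < p → ((∃ w ∈ C, VRep p q s w (x - s + q, y + p)) ↔ (x - s, y) ∈ C)) ∧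
    (s ≤ y → y < p + s → ((∃ w ∈ C, VRep p q s w (x - s + q, y - s + q)) ↔ (x, y) ∈ C)) ∧
    (2 * p ≤ y → y < 2 * p + s →
      ((∃ w ∈ C, VRep p q s w (x - s + q, y)) ↔ (x, y - 2 * p) ∈ C)) := by
  have hp := H.p_pos
  have hlo := H.s_lo
  have hhi := H.s_hi
  refine ⟨fun h h' => exists_vRep_iff H hC ?_ (Or.inr ((zigzag_corner H x y).2 hx hx').1),
    fun h h' => exists_vRep_iff H hC ?_ (Or.inl ⟨?_, ?_, 0, Or.inr ?_⟩),
    fun h h' => exists_vRep_iff H hC ?_ (Or.inr ((zigzag_corner H x y).2 hx hx').2),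
    fun h h' => exists_vRep_iff H hC ?_ (Or.inr ⟨?_, ?_, 0, Or.inr ?_⟩)⟩
  · simp only [smallBoard, Set.mem_ofPred_eq]; omega
  · simp only [smallBoard, Set.mem_ofPred_eq]; omega
  · simp only; omega
  · simp only; omega
  · ext <;> simp
  · simp only [smallBoard, Set.mem_ofPred_eq]; omega
  · simp only [smallBoard, Set.mem_ofPred_eq]; omega
  · simp only; omega
  · simp only; omega
  · ext <;> simp; ring

end Tours
end Leaper

/-! ### Assembling the tour of a lifted component from its rails. -/

namespace Leaper
section LiftTour
variable {P Q p q s : ℤ} {n : ℕ} {C : Set Square} {lb rb lt rt : List Square}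

theorem mem_lift_corner (H : Params p q s (n + 1)) (hC : IsComp s p (smallBoard p s) C) (x y : ℤ) :
    ((x, y) ∈ lift p q s C ∧ x < p ∧ y < p ↔ (x, y) ∈ C ∧ 0 ≤ x ∧ x < p ∧ 0 ≤ y ∧ y < p) ∧
    ((x, y) ∈ lift p q s C ∧ x < p ∧ q ≤ y ↔
      (x, y - q + s) ∈ C ∧ 0 ≤ x ∧ x < p ∧ s ≤ y - q + s ∧ y - q + s < p + s) ∧
    ((x, y) ∈ lift p q s C ∧ q ≤ x ∧ y < p ↔
      (x - q + s, y) ∈ C ∧ s ≤ x - q + s ∧ x - q + s < p + s ∧ 0 ≤ y ∧ y < p) ∧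
    ((x, y) ∈ lift p q s C ∧ q ≤ x ∧ q ≤ y ↔ (x - q + s, y - q + s) ∈ C ∧
      s ≤ x - q + s ∧ x - q + s < p + s ∧ s ≤ y - q + s ∧ y - q + s < p + s) := by
  have hp := H.p_pos
  have hpq := H.p_lt_q
  have ex : x - q + s - s + q = x := by ring
  have ey : y - q + s - s + q = y := by ring
  have hb : (x, y) ∈ bigBoard p q ↔ 0 ≤ x ∧ x < p + q ∧ 0 ≤ y ∧ y < p + q := Iff.rfl
  have key : x < p ∨ q ≤ x → ((x, y) ∈ lift p q s C ↔
      (x, y) ∈ bigBoard p q ∧ ∃ w ∈ C, VRep p q s w (x, y)) :=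
    fun h => mem_lift_iff_exists_vRep H hC h
  refine ⟨⟨?_, ?_⟩, ⟨?_, ?_⟩, ⟨?_, ?_⟩, ⟨?_, ?_⟩⟩
  · rintro ⟨h, hx, hy⟩
    rw [key (by omega), hb] at h
    exact ⟨((left_strip H hC (by omega) hx).1 (by omega) hy).1 h.2, by omega⟩
  · rintro ⟨h, h1, h2, h3, h4⟩
    rw [key (by omega), hb]
    exact ⟨⟨by omega, ((left_strip H hC h1 h2).1 h3 h4).2 h⟩, h2, h4⟩
  · rintro ⟨h, hx, hy⟩
    rw [key (by omega), hb] at h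
    have := (left_strip (x := x) (y := y - q + s) H hC (by omega) hx).2.2.1 (by omega) (by omega)
    rw [ey] at this
    exact ⟨this.1 h.2, by omega⟩
  · rintro ⟨h, h1, h2, h3, h4⟩
    rw [key (by omega), hb]
    have := (left_strip (x := x) (y := y - q + s) H hC h1 h2).2.2.1 (by omega) (by omega)
    rw [ey] at this
    exact ⟨⟨by omega, this.2 h⟩, h2, by omega⟩
  · rintro ⟨h, hx, hy⟩
    rw [key (by omega), hb] at h
    have := (right_strip (x := x - q + s) (y := y) H hC (by omega) (by omega)).1 (by omega) hy
    rw [ex] at this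
    exact ⟨this.1 h.2, by omega⟩
  · rintro ⟨h, h1, h2, h3, h4⟩
    rw [key (by omega), hb]
    have := (right_strip (x := x - q + s) (y := y) H hC h1 h2).1 h3 h4
    rw [ex] at this
    exact ⟨⟨by omega, this.2 h⟩, by omega, h4⟩
  · rintro ⟨h, hx, hy⟩
    rw [key (by omega), hb] at h
    have := (right_strip (x := x - q + s) (y := y - q + s) H hC (by omega) (by omega)).2.2.1
      (by omega) (by omega)
    rw [ex, ey] at this
    exact ⟨this.1 h.2, by omega⟩
  · rintro ⟨h, h1, h2, h3, h4⟩
    rw [key (by omega), hb]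
    have := (right_strip (x := x - q + s) (y := y - q + s) H hC h1 h2).2.2.1 h3 h4
    rw [ex, ey] at this
    exact ⟨⟨by omega, this.2 h⟩, by omega, by omega⟩

namespace RailData
variable (D : RailData P Q p s C lb rb lt rt)

/-- The arc along the left side of the board. -/
def left (n : ℕ) : List Square := rail lb rb D.L s p n

/-- The arc along the right side of the board, up to translation. -/
def right (n : ℕ) : List Square := rail rb lb D.K (-s) p n

theorem mem_left (H : Params p q s (n + 1)) (hC : IsComp s p (smallBoard p s) C) (x y : ℤ) :
    (x, y) ∈ D.left n ↔ (x, y) ∈ lift p q s C ∧ x < p ∧ p ≤ y ∧ y < q := by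
  have hp := H.p_pos
  have hlo := H.s_lo
  have hhi := H.s_hi
  have hq := H.q_eq
  -- `D` consists of the squares of the left columns, on or off the board, whose zigzag is attached
  -- to `C`; ignoring the horizontal edges of the board makes it periodic.
  have h := mem_rail (A := lb) (B := rb) (L := D.L) (e := s) (s := s)
    (D := fun a => (0 ≤ a.1 ∧ a.1 < p) ∧ ∃ w ∈ C, VRep p q s w a) hp H.s_lo
    (fun x y => by simp only [VRep.add_iff (a2 := y)])
    (fun x y => by
      rw [D.mem_lb]
      constructor
      · rintro ⟨h, h1, h2, h3, h4⟩
        exact ⟨⟨⟨h1, h2⟩, ((left_strip H hC h1 h2).1 h3 h4).2 h⟩, h3, h4⟩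
      · rintro ⟨⟨⟨h1, h2⟩, h⟩, h3, h4⟩
        exact ⟨((left_strip H hC h1 h2).1 h3 h4).1 h, h1, h2, h3, h4⟩)
    (fun x y => by
      have e : x - s + s = x := by ring
      rw [D.mem_rb]
      constructor
      · rintro ⟨h, h1, h2, h3, h4⟩
        have := (left_strip (x := x - s) (y := y) H hC (by omega) (by omega)).2.1 h3 h4
        rw [e] at this
        exact ⟨⟨⟨by simp only; omega, by simp only; omega⟩, this.2 h⟩, h3, h4⟩
      · rintro ⟨⟨⟨h1, h2⟩, h⟩, h3, h4⟩
        simp only at h1 h2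
        have := (left_strip (x := x - s) (y := y) H hC (by omega) (by omega)).2.1 h3 h4
        rw [e] at this
        exact ⟨this.1 h, by omega, by omega, h3, h4⟩)
    (fun x y => by
      have e : y - p + p = y := by ring
      rw [D.mem_L]
      constructor
      · rintro ⟨h1, h2, h3, h4, ⟨h5, h⟩ | ⟨h5, h⟩⟩
        · have := (left_strip (y := y - p) H hC h1 h2).2.1 (by omega) (by omega)
          rw [e] at this
          exact ⟨⟨⟨h1, h2⟩, this.2 h⟩, h3, h4⟩
        · exact ⟨⟨⟨h1, h2⟩, ((left_strip H hC h1 h2).2.2.2 h5 h4).2 h⟩, h3, h4⟩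
      · rintro ⟨⟨⟨h1, h2⟩, h⟩, h3, h4⟩
        refine ⟨h1, h2, h3, h4, ?_⟩
        by_cases h5 : y < 2 * p
        · have := (left_strip (y := y - p) H hC h1 h2).2.1 (by omega) (by omega)
          rw [e] at this
          exact Or.inl ⟨h5, this.1 h⟩
        · exact Or.inr ⟨by omega, ((left_strip H hC h1 h2).2.2.2 (by omega) h4).1 h⟩) n x y
  rw [left, h]
  have hb : (x, y) ∈ bigBoard p q ↔ 0 ≤ x ∧ x < p + q ∧ 0 ≤ y ∧ y < p + q := Iff.rfl
  have hpq := H.p_lt_q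
  constructor
  · rintro ⟨⟨⟨h1, h2⟩, h⟩, h3, h4⟩
    refine ⟨(mem_lift_iff_exists_vRep H hC (Or.inl h2)).2 ⟨?_, h⟩, h2, h3, by omega⟩
    simp only at h1 h2
    rw [hb]; omega
  · rintro ⟨h, h2, h3, h4⟩
    obtain ⟨h5, h⟩ := (mem_lift_iff_exists_vRep H hC (Or.inl h2)).1 h
    rw [hb] at h5
    exact ⟨⟨⟨by simp only; omega, h2⟩, h⟩, h3, by omega⟩

theorem mem_right (H : Params p q s (n + 1)) (hC : IsComp s p (smallBoard p s) C) (x y : ℤ) :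
    (x, y) ∈ sh (q - s, 0) (D.right n) ↔ (x, y) ∈ lift p q s C ∧ q ≤ x ∧ p ≤ y ∧ y < q := by
  have hp := H.p_pos
  have hlo := H.s_lo
  have hhi := H.s_hi
  have hq := H.q_eq
  have h := mem_rail (A := rb) (B := lb) (L := D.K) (e := -s) (s := s)
    (D := fun a => (s ≤ a.1 ∧ a.1 < p + s) ∧ ∃ w ∈ C, VRep p q s w (a.1 - s + q, a.2)) hp H.s_lo
    (fun x y => by simp only [VRep.add_iff (a2 := y)])
    (fun x y => by
      rw [D.mem_rb]
      constructor
      · rintro ⟨h, h1, h2, h3, h4⟩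
        exact ⟨⟨⟨h1, h2⟩, ((right_strip H hC h1 h2).1 h3 h4).2 h⟩, h3, h4⟩
      · rintro ⟨⟨⟨h1, h2⟩, h⟩, h3, h4⟩
        exact ⟨((right_strip H hC h1 h2).1 h3 h4).1 h, h1, h2, h3, h4⟩)
    (fun x y => by
      have e : x - -s - s = x := by ring
      rw [D.mem_lb]
      constructor
      · rintro ⟨h, h1, h2, h3, h4⟩
        have := (right_strip (x := x - -s) (y := y) H hC (by omega) (by omega)).2.1 h3 h4
        rw [e] at this
        exact ⟨⟨⟨by simp only; omega, by simp only; omega⟩, by simpa only [e] using this.2 h⟩,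
          h3, h4⟩
      · rintro ⟨⟨⟨h1, h2⟩, h⟩, h3, h4⟩
        simp only at h1 h2
        have := (right_strip (x := x - -s) (y := y) H hC (by omega) (by omega)).2.1 h3 h4
        rw [e] at this
        exact ⟨this.1 (by simpa only [e] using h), by omega, by omega, h3, h4⟩)
    (fun x y => by
      have e : y - p + p = y := by ring
      rw [D.mem_K]
      constructor
      · rintro ⟨h1, h2, h3, h4, ⟨h5, h⟩ | ⟨h5, h⟩⟩
        · have := (right_strip (y := y - p) H hC h1 h2).2.1 (by omega) (by omega)
          rw [e] at this
          exact ⟨⟨⟨h1, h2⟩, this.2 h⟩, h3, h4⟩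
        · exact ⟨⟨⟨h1, h2⟩, ((right_strip H hC h1 h2).2.2.2 h5 h4).2 h⟩, h3, h4⟩
      · rintro ⟨⟨⟨h1, h2⟩, h⟩, h3, h4⟩
        refine ⟨h1, h2, h3, h4, ?_⟩
        by_cases h5 : y < 2 * p
        · have := (right_strip (y := y - p) H hC h1 h2).2.1 (by omega) (by omega)
          rw [e] at this
          exact Or.inl ⟨h5, this.1 h⟩
        · exact Or.inr ⟨by omega, ((right_strip H hC h1 h2).2.2.2 (by omega) h4).1 h⟩) n
      (x - (q - s)) y
  rw [right, mem_sh, Prod.mk_sub_mk, sub_zero, h]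
  have hb : (x, y) ∈ bigBoard p q ↔ 0 ≤ x ∧ x < p + q ∧ 0 ≤ y ∧ y < p + q := Iff.rfl
  have hpq := H.p_lt_q
  have ex : x - (q - s) - s + q = x := by ring
  simp only [ex]
  constructor
  · rintro ⟨⟨⟨h1, h2⟩, h⟩, h3, h4⟩
    have h6 : q ≤ x := by omega
    refine ⟨(mem_lift_iff_exists_vRep H hC (Or.inr h6)).2 ⟨?_, h⟩, h6, h3, by omega⟩
    rw [hb]; omega
  · rintro ⟨h, h2, h3, h4⟩
    obtain ⟨h5, h⟩ := (mem_lift_iff_exists_vRep H hC (Or.inr h2)).1 h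
    rw [hb] at h5
    exact ⟨⟨⟨by omega, by omega⟩, h⟩, h3, by omega⟩

theorem two_mul_mul_eq (H : Params p q s (n + 1)) : 2 * (((n : ℤ) + 1) * p) = q - s := by
  rw [H.q_eq]; ring

theorem chain_left (H : Params p q s (n + 1)) :
    (lb ++ D.left n ++ sh (0, q - s) lt).IsChain (Mv P Q) := by
  have := isChain_rail D.ne_lb D.ne_rb D.eq_L D.eq_K D.chain_L D.chain_K n
  rwa [two_mul_mul_eq H] at this

theorem chain_right (H : Params p q s (n + 1)) :
    (rb ++ D.right n ++ sh (0, q - s) rt).IsChain (Mv P Q) := by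
  have := isChain_rail (e := -s) D.ne_rb D.ne_lb (by rw [neg_neg]; exact D.eq_K) D.eq_L
    D.chain_K D.chain_L n
  rwa [two_mul_mul_eq H] at this

theorem left_append (H : Params p q s (n + 1)) :
    D.left n ++ sh (0, q - s) lt = sh (-s, p) (rb ++ D.right n) := by
  rw [← two_mul_mul_eq H]; exact rail_append_eq D.eq_L n

theorem right_append (H : Params p q s (n + 1)) :
    D.right n ++ sh (0, q - s) rt = sh (s, p) (lb ++ D.left n) := by
  have := rail_append_eq (A := rb) (B := lb) (L := D.K) (K := D.L) (T := rt) (e := -s) (by rw [neg_neg]; exact D.eq_K) n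
  rwa [two_mul_mul_eq H, neg_neg] at this

theorem nodup_left (hp : 0 < p) : (D.left n).Nodup :=
  (nodup_rail hp (fun a ha => ((D.mem_lb a.1 a.2).1 ha).2.2.2)
    (fun a ha => ((D.mem_rb a.1 a.2).1 ha).2.2.2) (fun a ha => ((D.mem_L a.1 a.2).1 ha).2.2.1)
    D.nodup_lb D.nodup_rb D.nodup_L n).1

theorem nodup_right (hp : 0 < p) : (D.right n).Nodup :=
  (nodup_rail hp (fun a ha => ((D.mem_rb a.1 a.2).1 ha).2.2.2)
    (fun a ha => ((D.mem_lb a.1 a.2).1 ha).2.2.2) (fun a ha => ((D.mem_K a.1 a.2).1 ha).2.2.1)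
    D.nodup_rb D.nodup_lb D.nodup_K n).1

/-- The tour of a lifted component. -/
def arcTour (H : Params p q s (n + 1)) (hC : IsComp s p (smallBoard p s) C)
    (D' : RailData P Q p s (Prod.swap ⁻¹' C) (sw lb.reverse) (sw lt) (sw rb) (sw rt.reverse)) :
    ArcTour P Q p q (lift p q s C) where
  bl := lb
  l := D.left n
  tl := sh (0, q - s) lt
  -- The horizontal sides are the vertical sides of the reflected component, reflected back.
  t := sh (0, q - s) (sw (D'.right n))
  tr := sh (q - s, q - s) rt
  rt := sh (q - s, 0) (D.right n)
  br := sh (q - s, 0) rb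
  b := sw (D'.left n)
  sub := (isComp_lift H hC).subset
  mem_bl x y := by rw [(mem_lift_corner H hC x y).1, D.mem_lb]
  mem_l x y := D.mem_left H hC x y
  mem_tl x y := by
    rw [(mem_lift_corner H hC x y).2.1, mem_sh, Prod.mk_sub_mk, sub_zero, D.mem_lt,
      show y - (q - s) = y - q + s by ring]
  mem_t x y := by
    have := D'.mem_right H (isComp_swap hC) y x
    rw [lift_swap, Set.mem_preimage, Prod.swap_prod_mk, mem_sh] at this
    rw [mem_sh, mem_sw]
    simp only [Prod.mk_sub_mk, Prod.swap_prod_mk] at this ⊢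
    rw [this]; tauto
  mem_tr x y := by
    rw [(mem_lift_corner H hC x y).2.2.2, mem_sh, Prod.mk_sub_mk, D.mem_rt,
      show y - (q - s) = y - q + s by ring, show x - (q - s) = x - q + s by ring]
  mem_rt x y := D.mem_right H hC x y
  mem_br x y := by
    rw [(mem_lift_corner H hC x y).2.2.1, mem_sh, Prod.mk_sub_mk, sub_zero, D.mem_rb,
      show x - (q - s) = x - q + s by ring]
  mem_b x y := by
    have := D'.mem_left H (isComp_swap hC) y x
    rw [lift_swap, Set.mem_preimage, Prod.swap_prod_mk] at this
    rw [mem_sw, Prod.swap_prod_mk, this]; tauto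
  not_mid x y := by
    rintro ⟨z, hz, hr⟩ h
    rcases hr.2.2 with hv | hv <;> have := hv.outer H <;> simp only [Prod.swap_prod_mk] at this <;>
      omega
  nodup_bl := D.nodup_lb
  nodup_l := D.nodup_left H.p_pos
  nodup_tl := nodup_sh.2 D.nodup_lt
  nodup_t := nodup_sh.2 (nodup_sw.2 (D'.nodup_right H.p_pos))
  nodup_tr := nodup_sh.2 D.nodup_rt
  nodup_rt := nodup_sh.2 (D.nodup_right H.p_pos)
  nodup_br := nodup_sh.2 D.nodup_rb
  nodup_b := nodup_sw.2 (D'.nodup_left H.p_pos)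
  ne_bl := D.ne_lb
  ne_tl := by simpa using D.ne_lt
  ne_tr := by simpa using D.ne_rt
  ne_br := by simpa using D.ne_rb
  chain_l := D.chain_left H
  chain_rt := by simpa using isChain_sh (v := (q - s, 0)) (D.chain_right H)
  chain_b := by simpa using isChain_sw (D'.chain_left H)
  chain_t := by simpa using isChain_sh (v := (0, q - s)) (isChain_sw (D'.chain_right H))
  eq_l := by
    rw [D.left_append H, ← sh_append, sh_sh]
    exact sh_eq_of_eq _ (by ext <;> simp; ring)
  eq_rt := by
    have := congrArg (sh (q - s, 0)) (D.right_append H)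
    rw [sh_append, sh_sh, sh_sh] at this
    convert this using 2
    · exact sh_eq_of_eq _ (by ext <;> simp)
    · ext <;> simp
  eq_b := by
    have := congrArg (fun l => sh (-p, q) (sw l)) (D'.left_append H)
    simp only [sw_append, sw_sh, sw_sw, Prod.swap_prod_mk, sh_sh, sh_append] at this ⊢
    rw [this]
    congr 1 <;> exact sh_eq_of_eq _ (by ext <;> simp <;> ring)
  eq_t := by
    have := congrArg (fun l => sh (0, q - s) (sw l)) (D'.right_append H)
    simp only [sw_append, sw_sh, sw_sw, sw_reverse, Prod.swap_prod_mk, sh_sh, sh_append] at this ⊢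
    convert this using 2
    · rw [← sh_reverse]; exact sh_eq_of_eq _ (by ext <;> simp)
    · exact sh_eq_of_eq _ (by ext <;> simp)
    · exact sh_eq_of_eq _ (by ext <;> simp)

end RailData
end LiftTour
end Leaper

/-! ### Windows of a tour, and the case `q = 2mp + r`. -/

namespace Leaper
section FromArcTour
variable {P Q r p : ℤ} {C : Set Square}

namespace ArcTour
variable (T : ArcTour P Q r p C)

/-- The part of a tour outside the rightmost columns and the topmost rows. -/
def cornerLB : List Square := T.b.reverse ++ T.bl ++ T.l
/-- The part of a tour outside the leftmost columns and the topmost rows. -/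
def cornerRB : List Square := T.b ++ T.br ++ T.rt
/-- The part of a tour outside the rightmost columns and the bottom rows. -/
def cornerLT : List Square := T.l ++ T.tl ++ T.t
/-- The part of a tour outside the leftmost columns and the bottom rows. -/
def cornerRT : List Square := T.rt ++ T.tr ++ T.t.reverse

theorem cornerLB_swap : T.swap.cornerLB = sw T.cornerLB.reverse := by
  simp [cornerLB, ArcTour.swap]
theorem cornerRB_swap : T.swap.cornerRB = sw T.cornerLT := by
  simp [cornerRB, cornerLT, ArcTour.swap]
theorem cornerLT_swap : T.swap.cornerLT = sw T.cornerRB := by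
  simp [cornerRB, cornerLT, ArcTour.swap]
theorem cornerRT_swap : T.swap.cornerRT = sw T.cornerRT.reverse := by
  simp [cornerRT, ArcTour.swap]

theorem mem_cornerLB (hr : r ≤ p) (x y : ℤ) :
    (x, y) ∈ T.cornerLB ↔ (x, y) ∈ C ∧ x < p ∧ y < p := by
  have := T.not_mid x y
  simp only [cornerLB, List.mem_append, List.mem_reverse, T.mem_b, T.mem_bl, T.mem_l]
  by_cases h : (x, y) ∈ C
  · have := this h
    simp only [h, true_and]
    omega
  · simp only [h, false_and, or_self]

theorem mem_cornerRB (hr : r ≤ p) (x y : ℤ) :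
    (x, y) ∈ T.cornerRB ↔ (x, y) ∈ C ∧ r ≤ x ∧ y < p := by
  have := T.not_mid x y
  simp only [cornerRB, List.mem_append, T.mem_b, T.mem_br, T.mem_rt]
  by_cases h : (x, y) ∈ C
  · have := this h
    simp only [h, true_and]
    omega
  · simp only [h, false_and, or_self]

theorem mem_cornerLT (hr : r ≤ p) (x y : ℤ) :
    (x, y) ∈ T.cornerLT ↔ (x, y) ∈ C ∧ x < p ∧ r ≤ y := by
  have := T.not_mid x y
  simp only [cornerLT, List.mem_append, T.mem_t, T.mem_tl, T.mem_l]
  by_cases h : (x, y) ∈ C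
  · have := this h
    simp only [h, true_and]
    omega
  · simp only [h, false_and, or_self]

theorem mem_cornerRT (hr : r ≤ p) (x y : ℤ) :
    (x, y) ∈ T.cornerRT ↔ (x, y) ∈ C ∧ r ≤ x ∧ r ≤ y := by
  have := T.not_mid x y
  simp only [cornerRT, List.mem_append, List.mem_reverse, T.mem_t, T.mem_tr, T.mem_rt]
  by_cases h : (x, y) ∈ C
  · have := this h
    simp only [h, true_and]
    omega
  · simp only [h, false_and, or_self]

theorem nodup_b_bl : (T.b.reverse ++ T.bl).Nodup := by
  refine (List.nodup_reverse.2 T.nodup_b).append T.nodup_bl ?_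
  rintro ⟨x, y⟩ h h'
  rw [List.mem_reverse, T.mem_b] at h
  rw [T.mem_bl] at h'
  omega

theorem nodup_b_br : (T.b ++ T.br).Nodup := by
  refine T.nodup_b.append T.nodup_br ?_
  rintro ⟨x, y⟩ h h'
  rw [T.mem_b] at h
  rw [T.mem_br] at h'
  omega

theorem nodup_cornerLB : T.cornerLB.Nodup := by
  refine T.nodup_b_bl.append T.nodup_l ?_
  rintro ⟨x, y⟩ h h'
  rw [List.mem_append, List.mem_reverse, T.mem_b, T.mem_bl] at h
  rw [T.mem_l] at h'
  omega

theorem nodup_cornerRB : T.cornerRB.Nodup := by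
  refine T.nodup_b_br.append T.nodup_rt ?_
  rintro ⟨x, y⟩ h h'
  rw [List.mem_append, T.mem_b, T.mem_br] at h
  rw [T.mem_rt] at h'
  omega

theorem nodup_cornerLT : T.cornerLT.Nodup := by
  refine (T.nodup_l.append T.nodup_tl ?_).append T.nodup_t ?_ <;> rintro ⟨x, y⟩ h h'
  · rw [T.mem_l] at h
    rw [T.mem_tl] at h'
    omega
  · rw [List.mem_append, T.mem_l, T.mem_tl] at h
    rw [T.mem_t] at h'
    omega

theorem nodup_cornerRT : T.cornerRT.Nodup := by
  refine (T.nodup_rt.append T.nodup_tr ?_).append (List.nodup_reverse.2 T.nodup_t) ?_ <;>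
    rintro ⟨x, y⟩ h h'
  · rw [T.mem_rt] at h
    rw [T.mem_tr] at h'
    omega
  · rw [List.mem_append, T.mem_rt, T.mem_tr] at h
    rw [List.mem_reverse, T.mem_t] at h'
    omega

theorem ne_tl_t : T.tl ++ T.t ≠ [] := by simp [T.ne_tl]
theorem ne_tr_t : T.tr ++ T.t.reverse ≠ [] := by simp [T.ne_tr]
theorem ne_cornerLB : T.cornerLB ≠ [] := by simp [cornerLB, T.ne_bl]
theorem ne_cornerRB : T.cornerRB ≠ [] := by simp [cornerRB, T.ne_br]
theorem ne_cornerLT : T.cornerLT ≠ [] := by simp [cornerLT, T.ne_tl]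
theorem ne_cornerRT : T.cornerRT ≠ [] := by simp [cornerRT, T.ne_tr]

theorem eq_t' : T.tr ++ T.t.reverse = sh (r, p) (T.b.reverse ++ T.bl) := by
  have := congrArg List.reverse T.eq_t
  simpa using this

/-- The corner arcs are nonempty, so pieces of the tour which overlap in them glue. -/
theorem chain_outer_left :
    (T.b.reverse ++ T.bl ++ T.l ++ (T.tl ++ T.t)).IsChain (Mv P Q) := by
  have h1 : (T.b.reverse ++ T.bl).IsChain (Mv P Q) := by
    simpa using isChain_rev (T.chain_b.left_of_append)
  have h2 : (T.bl ++ (T.l ++ T.tl)).IsChain (Mv P Q) := by simpa using T.chain_l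
  have h3 : (T.tl ++ T.t).IsChain (Mv P Q) := T.chain_t.left_of_append
  have h4 : (T.b.reverse ++ T.bl ++ T.l ++ T.tl).IsChain (Mv P Q) := by
    simpa using h1.append_overlap h2 T.ne_bl
  simpa using h4.append_overlap h3 T.ne_tl

theorem chain_outer_right :
    (T.b ++ T.br ++ T.rt ++ (T.tr ++ T.t.reverse)).IsChain (Mv P Q) := by
  have h1 : (T.b ++ T.br).IsChain (Mv P Q) := by
    have := T.chain_b
    rw [List.append_assoc] at this
    exact this.right_of_append
  have h2 : (T.br ++ (T.rt ++ T.tr)).IsChain (Mv P Q) := by simpa using T.chain_rt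
  have h3 : (T.tr ++ T.t.reverse).IsChain (Mv P Q) := by
    have := T.chain_t
    rw [List.append_assoc] at this
    simpa using isChain_rev this.right_of_append
  have h4 : (T.b ++ T.br ++ T.rt ++ T.tr).IsChain (Mv P Q) := by
    simpa using h1.append_overlap h2 T.ne_br
  simpa using h4.append_overlap h3 T.ne_tr

/-- By `eq_b`, the translate of `cornerRB` begins with `tl ++ t`, which is how the tour itself
continues after `cornerLB`. -/
theorem chain_LB_RB : (T.cornerLB ++ sh (-r, p) T.cornerRB).IsChain (Mv P Q) := by
  have h := isChain_sh (v := (-r, p)) T.chain_outer_right.left_of_append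
  rw [sh_append, ← T.eq_b] at h
  have := T.chain_outer_left.append_overlap h T.ne_tl_t
  rw [cornerRB, sh_append, ← T.eq_b]
  simpa [cornerLB] using this

theorem chain_RB_LB : (T.cornerRB ++ sh (r, p) T.cornerLB).IsChain (Mv P Q) := by
  have h := isChain_sh (v := (r, p)) T.chain_outer_left.left_of_append
  rw [sh_append, ← T.eq_t'] at h
  have := T.chain_outer_right.append_overlap h T.ne_tr_t
  rw [cornerLB, sh_append, ← T.eq_t']
  simpa [cornerRB] using this

/-- A tour over a component for an `(r, p)`-leaper yields the data for the case
`q = 2mp + r`. -/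
def railData (hrp : r < p) :
    RailData P Q p r C T.cornerLB T.cornerRB T.cornerLT T.cornerRT where
  -- For `s = r` the last stretch is one full level together with `r` further rows.
  L := sh (-r, p) T.cornerRB ++ sh (0, 2 * p) (T.b.reverse ++ T.bl)
  K := sh (r, p) T.cornerLB ++ sh (0, 2 * p) (T.b ++ T.br)
  mem_lb x y := by
    have : (x, y) ∈ C → _ := fun h => T.sub h
    simp only [bigBoard, Set.mem_ofPred_eq] at this
    rw [T.mem_cornerLB hrp.le]
    constructor
    · rintro ⟨h, h1⟩; have := this h; exact ⟨h, by omega⟩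
    · rintro ⟨h, h1⟩; exact ⟨h, by omega⟩
  mem_rb x y := by
    have : (x, y) ∈ C → _ := fun h => T.sub h
    simp only [bigBoard, Set.mem_ofPred_eq] at this
    rw [T.mem_cornerRB hrp.le]
    constructor
    · rintro ⟨h, h1⟩; have := this h; exact ⟨h, by omega⟩
    · rintro ⟨h, h1⟩; exact ⟨h, by omega⟩
  mem_lt x y := by
    have : (x, y) ∈ C → _ := fun h => T.sub h
    simp only [bigBoard, Set.mem_ofPred_eq] at this
    rw [T.mem_cornerLT hrp.le]
    constructor
    · rintro ⟨h, h1⟩; have := this h; exact ⟨h, by omega⟩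
    · rintro ⟨h, h1⟩; exact ⟨h, by omega⟩
  mem_rt x y := by
    have : (x, y) ∈ C → _ := fun h => T.sub h
    simp only [bigBoard, Set.mem_ofPred_eq] at this
    rw [T.mem_cornerRT hrp.le]
    constructor
    · rintro ⟨h, h1⟩; have := this h; exact ⟨h, by omega⟩
    · rintro ⟨h, h1⟩; exact ⟨h, by omega⟩
  mem_L x y := by
    have h1 : (x - -r, y - p) ∈ C → _ := fun h => T.sub h
    have h2 : (x, y - 2 * p) ∈ C → _ := fun h => T.sub h
    simp only [bigBoard, Set.mem_ofPred_eq] at h1 h2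
    simp only [List.mem_append, mem_sh, Prod.mk_sub_mk, sub_zero, T.mem_cornerRB hrp.le,
      List.mem_reverse, T.mem_b, T.mem_bl, ← sub_neg_eq_add]
    by_cases h : (x - -r, y - p) ∈ C <;> by_cases h' : (x, y - 2 * p) ∈ C <;>
      simp only [h, h', true_and, false_and, and_true, and_false, or_false, false_or,
        or_self, forall_const, false_imp_iff] at h1 h2 ⊢ <;> omega
  mem_K x y := by
    have h1 : (x - r, y - p) ∈ C → _ := fun h => T.sub h
    have h2 : (x, y - 2 * p) ∈ C → _ := fun h => T.sub h
    simp only [bigBoard, Set.mem_ofPred_eq] at h1 h2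
    simp only [List.mem_append, mem_sh, Prod.mk_sub_mk, sub_zero, T.mem_cornerLB hrp.le,
      T.mem_b, T.mem_br]
    by_cases h : (x - r, y - p) ∈ C <;> by_cases h' : (x, y - 2 * p) ∈ C <;>
      simp only [h, h', true_and, false_and, and_true, and_false, or_false, false_or,
        or_self, forall_const, false_imp_iff] at h1 h2 ⊢ <;> omega
  nodup_lb := T.nodup_cornerLB
  nodup_rb := T.nodup_cornerRB
  nodup_lt := T.nodup_cornerLT
  nodup_rt := T.nodup_cornerRT
  nodup_L := by
    refine (nodup_sh.2 T.nodup_cornerRB).append (nodup_sh.2 T.nodup_b_bl) ?_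
    rintro ⟨x, y⟩ h h'
    rw [mem_sh, Prod.mk_sub_mk, T.mem_cornerRB hrp.le] at h
    rw [mem_sh, Prod.mk_sub_mk, List.mem_append, List.mem_reverse, T.mem_b, T.mem_bl] at h'
    have : (x - 0, y - 2 * p) ∈ bigBoard r p := T.sub (h'.elim (fun h => h.1) fun h => h.1)
    simp only [bigBoard, Set.mem_ofPred_eq] at this
    omega
  nodup_K := by
    refine (nodup_sh.2 T.nodup_cornerLB).append (nodup_sh.2 T.nodup_b_br) ?_
    rintro ⟨x, y⟩ h h'
    rw [mem_sh, Prod.mk_sub_mk, T.mem_cornerLB hrp.le] at h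
    rw [mem_sh, Prod.mk_sub_mk, List.mem_append, T.mem_b, T.mem_br] at h'
    have : (x - 0, y - 2 * p) ∈ bigBoard r p := T.sub (h'.elim (fun h => h.1) fun h => h.1)
    simp only [bigBoard, Set.mem_ofPred_eq] at this
    omega
  ne_lb := T.ne_cornerLB
  ne_rb := T.ne_cornerRB
  ne_lt := T.ne_cornerLT
  ne_rt := T.ne_cornerRT
  eq_L := by
    have e : sh (0, 2 * p) (T.b ++ T.br) = sh (r, p) (T.tl ++ T.t) := by
      rw [T.eq_b, sh_sh]; exact sh_eq_of_eq _ (by ext <;> simp; ring)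
    have e2 : sh (-r, p) (sh (r, p) (T.cornerLB ++ (T.tl ++ T.t)))
        = sh (0, 2 * p) (T.cornerLB ++ (T.tl ++ T.t)) := by
      rw [sh_sh]; exact sh_eq_of_eq _ (by ext <;> simp; ring)
    rw [e, ← sh_append, sh_append (-r, p), e2, List.append_assoc, ← sh_append]
    simp [cornerLT, cornerLB]
  eq_K := by
    have e : sh (0, 2 * p) (T.b.reverse ++ T.bl) = sh (-r, p) (T.tr ++ T.t.reverse) := by
      rw [T.eq_t', sh_sh]; exact sh_eq_of_eq _ (by ext <;> simp; ring)
    have e2 : sh (r, p) (sh (-r, p) (T.cornerRB ++ (T.tr ++ T.t.reverse)))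
        = sh (0, 2 * p) (T.cornerRB ++ (T.tr ++ T.t.reverse)) := by
      rw [sh_sh]; exact sh_eq_of_eq _ (by ext <;> simp; ring)
    rw [e, ← sh_append, sh_append (r, p), e2, List.append_assoc, ← sh_append]
    simp [cornerRT, cornerRB]
  chain_L := by
    have e2 : sh (-r, p) (sh (r, p) T.cornerLB) = sh (0, 2 * p) T.cornerLB := by
      rw [sh_sh]; exact sh_eq_of_eq _ (by ext <;> simp; ring)
    have h1 := isChain_sh (v := (-r, p)) T.chain_RB_LB
    rw [sh_append, e2] at h1
    have h2 := T.chain_LB_RB.append_overlap h1 (by simpa using T.ne_cornerRB)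
    have h3 := isChain_sh (v := (0, 2 * p)) T.chain_outer_left
    rw [sh_append] at h3
    have h4 := h2.append_overlap h3 (by simpa [cornerLB] using fun _ h => absurd h T.ne_bl)
    simpa [cornerLT, cornerLB] using h4
  chain_K := by
    have e2 : sh (r, p) (sh (-r, p) T.cornerRB) = sh (0, 2 * p) T.cornerRB := by
      rw [sh_sh]; exact sh_eq_of_eq _ (by ext <;> simp; ring)
    have h1 := isChain_sh (v := (r, p)) T.chain_LB_RB
    rw [sh_append, e2] at h1
    have h2 := T.chain_RB_LB.append_overlap h1 (by simpa using T.ne_cornerLB)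
    have h3 := isChain_sh (v := (0, 2 * p)) T.chain_outer_right
    rw [sh_append] at h3
    have h4 := h2.append_overlap h3 (by simpa [cornerRB] using fun _ h => absurd h T.ne_br)
    simpa [cornerRT, cornerRB] using h4

end ArcTour
end FromArcTour
end Leaper

/-! ### The case `q = 2mp - r`, and the lifts of isolated squares. -/

namespace Leaper
section LiftExists
variable {P Q r p q s : ℤ} {n : ℕ} {C : Set Square}

namespace ArcTour
variable (T : ArcTour P Q r p C)

theorem eq_b' : sh (r, p) (T.tl ++ T.t) = sh (0, 2 * p) (T.b ++ T.br) := by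
  rw [T.eq_b, sh_sh]; exact sh_eq_of_eq _ (by ext <;> simp; ring)

theorem eq_t'' : sh (-r, p) (T.tr ++ T.t.reverse) = sh (0, 2 * p) (T.b.reverse ++ T.bl) := by
  rw [T.eq_t', sh_sh]; exact sh_eq_of_eq _ (by ext <;> simp; ring)

/-- In the tour, `l` stands between `b.reverse ++ bl` and `tl ++ t`. By `eq_t'` and `eq_b'`,
suitable translates of these two are the end of `cornerRT` and the beginning of the translated
`cornerRB`. -/
theorem cornerRT_chain :
    (T.cornerRT ++ sh (r, p) T.l ++ sh (0, 2 * p) T.cornerRB).IsChain (Mv P Q) := by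
  have h1 : (T.rt ++ (T.tr ++ T.t.reverse)).IsChain (Mv P Q) := by
    have := T.chain_outer_right
    rw [List.append_assoc] at this
    exact this.right_of_append
  have h2 := isChain_sh (v := (r, p)) T.chain_outer_left
  rw [sh_append, sh_append, ← T.eq_t', List.append_assoc] at h2
  have h3 := isChain_sh (v := (0, 2 * p)) T.chain_outer_right.left_of_append
  rw [sh_append, ← T.eq_b'] at h3
  have h4 := h1.append_overlap h2 T.ne_tr_t
  rw [← List.append_assoc] at h4
  have h5 := h4.append_overlap h3 (by simp [T.ne_tl])
  rw [cornerRB, sh_append, ← T.eq_b']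
  simpa [cornerRT] using h5

theorem cornerLT_chain :
    (T.cornerLT ++ sh (-r, p) T.rt ++ sh (0, 2 * p) T.cornerLB).IsChain (Mv P Q) := by
  have h1 : (T.l ++ (T.tl ++ T.t)).IsChain (Mv P Q) := by
    have := T.chain_outer_left
    rw [List.append_assoc] at this
    exact this.right_of_append
  have h2 := isChain_sh (v := (-r, p)) T.chain_outer_right
  rw [sh_append, sh_append, ← T.eq_b, List.append_assoc] at h2
  have h3 := isChain_sh (v := (0, 2 * p)) T.chain_outer_left.left_of_append
  rw [sh_append, ← T.eq_t''] at h3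
  have h4 := h1.append_overlap h2 T.ne_tl_t
  rw [← List.append_assoc] at h4
  have h5 := h4.append_overlap h3 (by simp [T.ne_tr])
  rw [cornerLB, sh_append, ← T.eq_t'']
  simpa [cornerLT] using h5

theorem eq_cornerLT : sh (r, p) T.l ++ sh (0, 2 * p) T.cornerRB
    = sh (r, p) (T.cornerLT ++ sh (-r, p) T.rt) := by
  have e : sh (r, p) (sh (-r, p) T.rt) = sh (0, 2 * p) T.rt := by
    rw [sh_sh]; exact sh_eq_of_eq _ (by ext <;> simp; ring)
  rw [cornerLT, cornerRB, sh_append, sh_append (r, p), e, List.append_assoc T.l, sh_append (r, p),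
    T.eq_b', List.append_assoc]

theorem eq_cornerRT : sh (-r, p) T.rt ++ sh (0, 2 * p) T.cornerLB
    = sh (-r, p) (T.cornerRT ++ sh (r, p) T.l) := by
  have e : sh (-r, p) (sh (r, p) T.l) = sh (0, 2 * p) T.l := by
    rw [sh_sh]; exact sh_eq_of_eq _ (by ext <;> simp; ring)
  rw [cornerRT, cornerLB, sh_append, sh_append (-r, p), e, List.append_assoc T.rt,
    sh_append (-r, p), T.eq_t'', List.append_assoc]

theorem sh_comm (v w : Square) (l : List Square) : sh v (sh w l) = sh w (sh v l) := by
  rw [sh_sh, sh_sh, add_comm]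

/-- A tour over a component for an `(r, p)`-leaper yields the data for the case
`q = 2mp - r`. -/
def railDataNeg (hr : 0 ≤ r) (hrp : r < p) :
    RailData P Q p (-r) ((fun a => a + (r, r)) ⁻¹' C) (sh (-r, -r) T.cornerRT)
      (sh (-r, -r) T.cornerLT) (sh (-r, -r) T.cornerRB) (sh (-r, -r) T.cornerLB) where
  -- For `s = -r` the last stretch has only `p - r` rows. They correspond to the rows of `C` from
  -- `r` to `p`, where `not_mid` leaves nothing but the side arc.
  L := sh (-r, -r) (sh (r, p) T.l)
  K := sh (-r, -r) (sh (-r, p) T.rt)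
  mem_lb x y := by
    have : (x + r, y + r) ∈ C → _ := fun h => T.sub h
    simp only [bigBoard, Set.mem_ofPred_eq] at this
    simp only [mem_sh, Prod.mk_sub_mk, sub_neg_eq_add, T.mem_cornerRT hrp.le, Set.mem_preimage,
      Prod.mk_add_mk]
    constructor
    · rintro ⟨h, h1⟩; have := this h; exact ⟨h, by omega⟩
    · rintro ⟨h, h1⟩; exact ⟨h, by omega⟩
  mem_rb x y := by
    have : (x + r, y + r) ∈ C → _ := fun h => T.sub h
    simp only [bigBoard, Set.mem_ofPred_eq] at this
    simp only [mem_sh, Prod.mk_sub_mk, sub_neg_eq_add, T.mem_cornerLT hrp.le, Set.mem_preimage,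
      Prod.mk_add_mk]
    constructor
    · rintro ⟨h, h1⟩; have := this h; exact ⟨h, by omega⟩
    · rintro ⟨h, h1⟩; exact ⟨h, by omega⟩
  mem_lt x y := by
    have : (x + r, y + r) ∈ C → _ := fun h => T.sub h
    simp only [bigBoard, Set.mem_ofPred_eq] at this
    simp only [mem_sh, Prod.mk_sub_mk, sub_neg_eq_add, T.mem_cornerRB hrp.le, Set.mem_preimage,
      Prod.mk_add_mk]
    constructor
    · rintro ⟨h, h1⟩; have := this h; exact ⟨h, by omega⟩
    · rintro ⟨h, h1⟩; exact ⟨h, by omega⟩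
  mem_rt x y := by
    have : (x + r, y + r) ∈ C → _ := fun h => T.sub h
    simp only [bigBoard, Set.mem_ofPred_eq] at this
    simp only [mem_sh, Prod.mk_sub_mk, sub_neg_eq_add, T.mem_cornerLB hrp.le, Set.mem_preimage,
      Prod.mk_add_mk]
    constructor
    · rintro ⟨h, h1⟩; have := this h; exact ⟨h, by omega⟩
    · rintro ⟨h, h1⟩; exact ⟨h, by omega⟩
  mem_L x y := by
    have h1 : (x, y - p + r) ∈ C → _ := fun h => T.sub h
    have h2 := T.not_mid x (y - p + r)
    simp only [bigBoard, Set.mem_ofPred_eq] at h1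
    simp only [mem_sh, Prod.mk_sub_mk, sub_neg_eq_add, T.mem_l, Set.mem_preimage,
      Prod.mk_add_mk, add_sub_cancel_right, neg_add_cancel_right,
      show y + r - p = y - p + r by ring]
    constructor
    · rintro ⟨h, h3⟩; have := h1 h; exact ⟨by omega, by omega, by omega, by omega,
        Or.inl ⟨by omega, h⟩⟩
    · rintro ⟨h3, h4, h5, h6, ⟨-, h⟩ | ⟨h7, -⟩⟩
      · have := h2 h
        exact ⟨h, by omega⟩
      · omega
  mem_K x y := by
    have h1 : (x + r + r, y - p + r) ∈ C → _ := fun h => T.sub h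
    have h2 := T.not_mid (x + r + r) (y - p + r)
    simp only [bigBoard, Set.mem_ofPred_eq] at h1
    simp only [mem_sh, Prod.mk_sub_mk, sub_neg_eq_add, T.mem_rt, Set.mem_preimage,
      Prod.mk_add_mk, show y + r - p = y - p + r by ring]
    constructor
    · rintro ⟨h, h3⟩; have := h1 h; exact ⟨by omega, by omega, by omega, by omega,
        Or.inl ⟨by omega, h⟩⟩
    · rintro ⟨h3, h4, h5, h6, ⟨-, h⟩ | ⟨h7, -⟩⟩
      · have := h2 h
        exact ⟨h, by omega⟩
      · omega
  nodup_lb := nodup_sh.2 T.nodup_cornerRT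
  nodup_rb := nodup_sh.2 T.nodup_cornerLT
  nodup_lt := nodup_sh.2 T.nodup_cornerRB
  nodup_rt := nodup_sh.2 T.nodup_cornerLB
  nodup_L := nodup_sh.2 (nodup_sh.2 T.nodup_l)
  nodup_K := nodup_sh.2 (nodup_sh.2 T.nodup_rt)
  ne_lb := by simpa using T.ne_cornerRT
  ne_rb := by simpa using T.ne_cornerLT
  ne_lt := by simpa using T.ne_cornerRB
  ne_rt := by simpa using T.ne_cornerLB
  eq_L := by
    rw [neg_neg, ← sh_append, sh_comm _ (-r, -r), sh_comm _ (-r, -r), ← sh_append, T.eq_cornerLT]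
  eq_K := by
    rw [← sh_append, sh_comm _ (-r, -r), sh_comm _ (-r, -r), ← sh_append, T.eq_cornerRT]
  chain_L := by
    rw [sh_comm _ (-r, -r), ← sh_append, ← sh_append]
    exact isChain_sh T.cornerRT_chain
  chain_K := by
    rw [sh_comm _ (-r, -r), ← sh_append, ← sh_append]
    exact isChain_sh T.cornerLT_chain

end ArcTour

/-- The data for the component lifted from a square without moves. -/
def railDataSingleton {z : Square} (hz : z ∈ smallCenter p s) :
    RailData s p p s {z} [z] [z] [z] [z] where
  -- All windows are single squares, and neighbouring ones differ by `(±s, p)`; this is why the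
  -- touring leaper is here the small leaper itself.
  L := [z + (-s, p)]
  K := [z + (s, p)]
  mem_lb x y := by
    obtain ⟨X, Y⟩ := z
    simp only [smallCenter, Set.mem_ofPred_eq] at hz
    simp only [List.mem_singleton, Set.mem_singleton_iff, Prod.mk.injEq]
    omega
  mem_rb x y := by
    obtain ⟨X, Y⟩ := z
    simp only [smallCenter, Set.mem_ofPred_eq] at hz
    simp only [List.mem_singleton, Set.mem_singleton_iff, Prod.mk.injEq]
    omega
  mem_lt x y := by
    obtain ⟨X, Y⟩ := z
    simp only [smallCenter, Set.mem_ofPred_eq] at hz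
    simp only [List.mem_singleton, Set.mem_singleton_iff, Prod.mk.injEq]
    omega
  mem_rt x y := by
    obtain ⟨X, Y⟩ := z
    simp only [smallCenter, Set.mem_ofPred_eq] at hz
    simp only [List.mem_singleton, Set.mem_singleton_iff, Prod.mk.injEq]
    omega
  mem_L x y := by
    obtain ⟨X, Y⟩ := z
    simp only [smallCenter, Set.mem_ofPred_eq] at hz
    simp only [List.mem_singleton, Set.mem_singleton_iff, Prod.mk.injEq, Prod.mk_add_mk]
    omega
  mem_K x y := by
    obtain ⟨X, Y⟩ := z
    simp only [smallCenter, Set.mem_ofPred_eq] at hz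
    simp only [List.mem_singleton, Set.mem_singleton_iff, Prod.mk.injEq, Prod.mk_add_mk]
    omega
  nodup_lb := List.nodup_singleton _
  nodup_rb := List.nodup_singleton _
  nodup_lt := List.nodup_singleton _
  nodup_rt := List.nodup_singleton _
  nodup_L := List.nodup_singleton _
  nodup_K := List.nodup_singleton _
  ne_lb := by simp
  ne_rb := by simp
  ne_lt := by simp
  ne_rt := by simp
  eq_L := by
    obtain ⟨X, Y⟩ := z
    simp only [sh, List.map_cons, List.map_nil, Prod.mk_add_mk, List.cons_append, List.nil_append,
      List.cons.injEq, Prod.mk.injEq, and_true, true_and]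
    omega
  eq_K := by
    obtain ⟨X, Y⟩ := z
    simp only [sh, List.map_cons, List.map_nil, Prod.mk_add_mk, List.cons_append, List.nil_append,
      List.cons.injEq, Prod.mk.injEq, and_true, true_and]
    omega
  chain_L := by
    obtain ⟨X, Y⟩ := z
    refine List.isChain_cons_cons.2 ⟨Or.inl ⟨Or.inr ?_, Or.inl ?_⟩, List.isChain_cons_cons.2
      ⟨Or.inl ⟨Or.inl ?_, Or.inl ?_⟩, List.isChain_singleton _⟩⟩ <;>
      simp only [Prod.mk_add_mk] <;> omega
  chain_K := by
    obtain ⟨X, Y⟩ := z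
    refine List.isChain_cons_cons.2 ⟨Or.inl ⟨Or.inl ?_, Or.inl ?_⟩, List.isChain_cons_cons.2
      ⟨Or.inl ⟨Or.inr ?_, Or.inl ?_⟩, List.isChain_singleton _⟩⟩ <;>
      simp only [Prod.mk_add_mk] <;> omega

theorem nonempty_arcTour_lift (H : Params p q r (n + 1))
    (hC : IsComp r p (smallBoard p r) C) (h : Nonempty (ArcTour P Q r p C)) :
    Nonempty (ArcTour P Q p q (lift p q r C)) := by
  obtain ⟨T⟩ := h
  have D' := T.swap.railData H.s_hi
  rw [T.cornerLB_swap, T.cornerRB_swap, T.cornerLT_swap, T.cornerRT_swap] at D'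
  exact ⟨(T.railData H.s_hi).arcTour H hC D'⟩

theorem nonempty_arcTour_lift_neg (hr : 0 ≤ r) (H : Params p q (-r) (n + 1))
    (hC : IsComp (-r) p (smallBoard p (-r)) ((fun a => a + (r, r)) ⁻¹' C))
    (h : Nonempty (ArcTour P Q r p C)) :
    Nonempty (ArcTour P Q p q (lift p q (-r) ((fun a => a + (r, r)) ⁻¹' C))) := by
  obtain ⟨T⟩ := h
  have hrp : r < p := by have := H.s_lo; omega
  have D' := T.swap.railDataNeg hr hrp
  have e : ∀ l : List Square, sh (-r, -r) (sw l) = sw (sh (-r, -r) l) := fun l => by simp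
  rw [T.cornerLB_swap, T.cornerRB_swap, T.cornerLT_swap, T.cornerRT_swap, e, e, e, e, sh_reverse,
    sh_reverse] at D'
  exact ⟨(T.railDataNeg hr hrp).arcTour H hC D'⟩

theorem nonempty_arcTour_singleton {z : Square} (H : Params p q s (n + 1))
    (hC : IsComp s p (smallBoard p s) {z}) (hz : z ∈ smallCenter p s) :
    Nonempty (ArcTour s p p q (lift p q s {z})) := by
  have hz' : z.swap ∈ smallCenter p s := by
    simp only [smallCenter, Set.mem_ofPred_eq, Prod.fst_swap, Prod.snd_swap] at hz ⊢
    omega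
  have D' := railDataSingleton hz'
  have e : ({z.swap} : Set Square) = Prod.swap ⁻¹' {z} := by
    ext a; simp [Prod.swap_eq_iff_eq_swap]
  rw [e] at D'
  exact ⟨(railDataSingleton hz).arcTour H hC D'⟩

end LiftExists
end Leaper

/-! ### Classification of the components by type. -/

namespace Leaper
section Classification
variable {r p q : ℤ}

/-- The squares of the big board without moves. -/
def center (p q : ℤ) : Set Square := {a | (p ≤ a.1 ∧ a.1 < q) ∧ (p ≤ a.2 ∧ a.2 < q)}

/-- A correspondence between all components for an `(r, p)`-leaper and those components for a
`(p, q)`-leaper which are not isolated vertices, compatible with translations and tours. -/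
structure Lifting (r p q : ℤ) (Φ : Set Square → Set Square) : Prop where
  isComp : ∀ {C}, IsComp r p (bigBoard r p) C → IsComp p q (bigBoard p q) (Φ C)
  not_center : ∀ {C a}, IsComp r p (bigBoard r p) C → a ∈ Φ C → a ∉ center p q
  surj : ∀ {S a}, IsComp p q (bigBoard p q) S → a ∈ S → a ∉ center p q →
    ∃ C, IsComp r p (bigBoard r p) C ∧ Φ C = S
  inj : ∀ {C C'}, IsComp r p (bigBoard r p) C → IsComp r p (bigBoard r p) C' → Φ C = Φ C' →
    C = C'
  translate : ∀ {C C'}, IsComp r p (bigBoard r p) C → IsComp r p (bigBoard r p) C' →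
    (IsTranslate (Φ C) (Φ C') ↔ IsTranslate C C')
  tour : ∀ {C P Q}, IsComp r p (bigBoard r p) C → Nonempty (ArcTour P Q r p C) →
    Nonempty (ArcTour P Q p q (Φ C))
  tour_singleton : ∀ {z}, z ∈ center r p → Nonempty (ArcTour r p p q (Φ {z}))

theorem Rep.not_mem_center {s m : ℤ} {z a : Square} (H : Params p q s m) (h : Rep p q s z a) :
    a ∉ center p q := by
  rintro ⟨h1, h2⟩
  rcases h.2.2 with hv | hv <;> have := hv.outer H <;>
    (try simp only [Prod.fst_swap] at this) <;> omega

theorem lift_injective {s m : ℤ} {C C' : Set Square} (H : Params p q s m)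
    (hC : IsComp s p (smallBoard p s) C) (hC' : IsComp s p (smallBoard p s) C')
    (h : lift p q s C = lift p q s C') : C = C' := by
  obtain ⟨z, hz⟩ := hC.nonempty
  obtain ⟨a, ha, hv, -⟩ := exists_rep H (hC.subset hz)
  have hr : Rep p q s z a := ⟨hC.subset hz, ha, Or.inl hv⟩
  refine hC.eq_of_mem_of_mem hC' hz ((mem_lift_iff H hC' hr).1 ?_)
  rw [← h]
  exact ⟨z, hz, hr⟩

theorem smallBoard_of_nonneg (hr : 0 ≤ r) : smallBoard p r = bigBoard r p := by
  ext a
  simp only [smallBoard, bigBoard, Set.mem_ofPred_eq]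
  omega

theorem lifting_pos {n : ℕ} (hr : 0 ≤ r) (H : Params p q r (n + 1)) :
    Lifting r p q (lift p q r) := by
  have e := smallBoard_of_nonneg (p := p) hr
  constructor <;> try rw [← e]
  · exact fun hC => isComp_lift H hC
  · rintro C a hC ⟨z, -, hz⟩
    exact hz.not_mem_center H
  · intro S a hS ha hc
    exact exists_lift_eq H hS ha fun h => hc ⟨⟨h.1, h.2.1⟩, h.2.2⟩
  · exact fun hC hC' h => lift_injective H hC hC' h
  · exact fun hC hC' => ⟨isTranslate_of_lift H hC hC', isTranslate_lift H hC hC'⟩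
  · exact fun hC h => nonempty_arcTour_lift H hC h
  · intro z hz
    refine nonempty_arcTour_singleton H ?_ ?_
    · rw [e]; exact isComp_singleton_of_center hr hz.1 hz.2
    · simp only [center, smallCenter, Set.mem_ofPred_eq] at hz ⊢
      omega

theorem conn_neg_iff {a b : Square} :
    Conn (-r) p (smallBoard p (-r)) a b → 0 ≤ r →
      Conn r p (bigBoard r p) (a + (r, r)) (b + (r, r)) := by
  intro h hr
  induction h with
  | refl => exact .refl _
  | tail _ h ih =>
    refine ih.tail ⟨?_, ?_, (mv_neg.1 h.2.2).add _⟩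
    · have := h.1
      simp only [smallBoard, bigBoard, Set.mem_ofPred_eq, Prod.fst_add, Prod.snd_add] at this ⊢
      omega
    · have := h.2.1
      simp only [smallBoard, bigBoard, Set.mem_ofPred_eq, Prod.fst_add, Prod.snd_add] at this ⊢
      omega

theorem conn_neg_of_conn {a b : Square} :
    Conn r p (bigBoard r p) a b → 0 ≤ r →
      Conn (-r) p (smallBoard p (-r)) (a + (-r, -r)) (b + (-r, -r)) := by
  intro h hr
  induction h with
  | refl => exact .refl _
  | tail _ h ih =>
    refine ih.tail ⟨?_, ?_, mv_neg.2 (h.2.2.add _)⟩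
    · have := h.1
      simp only [smallBoard, bigBoard, Set.mem_ofPred_eq, Prod.fst_add, Prod.snd_add] at this ⊢
      omega
    · have := h.2.1
      simp only [smallBoard, bigBoard, Set.mem_ofPred_eq, Prod.fst_add, Prod.snd_add] at this ⊢
      omega

theorem isComp_preimage {C : Set Square} (hr : 0 ≤ r) (hC : IsComp r p (bigBoard r p) C) :
    IsComp (-r) p (smallBoard p (-r)) ((fun a => a + (r, r)) ⁻¹' C) := by
  obtain ⟨a, ha, rfl⟩ := hC
  refine ⟨a + (-r, -r), ?_, Set.ext fun b => ⟨fun h => ?_, fun h => ?_⟩⟩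
  · simp only [smallBoard, bigBoard, Set.mem_ofPred_eq, Prod.fst_add, Prod.snd_add] at ha ⊢
    omega
  · simpa [add_assoc, Prod.mk_zero_zero] using conn_neg_of_conn h hr
  · simpa [add_assoc, Prod.mk_zero_zero] using conn_neg_iff h hr

theorem isComp_of_preimage {C : Set Square} (hr : 0 ≤ r)
    (hC : IsComp (-r) p (smallBoard p (-r)) C) :
    IsComp r p (bigBoard r p) ((fun a => a + (-r, -r)) ⁻¹' C) := by
  obtain ⟨a, ha, rfl⟩ := hC
  refine ⟨a + (r, r), ?_, Set.ext fun b => ⟨fun h => ?_, fun h => ?_⟩⟩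
  · simp only [smallBoard, bigBoard, Set.mem_ofPred_eq, Prod.fst_add, Prod.snd_add] at ha ⊢
    omega
  · simpa [add_assoc, Prod.mk_zero_zero] using conn_neg_iff h hr
  · simpa [add_assoc, Prod.mk_zero_zero] using conn_neg_of_conn h hr

theorem isTranslate_preimage {C : Set Square} (v : Square) :
    IsTranslate C ((fun a => a + v) ⁻¹' C) := by
  rw [isTranslate_iff]
  exact ⟨-v, fun a ha => by simpa using ha, fun a ha => by simpa using ha⟩

/-- The orientation of the first proportion of the touring leaper does not matter. -/
def ArcTour.neg {P Q : ℤ} {C : Set Square} (T : ArcTour (-P) Q r p C) : ArcTour P Q r p C :=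
  have e : ∀ {l : List Square}, l.IsChain (Mv (-P) Q) → l.IsChain (Mv P Q) :=
    fun h => h.imp fun _ _ h => mv_neg.1 h
  { T with
    chain_l := e T.chain_l
    chain_rt := e T.chain_rt
    chain_b := e T.chain_b
    chain_t := e T.chain_t }

/-- For `s = -r` the small board is the board of the `(r, p)`-leaper translated by `(-r, -r)`, and
the sign of a proportion does not affect the moves, so everything is transported along this
translation. -/
theorem lifting_neg {n : ℕ} (hr : 0 ≤ r) (H : Params p q (-r) (n + 1)) :
    Lifting r p q (fun C => lift p q (-r) ((fun a => a + (r, r)) ⁻¹' C)) := by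
  have e : ∀ C : Set Square, (fun a => a + (r, r)) ⁻¹' ((fun a => a + (-r, -r)) ⁻¹' C) = C := by
    intro C; ext a; simp [add_assoc, Prod.mk_zero_zero]
  have e' : ∀ C : Set Square, (fun a => a + (-r, -r)) ⁻¹' ((fun a => a + (r, r)) ⁻¹' C) = C := by
    intro C; ext a; simp [add_assoc, Prod.mk_zero_zero]
  constructor
  · exact fun hC => isComp_lift H (isComp_preimage hr hC)
  · rintro C a hC ⟨z, -, hz⟩
    exact hz.not_mem_center H
  · intro S a hS ha hc
    obtain ⟨C, hC, h⟩ := exists_lift_eq H hS ha fun h => hc ⟨⟨h.1, h.2.1⟩, h.2.2⟩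
    exact ⟨_, isComp_of_preimage hr hC, by simp only [e, h]⟩
  · intro C C' hC hC' h
    have := lift_injective H (isComp_preimage hr hC) (isComp_preimage hr hC') h
    rw [← e' C, this, e']
  · intro C C' hC hC'
    have hc := isComp_preimage hr hC
    have hc' := isComp_preimage hr hC'
    have t := isTranslate_preimage (C := C) (r, r)
    have t' := isTranslate_preimage (C := C') (r, r)
    exact ⟨fun h => (t.trans (isTranslate_of_lift H hc hc' h)).trans t'.symm,
      fun h => isTranslate_lift H hc hc' ((t.symm.trans h).trans t')⟩
  · exact fun hC h => nonempty_arcTour_lift_neg hr H (isComp_preimage hr hC) h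
  · intro z hz
    have h1 : (fun a => a + (r, r)) ⁻¹' ({z} : Set Square) = {z + (-r, -r)} := by
      ext a
      simp only [Set.mem_preimage, Set.mem_singleton_iff]
      constructor
      · rintro rfl; simp [add_assoc, Prod.mk_zero_zero]
      · rintro rfl; simp [add_assoc, Prod.mk_zero_zero]
    have hC := isComp_preimage hr (isComp_singleton_of_center hr hz.1 hz.2)
    rw [h1] at hC ⊢
    obtain ⟨T⟩ := nonempty_arcTour_singleton H hC (by
      simp only [center, smallCenter, Set.mem_ofPred_eq, Prod.fst_add, Prod.snd_add] at hz ⊢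
      omega)
    exact ⟨T.neg⟩

theorem ncard_center (hpq : p ≤ q) : ((center p q).ncard : ℤ) = (q - p) ^ 2 := by
  have e : center p q = ((Finset.Ico p q ×ˢ Finset.Ico p q : Finset (ℤ × ℤ)) : Set Square) := by
    ext a
    simp [center]
  rw [e, Set.ncard_coe_finset, Finset.card_product, Int.card_Ico]
  push_cast
  rw [Int.toNat_of_nonneg (by omega)]
  ring

/-- The components for a `(p, q)`-leaper fall into isolated vertices, of type `0`, and cycles of
types `1`, …, `k`. -/
def Classified (k : ℕ) (p q : ℤ) (P Q : ℕ → ℤ) : Prop :=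
  ∃ τ : Set Square → ℕ,
    (∀ S, IsComp p q (bigBoard p q) S → τ S ≤ k) ∧
    (∀ S, IsComp p q (bigBoard p q) S → ∀ a ∈ S, τ S = 0 ↔ a ∈ center p q) ∧
    (∀ S S', IsComp p q (bigBoard p q) S → IsComp p q (bigBoard p q) S' →
      (τ S = τ S' ↔ IsTranslate S S')) ∧
    (∀ i ≤ k, ({S | IsComp p q (bigBoard p q) S ∧ τ S = i}.ncard : ℤ) = (Q i - P i) ^ 2) ∧
    ∀ i, 1 ≤ i → ∀ S, IsComp p q (bigBoard p q) S → τ S = i →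
      Nonempty (ArcTour (P i) (Q i) p q S)

theorem eq_singleton_of_mem_center {S : Set Square} {a : Square} (hp : 0 ≤ p)
    (hS : IsComp p q (bigBoard p q) S) (ha : a ∈ S) (hc : a ∈ center p q) : S = {a} :=
  hS.eq_of_mem_of_mem (isComp_singleton_of_center hp hc.1 hc.2) ha rfl

theorem ncard_isolated (hp : 0 ≤ p) (hpq : p ≤ q) :
    ({S | IsComp p q (bigBoard p q) S ∧ ∃ a ∈ S, a ∈ center p q}.ncard : ℤ) = (q - p) ^ 2 := by
  have e : {S | IsComp p q (bigBoard p q) S ∧ ∃ a ∈ S, a ∈ center p q}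
      = (fun a => ({a} : Set Square)) '' center p q := by
    ext S
    constructor
    · rintro ⟨hS, a, ha, hc⟩
      exact ⟨a, hc, (eq_singleton_of_mem_center hp hS ha hc).symm⟩
    · rintro ⟨a, hc, rfl⟩
      exact ⟨isComp_singleton_of_center hp hc.1 hc.2, a, rfl, hc⟩
  rw [e, Set.ncard_image_of_injective _ Set.singleton_injective, ncard_center hpq]

theorem classified_zero {P Q : ℕ → ℤ} (hP : P 0 = 0) (hQ : Q 0 = 1) : Classified 0 0 1 P Q := by
  have key : ∀ a : Square, a ∈ bigBoard 0 1 → a ∈ center 0 1 := by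
    intro a ha
    simp only [bigBoard, center, Set.mem_ofPred_eq] at ha ⊢
    omega
  refine ⟨fun _ => 0, fun _ _ => le_rfl, fun S hS a ha => ⟨fun _ => key a (hS.subset ha),
    fun _ => rfl⟩, fun S S' hS hS' => ⟨fun _ => ?_, fun _ => rfl⟩, fun i hi => ?_, ?_⟩
  · obtain ⟨a, ha⟩ := hS.nonempty
    obtain ⟨b, hb⟩ := hS'.nonempty
    rw [eq_singleton_of_mem_center le_rfl hS ha (key a (hS.subset ha)),
      eq_singleton_of_mem_center le_rfl hS' hb (key b (hS'.subset hb))]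
    exact ⟨b - a, by simp⟩
  · obtain rfl : i = 0 := by omega
    rw [hP, hQ, ← ncard_isolated le_rfl (by norm_num)]
    congr 2
    ext S
    constructor
    · rintro ⟨hS, -⟩
      obtain ⟨a, ha⟩ := hS.nonempty
      exact ⟨hS, a, ha, key a (hS.subset ha)⟩
    · rintro ⟨hS, -⟩
      exact ⟨hS, by simp⟩
  · intro i hi S hS h
    have : 0 = i := h
    omega

/-- A lift gets the type of its original plus one. The components that are not lifts are the single
central squares, which form the new type `0`. -/
theorem Classified.succ {k : ℕ} {P Q : ℕ → ℤ} {Φ : Set Square → Set Square}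
    (hp : 0 ≤ p) (hpq : p < q) (hΦ : Lifting r p q Φ)
    (hP0 : P 0 = p) (hQ0 : Q 0 = q) (hP1 : P 1 = r) (hQ1 : Q 1 = p) (hr : 0 ≤ r)
    (h : Classified k r p (fun i => P (i + 1)) (fun i => Q (i + 1))) :
    Classified (k + 1) p q P Q := by
  classical
  obtain ⟨τ, h1, h2, h3, h4, h5⟩ := h
  -- The choice is immaterial, since `Φ` is injective on components; the default `0` is the type of
  -- the isolated squares.
  let σ : Set Square → ℕ := fun S =>
    if h : ∃ C, IsComp r p (bigBoard r p) C ∧ Φ C = S then τ h.choose + 1 else 0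
  have σΦ : ∀ C, IsComp r p (bigBoard r p) C → σ (Φ C) = τ C + 1 := by
    intro C hC
    have hex : ∃ C', IsComp r p (bigBoard r p) C' ∧ Φ C' = Φ C := ⟨C, hC, rfl⟩
    simp only [σ, dif_pos hex]
    rw [hΦ.inj hex.choose_spec.1 hC hex.choose_spec.2]
  have σ0 : ∀ S, ∀ a ∈ S, a ∈ center p q → σ S = 0 := by
    intro S a ha hc
    refine dif_neg ?_
    rintro ⟨C, hC, rfl⟩
    exact hΦ.not_center hC ha hc
  have dich : ∀ S, IsComp p q (bigBoard p q) S → (∃ a ∈ center p q, S = {a}) ∨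
      ∃ C, IsComp r p (bigBoard r p) C ∧ Φ C = S := by
    intro S hS
    obtain ⟨a, ha⟩ := hS.nonempty
    by_cases hc : a ∈ center p q
    · exact Or.inl ⟨a, hc, eq_singleton_of_mem_center hp hS ha hc⟩
    · exact Or.inr (hΦ.surj hS ha hc)
  -- A lift contains a square with a move, hence a second square, and so is no copy of a single
  -- square.
  have hne : ∀ C, IsComp r p (bigBoard r p) C → ∀ z, ¬ IsTranslate {z} (Φ C) := by
    rintro C hC z ⟨v, hv⟩
    rw [Set.image_singleton] at hv
    have hS := hΦ.isComp hC
    have hz : z + v ∈ Φ C := by rw [hv]; rfl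
    have hc := hΦ.not_center hC hz
    obtain ⟨b, hb, hne, hm⟩ := exists_mv_of_not_center hp hpq (hS.subset hz)
      fun h => hc ⟨⟨h.1, h.2.1⟩, h.2.2⟩
    have := hS.mem_of_mv hz hb hm
    rw [hv] at this
    exact hne this
  refine ⟨σ, ?_, ?_, ?_, ?_, ?_⟩
  · intro S hS
    rcases dich S hS with ⟨a, ha, rfl⟩ | ⟨C, hC, rfl⟩
    · rw [σ0 _ a (Set.mem_singleton a) ha]; omega
    · rw [σΦ C hC]; have := h1 C hC; omega
  · intro S hS a ha
    refine ⟨fun h => ?_, σ0 S a ha⟩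
    rcases dich S hS with ⟨b, hb, rfl⟩ | ⟨C, hC, rfl⟩
    · rw [Set.mem_singleton_iff] at ha; rwa [ha]
    · rw [σΦ C hC] at h; omega
  · intro S S' hS hS'
    rcases dich S hS with ⟨a, ha, rfl⟩ | ⟨C, hC, rfl⟩ <;>
      rcases dich S' hS' with ⟨a', ha', rfl⟩ | ⟨C', hC', rfl⟩
    · rw [σ0 _ a (Set.mem_singleton a) ha, σ0 _ a' (Set.mem_singleton a') ha']
      exact ⟨fun _ => ⟨a' - a, by simp⟩, fun _ => rfl⟩
    · rw [σ0 _ a (Set.mem_singleton a) ha, σΦ C' hC']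
      exact ⟨fun h => by omega, fun h => absurd h (hne C' hC' a)⟩
    · rw [σ0 _ a' (Set.mem_singleton a') ha', σΦ C hC]
      exact ⟨fun h => by omega, fun h => absurd h.symm (hne C hC a')⟩
    · rw [σΦ C hC, σΦ C' hC', hΦ.translate hC hC', ← h3 C C' hC hC']
      omega
  · intro i hi
    rcases i with _ | i
    · rw [hP0, hQ0, ← ncard_isolated hp hpq.le]
      congr 2
      ext S
      constructor
      · rintro ⟨hS, h⟩
        refine ⟨hS, ?_⟩
        rcases dich S hS with ⟨a, ha, rfl⟩ | ⟨C, hC, rfl⟩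
        · exact ⟨a, rfl, ha⟩
        · rw [σΦ C hC] at h; omega
      · rintro ⟨hS, a, ha, hc⟩
        exact ⟨hS, σ0 S a ha hc⟩
    · rw [← h4 i (by omega)]
      have e : {S | IsComp p q (bigBoard p q) S ∧ σ S = i + 1}
          = Φ '' {C | IsComp r p (bigBoard r p) C ∧ τ C = i} := by
        ext S
        constructor
        · rintro ⟨hS, h⟩
          rcases dich S hS with ⟨a, ha, rfl⟩ | ⟨C, hC, rfl⟩
          · rw [σ0 _ a (Set.mem_singleton a) ha] at h; omega
          · rw [σΦ C hC] at h; exact ⟨C, ⟨hC, by omega⟩, rfl⟩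
        · rintro ⟨C, ⟨hC, rfl⟩, rfl⟩
          exact ⟨hΦ.isComp hC, σΦ C hC⟩
      rw [e, Set.InjOn.ncard_image]
      intro C hC C' hC' h
      exact hΦ.inj hC.1 hC'.1 h
  · intro i hi S hS h
    rcases dich S hS with ⟨a, ha, rfl⟩ | ⟨C, hC, rfl⟩
    · rw [σ0 _ a (Set.mem_singleton a) ha] at h; omega
    · rw [σΦ C hC] at h
      obtain rfl : i = τ C + 1 := h.symm
      -- An isolated square of the smaller board has no tour to lift; its lift is toured by the `(r,
      -- p)`-leaper, whose proportions are `P 1` and `Q 1`.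
      by_cases h0 : τ C = 0
      · obtain ⟨z, hz⟩ := hC.nonempty
        have hc := (h2 C hC z hz).1 h0
        rw [h0, zero_add, hP1, hQ1, eq_singleton_of_mem_center hr hC hz hc]
        exact hΦ.tour_singleton hc
      · exact hΦ.tour hC (h5 (τ C) (by omega) C hC rfl)

end Classification
end Leaper

/-! ### Hamiltonian cycles, cycle components and the leaper graph. -/

namespace Leaper
section Graphs

open SimpleGraph

theorem exists_isHamiltonianCycle {V : Type*} [DecidableEq V] {G : SimpleGraph V} {a : V}
    {l : List V} (h : (a :: (l ++ [a])).IsChain G.Adj) (nd : (a :: l).Nodup)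
    (mem : ∀ v, v ∈ a :: l) (len : 2 ≤ l.length) : ∃ w : G.Walk a a, w.IsHamiltonianCycle := by
  obtain ⟨w, hw⟩ : ∃ w : G.Walk a a, w.support = a :: (l ++ [a]) :=
    ⟨(Walk.ofSupport _ (List.cons_ne_nil _ _) h).copy rfl (by simp),
      (Walk.support_copy _ _ _).trans (Walk.support_ofSupport _ h)⟩
  have hlen : w.length = l.length + 1 := by
    have := w.length_support
    rw [hw] at this
    simpa using this.symm
  have hnil : ¬ w.Nil := by
    rw [Walk.not_nil_iff_lt_length]; omega
  have ht : w.tail.support = l ++ [a] := by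
    rw [Walk.support_tail_of_not_nil _ hnil, hw, List.tail_cons]
  have hp : w.tail.IsPath := by
    rw [Walk.isPath_def, ht]
    exact (List.perm_append_singleton a l).nodup_iff.2 nd
  refine ⟨w, ⟨Walk.isCycle_iff_isPath_tail_and_le_length.2 ⟨hp, by omega⟩,
    hp.isHamiltonian_of_mem fun v => ?_⟩⟩
  rw [ht, (List.perm_append_singleton a l).mem_iff]
  exact mem v

theorem isTouredBy_of_isChain {P Q : ℕ} {S : Set Square} {a : Square} {l : List Square}
    (h : (a :: (l ++ [a])).IsChain (Mv P Q)) (nd : (a :: l).Nodup)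
    (mem : ∀ x, x ∈ a :: l ↔ x ∈ S) (len : 2 ≤ l.length) : IsTouredBy P Q S := by
  -- Were both proportions `0`, a move would not leave its square, against `nd`. Afterwards the
  -- condition `a ≠ b` in the adjacency of `graph` is automatic.
  have h0 : (P : ℤ) ≠ 0 ∨ (Q : ℤ) ≠ 0 := by
    obtain ⟨b, l', rfl⟩ : ∃ b l', l = b :: l' := by
      cases l with
      | nil => simp at len
      | cons b l' => exact ⟨b, l', rfl⟩
    have hab : a ≠ b := fun e => by simp [e] at nd
    have hm : Mv P Q a b := by
      simp only [List.cons_append, List.isChain_cons_cons] at h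
      exact h.1
    by_contra! hc
    rw [hc.1, hc.2] at hm
    exact hab (Prod.ext_iff.2 (by simp only [Mv] at hm; omega))
  obtain ⟨a, rfl⟩ : ∃ a' : S, (a' : Square) = a := ⟨⟨a, (mem a).1 (by simp)⟩, rfl⟩
  obtain ⟨l, rfl⟩ : ∃ l' : List S, l'.map Subtype.val = l :=
    ⟨l.attachWith (· ∈ S) fun x hx => (mem x).1 (List.mem_cons_of_mem _ hx), List.attachWith_map_subtype_val _⟩
  have e : (a : Square) :: (l.map Subtype.val) = (a :: l).map Subtype.val := rfl
  have e' : (a : Square) :: (l.map Subtype.val ++ [(a : Square)]) =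
    (a :: (l ++ [a])).map Subtype.val := by simp
  rw [e', List.isChain_map] at h
  rw [e] at nd mem
  refine ⟨a, exists_isHamiltonianCycle (h.imp fun x y hxy => ⟨?_, isMove_iff_mv.2 hxy⟩)
    (List.Nodup.of_map _ nd) (fun v => ?_) (by simpa using len)⟩
  · rintro rfl
    simp only [Mv] at hxy
    omega
  · obtain ⟨w, hw, hwv⟩ := List.mem_map.1 ((mem v).2 v.2)
    exact Subtype.val_injective hwv ▸ hw

/-- The arcs are followed once around the board: up the left side, along the top, and then with
reversed arcs down the right side and back along the bottom. -/
theorem ArcTour.isTouredBy {P Q : ℕ} {r p : ℤ} {C : Set Square} (T : ArcTour P Q r p C)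
    (hr : r ≤ p) : IsTouredBy P Q C := by
  obtain ⟨a, bl, hbl⟩ := List.exists_cons_of_ne_nil T.ne_bl
  have h1 := T.chain_l
  have h2 := T.chain_t
  have h3 := isChain_rev T.chain_rt
  have h4 := isChain_rev T.chain_b
  simp only [List.reverse_append, List.reverse_reverse] at h3 h4
  rw [← List.append_assoc] at h3 h4
  have ne3 : T.tr.reverse ≠ [] := by simpa using T.ne_tr
  have ne4 : T.br.reverse ≠ [] := by simpa using T.ne_br
  have h5 := h1.append_overlap (by simpa using h2) T.ne_tl
  rw [← List.append_assoc] at h5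
  have h6 := h5.append_overlap (by simpa using h3) ne3
  rw [← List.append_assoc] at h6
  have h7 := h6.append_overlap (by simpa using h4) ne4
  have hlt := List.length_pos_of_ne_nil T.ne_tl
  have hlr := List.length_pos_of_ne_nil T.ne_tr
  -- `h7` runs through all of the bottom left arc a second time; the closed walk stops at the first
  -- square `a` of that arc.
  refine isTouredBy_of_isChain (a := a) (l := bl ++ T.l ++ T.tl ++ T.t ++ T.tr.reverse ++
    T.rt.reverse ++ T.br.reverse ++ T.b.reverse) (h7.prefix ⟨bl, ?_⟩) ?_ ?_ ?_
  · simp [hbl]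
  · have key : (T.bl ++ T.l ++ T.tl ++ T.t ++ T.tr.reverse ++
      T.rt.reverse ++ T.br.reverse ++ T.b.reverse).Nodup := by
      simp only [List.nodup_append, List.nodup_reverse, T.nodup_bl, T.nodup_l, T.nodup_tl,
        T.nodup_t, T.nodup_tr, T.nodup_rt, T.nodup_br, T.nodup_b, true_and, List.mem_append,
        List.mem_reverse, Prod.forall, T.mem_bl, T.mem_l, T.mem_tl, T.mem_t, T.mem_tr, T.mem_rt,
        T.mem_br, T.mem_b, ne_eq, Prod.mk.injEq]
      refine ⟨⟨⟨⟨⟨⟨?_, ?_⟩, ?_⟩, ?_⟩, ?_⟩, ?_⟩, ?_⟩ <;> intros <;> omega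
    simpa [hbl] using key
  · rintro ⟨x, y⟩
    have key : (x, y) ∈ T.bl ++ T.l ++ T.tl ++ T.t ++ T.tr.reverse ++
      T.rt.reverse ++ T.br.reverse ++ T.b.reverse ↔ (x, y) ∈ C := by
      have := T.not_mid x y
      simp only [List.mem_append, List.mem_reverse, T.mem_bl, T.mem_l, T.mem_tl, T.mem_t, T.mem_tr,
        T.mem_rt, T.mem_br, T.mem_b]
      constructor
      · tauto
      · intro h
        have := this h
        simp only [h, true_and]
        omega
    simpa [hbl] using key
  · have := List.length_pos_of_ne_nil T.ne_br
    simp only [List.length_append, List.length_reverse]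
    omega

/-- A finite connected graph all of whose vertices have degree two is a cycle. -/
theorem exists_iso_cycleGraph {V : Type*} [Finite V] {G : SimpleGraph V} (hG : G.Connected)
    (h2 : ∀ v, (G.neighborSet v).ncard = 2) :
    ∃ n, 3 ≤ n ∧ Nonempty (G ≃g cycleGraph n) := by
  have hc : G.IsCycles := fun v _ => h2 v
  obtain ⟨v⟩ := hG.nonempty
  obtain ⟨w, hw, -⟩ := hc.exists_cycle_toSubgraph_verts_eq_connectedComponentSupp
    (c := G.connectedComponentMk v) (v := v) rfl
    (Set.nonempty_of_ncard_ne_zero (by rw [h2]; norm_num))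
  have h3 := hw.three_le_length
  obtain ⟨f⟩ := (cycleGraph_isContained_iff (G := G) (n := w.length) (by omega)).2 ⟨v, w, hw, rfl⟩
  obtain ⟨m, hm⟩ : ∃ m, w.length = m + 3 := ⟨w.length - 3, by omega⟩
  rw [hm] at f
  -- An injective homomorphism sends the two neighbours of `u` to two neighbours of its image, which
  -- has no others.
  have him : ∀ u, f.toHom '' (cycleGraph (m + 3)).neighborSet u = G.neighborSet (f.toHom u) := by
    intro u
    refine Set.eq_of_subset_of_ncard_le ?_ ?_ (Set.toFinite _)
    · rintro _ ⟨x, hx, rfl⟩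
      exact f.toHom.map_adj hx
    · rw [h2, Set.ncard_image_of_injective _ f.injective, Set.ncard_eq_toFinset_card',
        ← cycleGraph_degree_three_le (n := m) (v := u)]
      rfl
  -- The image contains all neighbours of its vertices, so by connectedness it is everything.
  have hsurj : Function.Surjective f.toHom := by
    intro x
    have hx := (hG.preconnected (f.toHom 0) x)
    rw [reachable_iff_reflTransGen] at hx
    induction hx with
    | refl => exact ⟨0, rfl⟩
    | tail _ hyz ih =>
      obtain ⟨u, rfl⟩ := ih
      obtain ⟨x, -, hx⟩ := (him u).symm ▸ (show _ ∈ G.neighborSet (f.toHom u) from hyz)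
      exact ⟨x, hx⟩
  refine ⟨m + 3, by omega, ⟨(⟨Equiv.ofBijective f.toHom ⟨f.injective, hsurj⟩, ?_⟩ :
    cycleGraph (m + 3) ≃g G).symm⟩⟩
  intro a b
  refine ⟨fun hab => ?_, fun hab => f.toHom.map_adj hab⟩
  obtain ⟨x, hx, hxb⟩ := (him a).symm ▸ (show f.toHom b ∈ G.neighborSet (f.toHom a) from hab)
  exact f.injective hxb ▸ hx

/-- The board without its centre falls into four corners and four sides, and from each of these
regions exactly two of the eight moves stay on the board. -/
theorem exists_two_neighbors {p q : ℤ} {a : Square} (hp : 0 < p) (hpq : p < q)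
    (ha : a ∈ bigBoard p q) (h : a ∉ center p q) :
    ∃ b c : Square, b ≠ c ∧ ∀ x, x ∈ bigBoard p q ∧ Mv p q a x ↔ x = b ∨ x = c := by
  obtain ⟨x, y⟩ := a
  simp only [bigBoard, center, Set.mem_ofPred_eq] at ha h
  have key : ∀ x1 y1 x2 y2 : ℤ, (x1 ≠ x2 ∨ y1 ≠ y2) →
    (∀ u v : ℤ, ((0 ≤ u ∧ u < p + q ∧ 0 ≤ v ∧ v < p + q) ∧
      (((u = x + p ∨ u = x - p) ∧ (v = y + q ∨ v = y - q)) ∨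
      ((u = x + q ∨ u = x - q) ∧ (v = y + p ∨ v = y - p))) ↔
      (u = x1 ∧ v = y1) ∨ (u = x2 ∧ v = y2))) →
    ∃ b c : Square, b ≠ c ∧ ∀ z, z ∈ bigBoard p q ∧ Mv p q (x, y) z ↔ z = b ∨ z = c := by
    intro x1 y1 x2 y2 h1 h2
    refine ⟨(x1, y1), (x2, y2), ?_, ?_⟩
    · rw [ne_eq, Prod.mk.injEq]; omega
    · rintro ⟨u, v⟩
      rw [Prod.mk.injEq, Prod.mk.injEq]
      exact h2 u v
  have : (x < p ∧ y < p) ∨ (x < p ∧ p ≤ y ∧ y < q) ∨ (x < p ∧ q ≤ y) ∨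
    (p ≤ x ∧ x < q ∧ y < p) ∨ (p ≤ x ∧ x < q ∧ q ≤ y) ∨
    (q ≤ x ∧ y < p) ∨ (q ≤ x ∧ p ≤ y ∧ y < q) ∨ (q ≤ x ∧ q ≤ y) := by omega
  rcases this with h | h | h | h | h | h | h | h
  · exact key (x + p) (y + q) (x + q) (y + p) (by omega) fun u v => by constructor <;> intro <;> omega
  · exact key (x + q) (y + p) (x + q) (y - p) (by omega) fun u v => by constructor <;> intro <;> omega
  · exact key (x + p) (y - q) (x + q) (y - p) (by omega) fun u v => by constructor <;> intro <;> omega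
  · exact key (x + p) (y + q) (x - p) (y + q) (by omega) fun u v => by constructor <;> intro <;> omega
  · exact key (x + p) (y - q) (x - p) (y - q) (by omega) fun u v => by constructor <;> intro <;> omega
  · exact key (x - p) (y + q) (x - q) (y + p) (by omega) fun u v => by constructor <;> intro <;> omega
  · exact key (x - q) (y + p) (x - q) (y - p) (by omega) fun u v => by constructor <;> intro <;> omega
  · exact key (x - p) (y - q) (x - q) (y - p) (by omega) fun u v => by constructor <;> intro <;> omega

variable {p q : ℕ}

theorem squareBoard_eq : squareBoard (p + q) = bigBoard p q := by
  ext ⟨x, y⟩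
  simp only [squareBoard, bigBoard, Set.mem_prod, Set.mem_Ico, Set.mem_ofPred_eq]
  push_cast
  omega

theorem graph_adj_iff {B : Set Square} (hpq : p < q) {a b : B} :
    (graph p q B).Adj a b ↔ Mv p q a b := by
  refine ⟨fun h => isMove_iff_mv.1 h.2, fun h => ⟨?_, isMove_iff_mv.2 h⟩⟩
  rintro rfl
  simp only [Mv] at h
  omega

theorem reachable_iff {B : Set Square} (hpq : p < q) {a b : B} :
    (graph p q B).Reachable a b ↔ Conn p q B a b := by
  rw [reachable_iff_reflTransGen]
  constructor
  · intro h
    induction h with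
    | refl => exact .refl _
    | tail _ h ih => exact ih.trans (Link.conn ⟨Subtype.prop _, Subtype.prop _,
        (graph_adj_iff hpq).1 h⟩)
  · obtain ⟨b, hb⟩ := b
    intro h
    change Conn p q B a b at h
    induction h with
    | refl => exact .refl
    | tail _ h ih => exact (ih h.1).tail ((graph_adj_iff hpq).2 h.2.2)

theorem squares_mk {B : Set Square} (hpq : p < q) (a : B) :
    squares ((graph p q B).connectedComponentMk a) = {b | Conn p q B a b} := by
  ext b
  simp only [squares, Set.mem_image, ConnectedComponent.mem_supp_iff, ConnectedComponent.eq,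
    reachable_iff hpq, Set.mem_ofPred_eq]
  constructor
  · rintro ⟨c, h, rfl⟩
    exact h.symm
  · exact fun h => ⟨⟨b, h.mem a.2⟩, h.symm, rfl⟩

theorem isComp_squares {B : Set Square} (hpq : p < q) (K : (graph p q B).ConnectedComponent) :
    IsComp p q B (squares K) := by
  induction K using ConnectedComponent.ind with
  | _ a => rw [squares_mk hpq]; exact isComp_conn a.2

theorem exists_squares_eq {B S : Set Square} (hpq : p < q) (hS : IsComp p q B S) :
    ∃ K : (graph p q B).ConnectedComponent, squares K = S := by
  obtain ⟨a, ha, rfl⟩ := hS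
  exact ⟨_, squares_mk hpq ⟨a, ha⟩⟩

theorem squares_injective {B : Set Square} {G : SimpleGraph B} :
    Function.Injective (squares (G := G)) := fun _ _ h =>
  ConnectedComponent.supp_injective (Set.image_injective.2 Subtype.val_injective h)

theorem ncard_neighborSet {a : squareBoard (p + q)} (hp : 0 < p) (hpq : p < q)
    (ha : (a : Square) ∉ center p q) :
    ((graph p q (squareBoard (p + q))).neighborSet a).ncard = 2 := by
  have ha' := a.2
  obtain ⟨b, c, hbc, h⟩ := exists_two_neighbors (p := p) (q := q) (by exact_mod_cast hp)
    (by exact_mod_cast hpq) (squareBoard_eq ▸ a.2) ha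
  rw [← Set.ncard_image_of_injective _ Subtype.val_injective, ← Set.ncard_pair hbc]
  congr 1
  ext x
  rw [Set.mem_insert_iff, Set.mem_singleton_iff, ← h]
  constructor
  · rintro ⟨y, hy, rfl⟩
    exact ⟨squareBoard_eq ▸ y.2, (graph_adj_iff hpq).1 hy⟩
  · rintro ⟨hx, hm⟩
    exact ⟨⟨x, squareBoard_eq ▸ hx⟩, (graph_adj_iff hpq).2 hm, rfl⟩

theorem finite_squareBoard (n : ℕ) : (squareBoard n).Finite :=
  (Set.finite_Ico _ _).prod (Set.finite_Ico _ _)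

theorem isIsolated_iff {a : squareBoard (p + q)} (hp : 0 < p) (hpq : p < q) :
    (graph p q (squareBoard (p + q))).IsIsolated a ↔ (a : Square) ∈ center p q := by
  refine ⟨fun h => ?_, fun h b hb => ?_⟩
  · by_contra hc
    obtain ⟨b, hb⟩ := Set.nonempty_of_ncard_ne_zero
      (by rw [ncard_neighborSet hp hpq hc]; norm_num)
    exact h b hb
  · have hb' : (b : Square) ∈ bigBoard p q := squareBoard_eq ▸ b.2
    have hm := (graph_adj_iff hpq).1 hb
    simp only [center, bigBoard, Mv, Set.mem_ofPred_eq] at h hb' hm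
    omega

theorem isCycleComponent_of_notMem_center (hp : 0 < p) (hpq : p < q)
    (K : (graph p q (squareBoard (p + q))).ConnectedComponent)
    (h : ∀ a ∈ squares K, a ∉ center p q) : IsCycleComponent K := by
  have := (finite_squareBoard (p + q)).to_subtype
  refine exists_iso_cycleGraph K.connected_toSimpleGraph fun v => ?_
  rw [← ncard_neighborSet hp hpq (h _ ⟨v.1, v.2, rfl⟩),
    ← Set.ncard_image_of_injective _ Subtype.val_injective]
  congr 1
  ext x
  constructor
  · rintro ⟨y, hy, rfl⟩
    exact hy
  · intro hx
    exact ⟨⟨x, K.mem_supp_of_adj_mem_supp v.2 hx⟩, hx, rfl⟩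

theorem IsCycleComponent.notMem_center (hp : 0 < p) (hpq : p < q)
    {K : (graph p q (squareBoard (p + q))).ConnectedComponent} (h : IsCycleComponent K)
    {a : Square} (ha : a ∈ squares K) : a ∉ center p q := by
  intro hc
  obtain ⟨v, hv, rfl⟩ := ha
  have hi := (isIsolated_iff hp hpq).2 hc
  obtain ⟨n, hn, ⟨e⟩⟩ := h
  obtain ⟨m, rfl⟩ : ∃ m, n = m + 3 := ⟨n - 3, by omega⟩
  have hd := cycleGraph_degree_three_le (n := m) (v := e ⟨v, hv⟩)
  obtain ⟨w, hw⟩ := (degree_pos_iff_exists_adj _ _).1 (hd ▸ two_pos)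
  have h2 : K.toSimpleGraph.Adj ⟨v, hv⟩ (e.symm w) := by
    rw [← e.map_adj_iff]; simpa using hw
  exact hi _ h2

end Graphs
end Leaper

/-! ### Even continued fractions, and the induction along them. -/

namespace Leaper
section ContinuedFractions

variable {init : List (ℕ × ℤˣ)} {last : ℕ}

/-- All terms of a continued fraction are even and positive. -/
def IsPos (init : List (ℕ × ℤˣ)) (last : ℕ) : Prop :=
  ∀ c ∈ init.map Prod.fst ++ [last], Even c ∧ 0 < c

theorem isPos_nil : IsPos [] last ↔ Even last ∧ 0 < last := by
  simp [IsPos]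

theorem isPos_cons {t : ℕ × ℤˣ} : IsPos (t :: init) last ↔ (Even t.1 ∧ 0 < t.1) ∧ IsPos init last := by
  simp only [IsPos, List.map_cons, List.cons_append, List.mem_cons, forall_eq_or_imp]

theorem cfValue_nil : cfValue [] last = last := rfl

theorem cfValue_cons {t : ℕ × ℤˣ} :
    cfValue (t :: init) last = (t.1 : ℚ) + ((t.2 : ℤ) : ℚ) / cfValue init last := rfl

theorem two_le_of_even {c : ℕ} (h : Even c ∧ 0 < c) : 2 ≤ c := by
  obtain ⟨⟨d, rfl⟩, h⟩ := h
  omega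

theorem abs_unit_div_lt {v : ℚ} (hv : 1 < v) (ε : ℤˣ) :
    0 < |((ε : ℤ) : ℚ) / v| ∧ |((ε : ℤ) : ℚ) / v| < 1 := by
  have h : |((ε : ℤ) : ℚ)| = 1 := by
    rcases Int.units_eq_one_or ε with rfl | rfl <;> simp
  rw [abs_div, h, abs_of_pos (by linarith : (0 : ℚ) < v)]
  exact ⟨by positivity, (div_lt_one (by linarith)).2 hv⟩

theorem IsPos.one_lt_cfValue (h : IsPos init last) : 1 < cfValue init last := by
  induction init with
  | nil =>
    rw [isPos_nil] at h
    rw [cfValue_nil]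
    exact_mod_cast two_le_of_even h
  | cons t init ih =>
    rw [isPos_cons] at h
    have h1 : (2 : ℚ) ≤ t.1 := by exact_mod_cast two_le_of_even h.1
    have h2 := abs_lt.1 (abs_unit_div_lt (ih h.2) t.2).2
    rw [cfValue_cons]
    linarith

/-- Only the first term may vanish, and then the value is `0` or `±1/v` with `v > 1`, hence less
than `1`. -/
theorem EvenCF.isPos (x : EvenCF) (h : 1 < x.value) : IsPos x.init x.last := by
  obtain ⟨init, last, even, pos⟩ := x
  intro c hc
  refine ⟨even c hc, ?_⟩
  change 1 < cfValue init last at h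
  cases init with
  | nil =>
    simp only [List.map_nil, List.nil_append, List.mem_singleton] at hc
    subst hc
    rw [cfValue_nil] at h
    have : 1 < c := by exact_mod_cast h
    omega
  | cons t init =>
    rcases List.mem_cons.1 hc with rfl | hc
    · have hp : IsPos init last := fun d hd => ⟨even d (List.mem_cons_of_mem _ hd), pos d hd⟩
      have h2 := abs_lt.1 (abs_unit_div_lt hp.one_lt_cfValue t.2).2
      rw [cfValue_cons] at h
      by_contra! h0
      have : (t.1 : ℚ) = 0 := by exact_mod_cast Nat.le_zero.1 h0
      linarith
    · exact pos c hc

/-- Otherwise `±1/v` would be a nonzero integer of absolute value less than `1`. -/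
theorem natCast_ne_add {v : ℚ} (hv : 1 < v) (ε : ℤˣ) (a b : ℕ) :
    (a : ℚ) ≠ b + ((ε : ℤ) : ℚ) / v := by
  intro h
  obtain ⟨h1, h2⟩ := abs_unit_div_lt hv ε
  rw [show ((ε : ℤ) : ℚ) / v = (((a : ℤ) - b : ℤ) : ℚ) by push_cast; linarith, ← Int.cast_abs]
    at h1 h2
  have h1' : 0 < |(a : ℤ) - b| := by exact_mod_cast h1
  have h2' : |(a : ℤ) - b| < 1 := by exact_mod_cast h2
  omega

theorem IsPos.eq_of_cfValue_eq {init' : List (ℕ × ℤˣ)} {last' : ℕ} (h : IsPos init last)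
    (h' : IsPos init' last') (hv : cfValue init last = cfValue init' last') :
    init = init' ∧ last = last' := by
  induction init generalizing init' with
  | nil =>
    cases init' with
    | nil => exact ⟨rfl, Nat.cast_injective (R := ℚ) hv⟩
    | cons t' init' => exact absurd hv (natCast_ne_add (isPos_cons.1 h').2.one_lt_cfValue _ _ _)
  | cons t init ih =>
    cases init' with
    | nil => exact absurd hv.symm (natCast_ne_add (isPos_cons.1 h).2.one_lt_cfValue _ _ _)
    | cons t' init' =>
      obtain ⟨c, ε⟩ := t
      obtain ⟨c', ε'⟩ := t'
      rw [isPos_cons] at h h'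
      obtain ⟨⟨⟨d, rfl⟩, -⟩, h⟩ := h
      obtain ⟨⟨⟨d', rfl⟩, -⟩, h'⟩ := h'
      have hu := h.one_lt_cfValue
      have hu' := h'.one_lt_cfValue
      have h1 := abs_lt.1 (abs_unit_div_lt hu ε).2
      have h2 := abs_lt.1 (abs_unit_div_lt hu' ε').2
      rw [cfValue_cons, cfValue_cons] at hv
      simp only at hv
      -- The remainders differ by less than `2`, and so do the first terms `2d` and `2d'`; being
      -- even, these agree.
      have hd : d = d' := by
        push_cast at hv
        have h3 : (((d : ℤ) - d' : ℤ) : ℚ) < ((1 : ℤ) : ℚ) := by push_cast; linarith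
        have h4 : ((-1 : ℤ) : ℚ) < (((d : ℤ) - d' : ℤ) : ℚ) := by push_cast; linarith
        rw [Int.cast_lt] at h3 h4
        omega
      subst hd
      have hv := add_left_cancel hv
      have hp : 0 < cfValue init last := by linarith
      have hp' : 0 < cfValue init' last' := by linarith
      have hi := inv_pos.2 hp
      have hi' := inv_pos.2 hp'
      have hboth : ε = ε' ∧ cfValue init last = cfValue init' last' := by
        rw [div_eq_mul_inv, div_eq_mul_inv] at hv
        rcases Int.units_eq_one_or ε with rfl | rfl <;>
        rcases Int.units_eq_one_or ε' with rfl | rfl <;>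
        simp only [Units.val_one, Units.val_neg, Int.cast_one, Int.cast_neg, one_mul, neg_mul] at hv
        · exact ⟨rfl, inv_injective hv⟩
        · linarith
        · linarith
        · exact ⟨rfl, inv_injective (neg_injective hv)⟩
      obtain ⟨rfl, rfl⟩ := ih h h' hboth.2
      rw [hboth.1]
      exact ⟨rfl, rfl⟩

theorem exists_even_division {p q : ℕ} (hp : 1 < p) (hpq : p < q) (hc : p.Coprime q)
    (ho : Odd (p + q)) : ∃ (m r : ℕ) (ε : ℤˣ), 0 < r ∧ r < p ∧ r.Coprime p ∧ Odd (r + p) ∧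
      (q : ℤ) = 2 * ((m + 1) * p) + ε * r := by
  have key : ∀ (m r : ℕ) (ε : ℤˣ), r < p → (q : ℤ) = 2 * ((m + 1) * p) + ε * r →
      ∃ (m r : ℕ) (ε : ℤˣ), 0 < r ∧ r < p ∧ r.Coprime p ∧ Odd (r + p) ∧
      (q : ℤ) = 2 * ((m + 1) * p) + ε * r := by
    intro m r ε hr h
    have hcop : r.Coprime p := by
      rw [← Nat.isCoprime_iff_coprime] at hc ⊢
      rw [h, show (2 : ℤ) * ((m + 1) * p) + ε * r = ε * r + p * (2 * (m + 1)) by ring,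
        IsCoprime.add_mul_left_right_iff] at hc
      exact (hc.symm.of_mul_left_right)
    refine ⟨m, r, ε, ?_, hr, hcop, ?_, h⟩
    · rcases Nat.eq_zero_or_pos r with rfl | h0
      · rw [Nat.coprime_zero_left] at hcop; omega
      · exact h0
    · rw [← Int.odd_coe_nat] at ho ⊢
      push_cast at ho ⊢
      rw [h] at ho
      obtain ⟨k, hk⟩ := ho
      generalize ((m : ℤ) + 1) * p = z at *
      rcases Int.units_eq_one_or ε with rfl | rfl
      · exact ⟨k - z, by simp at hk; omega⟩
      · exact ⟨k - z + r, by simp at hk; omega⟩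
  have hdm := Nat.div_add_mod q (2 * p)
  have hlt := Nat.mod_lt q (show 0 < 2 * p by omega)
  set d := q / (2 * p)
  set e := q % (2 * p)
  -- If `q` were an odd multiple of `p`, coprimality would force `p = 1`. In all other cases an even
  -- multiple of `p` lies at distance less than `p` from `q`.
  have hne : e ≠ p := by
    intro he
    have : p ∣ q := ⟨2 * d + 1, by rw [← hdm, he]; ring⟩
    have := hc.eq_one_of_dvd this
    omega
  have hdm' : (q : ℤ) = 2 * (d * p) + e := by rw [← hdm]; push_cast; ring
  rcases Nat.lt_or_gt_of_ne hne with he | he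
  · obtain ⟨d', hd'⟩ : ∃ d', d = d' + 1 := Nat.exists_eq_succ_of_ne_zero (by
      rintro h0; rw [h0] at hdm; omega)
    exact key d' e 1 he (by rw [hdm', hd']; push_cast; ring)
  · exact key d (2 * p - e) (-1) (by omega) (by
      rw [hdm']; push_cast [Nat.cast_sub hlt.le]; ring)

theorem exists_cfValue_eq {p q : ℕ} (hp : 0 < p) (hpq : p < q) (hc : p.Coprime q)
    (ho : Odd (p + q)) : ∃ init last, IsPos init last ∧ cfValue init last = (q : ℚ) / p := by
  induction p using Nat.strong_induction_on generalizing q with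
  | _ p ih =>
    rcases Nat.eq_or_lt_of_le (Nat.succ_le_of_lt hp) with h1 | h1
    · obtain rfl : p = 1 := h1.symm
      refine ⟨[], q, isPos_nil.2 ⟨?_, by omega⟩, by simp [cfValue_nil]⟩
      obtain ⟨k, hk⟩ := ho
      exact ⟨k, by omega⟩
    · obtain ⟨m, r, ε, hr, hrp, hcop, hodd, h⟩ := exists_even_division h1 hpq hc ho
      obtain ⟨init, last, hpos, hv⟩ := ih r hrp hr hrp hcop hodd
      refine ⟨(2 * (m + 1), ε) :: init, last, isPos_cons.2 ⟨⟨even_two_mul _, by positivity⟩, hpos⟩, ?_⟩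
      have hp' : (p : ℚ) ≠ 0 := by positivity
      have hr' : (r : ℚ) ≠ 0 := by positivity
      have hq : (q : ℚ) = 2 * ((m + 1) * p) + ((ε : ℤ) : ℚ) * r := by exact_mod_cast h
      rw [cfValue_cons, hv, hq]
      push_cast
      field_simp

theorem existsUnique_evenCF {p q : ℕ} (hp : 0 < p) (hpq : p < q) (hc : p.Coprime q)
    (ho : Odd (p + q)) : ∃! x : EvenCF, x.value = (q : ℚ) / p := by
  obtain ⟨init, last, hpos, hv⟩ := exists_cfValue_eq hp hpq hc ho
  refine ⟨⟨init, last, fun c h => (hpos c h).1, fun c h => (hpos c (List.mem_of_mem_tail h)).2⟩,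
    hv, fun y hy => ?_⟩
  have hpos' := y.isPos (by
    rw [hy, one_lt_div (by exact_mod_cast hp)]
    exact_mod_cast hpq)
  obtain ⟨h1, h2⟩ := hpos'.eq_of_cfValue_eq hpos (hy.trans hv.symm)
  obtain ⟨init', last', _, _⟩ := y
  subst h1 h2
  rfl

theorem den_div_natCast {p q : ℕ} (hp : 0 < p) (hc : p.Coprime q) : ((q : ℚ) / p).den = p := by
  have := Rat.den_div_eq_of_coprime (a := q) (b := p) (by exact_mod_cast hp) (by simpa using hc.symm)
  simpa only [Int.cast_natCast, Nat.cast_inj] using this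

theorem num_div_natCast {p q : ℕ} (hp : 0 < p) (hc : p.Coprime q) : ((q : ℚ) / p).num = q := by
  have := Rat.num_div_eq_of_coprime (a := q) (b := p) (by exact_mod_cast hp) (by simpa using hc.symm)
  simpa only [Int.cast_natCast, Nat.cast_inj] using this

/-- The denominators of the tails of a continued fraction, followed by `0`. -/
def tailDen (init : List (ℕ × ℤˣ)) (last i : ℕ) : ℤ :=
  if i < init.length + 1 then ((cfValue (init.drop i) last).den : ℤ) else 0

/-- The numerators of the tails of a positive continued fraction, followed by `1`. -/
def tailNum (init : List (ℕ × ℤˣ)) (last i : ℕ) : ℤ :=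
  if i < init.length + 1 then ((cfValue (init.drop i) last).num.toNat : ℤ) else 1

theorem tailDen_zero {p q : ℕ} (hp : 0 < p) (hc : p.Coprime q)
    (hv : cfValue init last = (q : ℚ) / p) : tailDen init last 0 = p := by
  simp [tailDen, hv, den_div_natCast hp hc]

theorem tailNum_zero {p q : ℕ} (hp : 0 < p) (hc : p.Coprime q)
    (hv : cfValue init last = (q : ℚ) / p) : tailNum init last 0 = q := by
  simp [tailNum, hv, num_div_natCast hp hc]

theorem tailDen_cons_succ {t : ℕ × ℤˣ} (i : ℕ) :
    tailDen (t :: init) last (i + 1) = tailDen init last i := by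
  simp [tailDen]

theorem tailNum_cons_succ {t : ℕ × ℤˣ} (i : ℕ) :
    tailNum (t :: init) last (i + 1) = tailNum init last i := by
  simp [tailNum]

/-- Removing the first term `2(n + 1)` and its sign `ε` replaces `q/p` by `p/r`, where `q = 2(n +
1)p + εr`. This is the division under which components are lifted. -/
theorem classified_cfValue {p q : ℕ} (hpos : IsPos init last) (hp : 0 < p) (hc : p.Coprime q)
    (hv : cfValue init last = (q : ℚ) / p) :
    Classified (init.length + 1) p q (tailDen init last) (tailNum init last) := by
  have hP0 := tailDen_zero hp hc hv
  have hQ0 := tailNum_zero hp hc hv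
  have hpq : p < q := by
    have := hpos.one_lt_cfValue
    rw [hv, one_lt_div (by exact_mod_cast hp)] at this
    exact_mod_cast this
  have hp' : (p : ℚ) ≠ 0 := by positivity
  induction init generalizing p q with
  | nil =>
    rw [isPos_nil] at hpos
    rw [cfValue_nil] at hv
    have h1 : p = 1 := by rw [← den_div_natCast hp hc, ← hv]; simp
    subst h1
    have hq : last = q := by simpa using hv
    subst hq
    obtain ⟨⟨d, rfl⟩, hd⟩ := hpos
    obtain ⟨n, rfl⟩ : ∃ n, d = n + 1 := ⟨d - 1, by omega⟩
    have H : Params 1 ((n + 1 + (n + 1) : ℕ) : ℤ) 0 (n + 1) :=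
      ⟨one_pos, by norm_num, one_pos, by omega, by push_cast; ring⟩
    -- Index `1` is past the last tail, so `tailDen` and `tailNum` take their default values `0` and
    -- `1`, the proportions of the leaper on a single square.
    exact Classified.succ (by simp) (by exact_mod_cast hpq) (lifting_pos le_rfl H) hP0 hQ0
      (by simp [tailDen]) (by simp [tailNum]) le_rfl
      (classified_zero (by simp [tailDen]) (by simp [tailNum]))
  | cons t init ih =>
    obtain ⟨c, ε⟩ := t
    rw [isPos_cons] at hpos
    obtain ⟨⟨⟨d, rfl⟩, hd⟩, hpos⟩ := hpos
    obtain ⟨n, rfl⟩ : ∃ n, d = n + 1 := ⟨d - 1, by simp at hd; omega⟩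
    have hv1 := hpos.one_lt_cfValue
    rw [cfValue_cons] at hv
    simp only at hv
    set v := cfValue init last
    have hv0 : v ≠ 0 := by linarith
    have hεε : ((ε : ℤ) : ℚ) * ((ε : ℤ) : ℚ) = 1 := by
      rcases Int.units_eq_one_or ε with rfl | rfl <;> simp
    have hεε' : (ε : ℤ) * (ε : ℤ) = 1 := by exact_mod_cast hεε
    -- The integer `ε(q - 2(n + 1)p)` equals `p / v`, so it is positive and, as `v > 1`, less than
    -- `p`; it serves as `r`.
    have hr : (((ε : ℤ) * (q - 2 * ((n + 1) * p)) : ℤ) : ℚ) * v = p := by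
      have : (q : ℚ) = (2 * (n + 1) + ((ε : ℤ) : ℚ) / v) * p := by
        rw [eq_div_iff hp'] at hv
        rw [← hv]; push_cast; ring
      push_cast
      rw [this]
      field_simp
      linear_combination hεε
    obtain ⟨r, hrr⟩ : ∃ r : ℕ, (ε : ℤ) * (q - 2 * ((n + 1) * p)) = r := by
      refine ⟨_, (Int.toNat_of_nonneg ?_).symm⟩
      by_contra! hneg
      have h1 : (((ε : ℤ) * (q - 2 * ((n + 1) * p)) : ℤ) : ℚ) < 0 := by exact_mod_cast hneg
      have h2 : (0 : ℚ) < p := by positivity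
      nlinarith
    rw [hrr, Int.cast_natCast] at hr
    have hq : (q : ℤ) = 2 * ((n + 1) * p) + ε * r := by
      rw [← hrr]; linear_combination (-(q : ℤ) + 2 * ((n + 1) * p)) * hεε'
    have hr0 : 0 < r := by
      rcases Nat.eq_zero_or_pos r with rfl | h
      · exact absurd (by simpa using hr.symm) hp'
      · exact h
    have hrp : (r : ℤ) < p := by
      have : (0 : ℚ) < r := by positivity
      have : (r : ℚ) < p := by nlinarith
      exact_mod_cast this
    have hr0' : (r : ℚ) ≠ 0 := by positivity
    have hcop : r.Coprime p := by
      rw [← Nat.isCoprime_iff_coprime] at hc ⊢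
      rw [hq, show (2 : ℤ) * ((n + 1) * p) + ε * r = ε * r + p * (2 * (n + 1)) by ring,
        IsCoprime.add_mul_left_right_iff] at hc
      exact hc.symm.of_mul_left_right
    have hvr : v = (p : ℚ) / r := by
      rw [eq_div_iff hr0', mul_comm]; exact hr
    have hD := tailDen_zero hr0 hcop hvr
    have hN := tailNum_zero hr0 hcop hvr
    have IH := ih hpos hr0 hcop hvr hD hN (by exact_mod_cast hrp) hr0'
    obtain ⟨Φ, hΦ⟩ : ∃ Φ, Lifting r p q Φ := by
      rcases Int.units_eq_one_or ε with rfl | rfl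
      · exact ⟨_, lifting_pos (n := n) (by positivity) ⟨by exact_mod_cast hp, by omega, hrp,
          by omega, by rw [hq]; simp⟩⟩
      · exact ⟨_, lifting_neg (n := n) (by positivity) ⟨by exact_mod_cast hp, by omega, by omega,
          by omega, by rw [hq]; simp⟩⟩
    exact Classified.succ (by positivity) (by exact_mod_cast hpq) hΦ hP0 hQ0
      (by rw [tailDen_cons_succ]; exact hD) (by rw [tailNum_cons_succ]; exact hN) (by positivity)
      (by simpa only [tailDen_cons_succ, tailNum_cons_succ, List.length_cons] using IH)

end ContinuedFractions
end Leaper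

/-! ### Transfer to the leaper graph, and the theorem. -/

namespace Leaper
section Main

open SimpleGraph

theorem EvenCF.coe_p (x : EvenCF) (i : ℕ) : (x.p i : ℤ) = tailDen x.init x.last i := by
  simp only [EvenCF.p, tailDen, EvenCF.length, EvenCF.tailValue]
  split_ifs with h <;> simp [h]

theorem EvenCF.coe_q (x : EvenCF) (i : ℕ) : (x.q i : ℤ) = tailNum x.init x.last i := by
  simp only [EvenCF.q, tailNum, EvenCF.length, EvenCF.tailValue]
  split_ifs with h <;> simp [h]

variable {p q : ℕ}

theorem ncard_isIsolated (hp : 0 < p) (hpq : p < q) :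
    ({v | (graph p q (squareBoard (p + q))).IsIsolated v}.ncard : ℤ) = ((q : ℤ) - p) ^ 2 := by
  rw [← ncard_center (by exact_mod_cast hpq.le),
    ← Set.ncard_image_of_injective _ Subtype.val_injective]
  congr 2
  ext a
  constructor
  · rintro ⟨v, hv, rfl⟩
    exact (isIsolated_iff hp hpq).1 hv
  · intro ha
    have hb : a ∈ squareBoard (p + q) := by
      rw [squareBoard_eq]
      simp only [center, bigBoard, Set.mem_ofPred_eq] at ha ⊢
      omega
    exact ⟨⟨a, hb⟩, (isIsolated_iff hp hpq).2 ha, rfl⟩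

theorem supp_eq_singleton_or_isCycleComponent (hp : 0 < p) (hpq : p < q)
    (K : (graph p q (squareBoard (p + q))).ConnectedComponent) :
    (∃ v, (graph p q (squareBoard (p + q))).IsIsolated v ∧ K.supp = {v}) ∨
      IsCycleComponent K := by
  by_cases h : ∀ a ∈ squares K, a ∉ center p q
  · exact .inr (isCycleComponent_of_notMem_center hp hpq K h)
  · push Not at h
    obtain ⟨a, ha, hc⟩ := h
    have hs := eq_singleton_of_mem_center (by positivity) (squareBoard_eq ▸ isComp_squares hpq K)
      ha hc
    obtain ⟨v, hv, rfl⟩ := ha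
    refine .inl ⟨v, (isIsolated_iff hp hpq).2 hc, Set.image_injective.2 Subtype.val_injective ?_⟩
    rw [Set.image_singleton]
    exact hs

end Main
end Leaper

theorem theorem3 (p q : ℕ) (hskew : Leaper.IsSkew p q) (hbasic : Leaper.IsBasic p q)
    (hpq : p < q) :
    (∃! x : Leaper.EvenCF, x.value = (q : ℚ) / (p : ℚ)) ∧
    ∀ x : Leaper.EvenCF, x.value = (q : ℚ) / (p : ℚ) →
      ({v | (Leaper.graph p q (Leaper.squareBoard (p + q))).IsIsolated v}.ncard : ℤ)
          = ((q : ℤ) - p) ^ 2 ∧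
      (∀ K : (Leaper.graph p q (Leaper.squareBoard (p + q))).ConnectedComponent,
        (∃ v, (Leaper.graph p q (Leaper.squareBoard (p + q))).IsIsolated v ∧ K.supp = {v}) ∨
          Leaper.IsCycleComponent K) ∧
      ∃ type : {K : (Leaper.graph p q (Leaper.squareBoard (p + q))).ConnectedComponent //
          Leaper.IsCycleComponent K} → ℕ,
        (∀ C, type C ∈ Set.Icc 1 x.length) ∧
        (∀ C C', type C = type C' ↔
          Leaper.IsTranslate (Leaper.squares C.1) (Leaper.squares C'.1)) ∧
        ∀ i ∈ Set.Icc 1 x.length,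
          ({C | type C = i}.ncard : ℤ) = ((x.q i : ℤ) - x.p i) ^ 2 ∧
          ∀ C, type C = i → Leaper.IsTouredBy (x.p i) (x.q i) (Leaper.squares C.1) := by
  obtain ⟨hodd, hcop⟩ := hbasic
  have hp : 0 < p := Nat.pos_of_ne_zero hskew.1
  refine ⟨Leaper.existsUnique_evenCF hp hpq hcop hodd, fun x hx =>
    ⟨Leaper.ncard_isIsolated hp hpq, Leaper.supp_eq_singleton_or_isCycleComponent hp hpq, ?_⟩⟩
  have hpos := x.isPos (by
    rw [hx, one_lt_div (by exact_mod_cast hp)]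
    exact_mod_cast hpq)
  obtain ⟨τ, hle, hzero, htr, hcard, htour⟩ := Leaper.classified_cfValue hpos hp hcop hx
  have hcomp : ∀ K : (Leaper.graph p q (Leaper.squareBoard (p + q))).ConnectedComponent,
      Leaper.IsComp p q (Leaper.bigBoard p q) (Leaper.squares K) := fun K =>
    Leaper.squareBoard_eq ▸ Leaper.isComp_squares hpq K
  refine ⟨fun C => τ (Leaper.squares C.1), fun C => ⟨?_, hle _ (hcomp C.1)⟩,
    fun C C' => htr _ _ (hcomp C.1) (hcomp C'.1), fun i hi => ⟨?_, fun C hC => ?_⟩⟩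
  -- Type `0` is reserved for the central squares, and these lie on no cycle.
  · obtain ⟨a, ha⟩ := (hcomp C.1).nonempty
    rw [Nat.one_le_iff_ne_zero, ne_eq, hzero _ (hcomp C.1) a ha]
    exact C.2.notMem_center hp hpq ha
  · rw [x.coe_q, x.coe_p, ← hcard i hi.2,
      ← Set.ncard_image_of_injective _ (Leaper.squares_injective.comp Subtype.val_injective)]
    congr 2
    ext S
    constructor
    · rintro ⟨C, hC, rfl⟩
      exact ⟨hcomp C.1, hC⟩
    · rintro ⟨hS, hSi⟩
      obtain ⟨K, rfl⟩ := Leaper.exists_squares_eq hpq (Leaper.squareBoard_eq.symm ▸ hS)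
      refine ⟨⟨K, Leaper.isCycleComponent_of_notMem_center hp hpq K fun a ha hc => ?_⟩, hSi, rfl⟩
      have h0 := (hzero _ hS a ha).2 hc
      have := hi.1
      omega
  · obtain ⟨T⟩ := htour i hi.1 _ (hcomp C.1) hC
    rw [← x.coe_p, ← x.coe_q] at T
    exact T.isTouredBy (by exact_mod_cast hpq.le)
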